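/- **Conventions.** All parameters $r,q,m,d,t,\sigma,\dots$ are functions from positive integers to positive integers, and inputs are nonempty binary strings. An $(r,q,m,d,t)$-restricted verifier over $\Sigma=\{0,1\}^\sigma$ is an algorithm $V$ (a random access machine with unit-cost addition, subtraction, integer division and remainder) that, on an input $x$ of length $n$ and coins $R\in\{0,1\}^{r(n)}$, outputs within $t(n)$ steps query locations $i^{(1)},\dots,i^{(q)}\in[m(n)]$, $q=q(n)$, and a Boolean circuit $D:\Sigma^{q}\to\{0,1\}$ with at most $d(n)$ vertices. It is a robust PCP for a language $L$ with robust-soundness error $s$ and robustness parameter $\rho$ (functions from positive integers to $[0,1]$) if for $x\in L$ some $\pi\in\Sigma^m$ satisfies $\Pr_R[D(\pi|_I)=1]=1$, and for $x\notin L$ every $\pi\in\Sigma^m$ satisfies $\Pr_R[\exists a:\ D(a)=1,\ \delta(a,\pi|_I)\le\rho(n)]<s(n)$, where $I=(i^{(1)},\dots,i^{(q)})$ and $\delta$ is the relative Hamming distance over the alphabet $\Sigma$. Configurations $(R,k)\in\{0,1\}^r\times[q]$ are neighbors if they yield the same query location. Let $\tau$ take values in $[0,1)$ (a constant, or more generally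 a function of $n$), and fix for each $n$ a partition of the coin positions into $R=(R_{\rm row},R_{\rm col},R_{\rm sh.row},R_{\rm sh.col})$ with parts of sizes $\frac{(1-\tau)r}2,\frac{(1-\tau)r}2,\frac{\tau r}2,\frac{\tau r}2$ (assumed to be integers). $V$ has $\tau$-RNL (rectangular neighbor listing) with this partition and time $T(n)$ if there are two algorithms running within $T(n)$ steps, a row agent with input $(x,R_{\rm row},R_{\rm sh.row},R_{\rm sh.col},k)$ and a column agent with input $(x,R_{\rm col},R_{\rm sh.row},R_{\rm sh.col},k)$, which output a list of tuples $(R'_{\rm row},R'_{\rm sh.row},k')$, respectively $(R'_{\rm col},R'_{\rm sh.col},k')$, and an index, such that for every $x$ and every configuration $(R,k)$: the two lists have the same length and entrywise the same $k'$; the zipped list of full configurations contains each neighbor of $(R,k)$ exactly once and nothing else; it is the same ordered list for any two neighboring configurations; and each agent's index is the position of $(R,k)$ in it. **Lemma.** There are universal constants $\delta\in(0,1]$ and $C,c\in\mathbb N$, $C\ge1$, such that the following holds. Suppose that a language $L$ has a robust PCP with an $(r,q,m,d,t)$-restricted verifier $V$ over the alphabet $\Sigma=\{0,1\}^{\sigma}$,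 so $\log_2|\Sigma|=\sigma=\sigma(n)$, with robust-soundness error $s$ and robustness parameter $\rho$. Then there are a function $b$ with $b(n)\le C\,\sigma(n)$ and an $(r,\ q b,\ m b,\ C\sigma^{c} d,\ C\sigma^{c} t)$-restricted verifier $V'$ over the alphabet $\{0,1\}$ that is a robust PCP for $L$ with robust-soundness error $s$ and robustness parameter $\delta\rho$. Moreover, for every $\tau$, every partition of the coins and every $T$: if $V$ has $\tau$-RNL with that partition and time $T$, then $V'$ has $\tau$-RNL with the same partition and time $C\sigma^{c}(T+t)$; and also with time $C\sigma^{c}(T+T_\sigma)$ for every $T_\sigma$ such that $\sigma(n)$ can be computed from every input of length $n$ within $T_\sigma(n)$ steps. -/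

import Mathlib

noncomputable section

namespace RobustPCP

/-! ## Machine model

A random access machine with unit cost, presented as a structured programming language.  A program
is a fixed finite text; it uses finitely many scalar variables and finitely many arrays, holding
natural numbers, all `0` at the start.  The inputs are read-only sequences of naturals with random
access, the outputs are write-only streams of naturals.  Multiplication is not a primitive, so the
bit length of any number grows by at most one in each step. -/

/-- The unit-cost arithmetic operations (`sub` is truncated, division by zero follows `ℕ`). -/
inductive Op
  | add
  | sub
  | div
  | mod

def Op.eval : Op → ℕ → ℕ → ℕ
  | .add, a, b => a + b
  | .sub, a, b => a - b
  | .div, a, b => a / b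
  | .mod, a, b => a % b

/-- Programs. Variables, arrays, input sequences and output streams are named by naturals. -/
inductive Cmd
  /-- do nothing -/
  | skip
  /-- `v := c` -/
  | const (v c : ℕ)
  /-- `v := a o b`, where `a`, `b` are variables -/
  | arith (o : Op) (v a b : ℕ)
  /-- `v := A[i]`, where `i` is a variable -/
  | load (v A i : ℕ)
  /-- `A[i] := v`, where `i`, `v` are variables -/
  | store (A i v : ℕ)
  /-- `v :=` entry number `i` of input sequence `j` (`0` past its end), where `i` is a variable -/
  | read (v j i : ℕ)
  /-- `v :=` the length of input sequence `j` -/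
  | len (v j : ℕ)
  /-- append the value of the variable `v` to the output stream `w` -/
  | out (w v : ℕ)
  /-- run one program, then the other -/
  | seq (p p' : Cmd)
  /-- run `p` if the variable `v` is nonzero and `p'` otherwise -/
  | cond (v : ℕ) (p p' : Cmd)
  /-- run `p` as long as the variable `v` is nonzero -/
  | loop (v : ℕ) (p : Cmd)

structure State where
  var : ℕ → ℕ
  arr : ℕ → ℕ → ℕ
  out : ℕ → List ℕ

def State.start : State where
  var _ := 0
  arr _ _ := 0
  out _ := []

def State.setVar (s : State) (v a : ℕ) : State :=
  { s with var := Function.update s.var v a }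

/-- `Exec inp p s T s'`: on the input sequences `inp`, the program `p` started in the state `s`
halts in the state `s'` after exactly `T` steps. -/
inductive Exec (inp : List (List ℕ)) : Cmd → State → ℕ → State → Prop
  | skip (s : State) : Exec inp .skip s 1 s
  | const (v c : ℕ) (s : State) : Exec inp (.const v c) s 1 (s.setVar v c)
  | arith (o : Op) (v a b : ℕ) (s : State) :
      Exec inp (.arith o v a b) s 1 (s.setVar v (o.eval (s.var a) (s.var b)))
  | load (v A i : ℕ) (s : State) :
      Exec inp (.load v A i) s 1 (s.setVar v (s.arr A (s.var i)))
  | store (A i v : ℕ) (s : State) :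
      Exec inp (.store A i v) s 1
        { s with arr := Function.update s.arr A
                          (Function.update (s.arr A) (s.var i) (s.var v)) }
  | read (v j i : ℕ) (s : State) :
      Exec inp (.read v j i) s 1 (s.setVar v ((inp.getD j []).getD (s.var i) 0))
  | len (v j : ℕ) (s : State) :
      Exec inp (.len v j) s 1 (s.setVar v (inp.getD j []).length)
  | out (w v : ℕ) (s : State) :
      Exec inp (.out w v) s 1
        { s with out := Function.update s.out w (s.out w ++ [s.var v]) }
  | seq {p p' : Cmd} {s₁ s₂ s₃ : State} {T T' : ℕ} :
      Exec inp p s₁ T s₂ → Exec inp p' s₂ T' s₃ → Exec inp (.seq p p') s₁ (T + T') s₃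
  | condTrue {v : ℕ} {p p' : Cmd} {s s' : State} {T : ℕ} :
      s.var v ≠ 0 → Exec inp p s T s' → Exec inp (.cond v p p') s (T + 1) s'
  | condFalse {v : ℕ} {p p' : Cmd} {s s' : State} {T : ℕ} :
      s.var v = 0 → Exec inp p' s T s' → Exec inp (.cond v p p') s (T + 1) s'
  | loopStop {v : ℕ} {p : Cmd} {s : State} :
      s.var v = 0 → Exec inp (.loop v p) s 1 s
  | loopStep {v : ℕ} {p : Cmd} {s₁ s₂ s₃ : State} {T T' : ℕ} :
      s₁.var v ≠ 0 → Exec inp p s₁ T s₂ → Exec inp (.loop v p) s₂ T' s₃ →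
        Exec inp (.loop v p) s₁ (T + T' + 1) s₃

/-- On the inputs `inp`, the program `p` halts within `T` steps, and its output streams satisfy
`Q`. -/
def HaltsWithin (p : Cmd) (inp : List (List ℕ)) (T : ℕ) (Q : (ℕ → List ℕ) → Prop) : Prop :=
  ∃ T' ≤ T, ∃ s', Exec inp p State.start T' s' ∧ Q s'.out

/-- A bit string as a sequence of naturals. -/
def bits {k : ℕ} (u : Fin k → Bool) : List ℕ := List.ofFn fun i => (u i).toNat

/-! ## Boolean circuits -/

/-- Gates; the arguments are the numbers of the vertices that are fed into the gate. -/
inductive Gate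
  | and (a b : ℕ)
  | or (a b : ℕ)
  | not (a : ℕ)

/-- All inputs of the gate are vertices with a number below `k`. -/
def Gate.Below (k : ℕ) : Gate → Prop
  | .and a b => a < k ∧ b < k
  | .or a b => a < k ∧ b < k
  | .not a => a < k

/-- The value of a gate, given the values of the earlier vertices. -/
def Gate.eval (vals : List Bool) : Gate → Bool
  | .and a b => vals.getD a false && vals.getD b false
  | .or a b => vals.getD a false || vals.getD b false
  | .not a => !vals.getD a false

def Gate.code : Gate → List ℕ
  | .and a b => [0, a, b]
  | .or a b => [1, a, b]
  | .not a => [2, a, a]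

/-- Boolean circuits with `N` inputs and fan-in at most two. The vertices are numbered: first the
inputs, `0, …, N - 1`, then the gates in topological order. The last vertex is the output. -/
structure Circuit (N : ℕ) where
  gates : List Gate
  acyclic : ∀ (i : ℕ) (h : i < gates.length), (gates[i]).Below (N + i)

/-- The number of vertices (inputs and gates). -/
def Circuit.size {N : ℕ} (D : Circuit N) : ℕ := N + D.gates.length

def Circuit.eval {N : ℕ} (D : Circuit N) (z : Fin N → Bool) : Bool :=
  (D.gates.foldl (fun vals g => vals ++ [g.eval vals]) (List.ofFn z)).getLastD false

/-- The description of a circuit: the number of inputs, then the gates. -/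
def Circuit.code {N : ℕ} (D : Circuit N) : List ℕ := N :: D.gates.flatMap Gate.code

/-- The predicate on `q` symbols of `{0,1}^σ` that is computed by a circuit on `q * σ` bits (the
bits of the symbol number `k` are the inputs `k * σ, …, k * σ + σ - 1`). -/
def Circuit.Accepts {q σ : ℕ} (D : Circuit (q * σ)) (a : Fin q → Fin σ → Bool) : Prop :=
  D.eval (fun i => a (finProdFinEquiv.symm i).1 (finProdFinEquiv.symm i).2) = true

/-! ## PCP verifiers -/

/-- An `(r, q, m, d, t)`-restricted (non-adaptive) verifier over the alphabet `{0,1}^σ`: a program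
that, on an input `x` of length `n` and coins `R ∈ {0,1}^{r n}`, writes `q n` locations in a proof
of length `m n` and a circuit of size at most `d n` for the decision predicate, within `t n` steps.
`query` and `pred` are the locations and the predicate that the program produces. -/
structure Verifier (r q m d t σ : ℕ+ → ℕ+) where
  prog : Cmd
  query : ∀ {n : ℕ+}, (Fin n → Bool) → (Fin (r n) → Bool) → Fin (q n) → Fin (m n)
  pred : ∀ {n : ℕ+}, (Fin n → Bool) → (Fin (r n) → Bool) → Circuit (q n * σ n)
  size_le : ∀ {n : ℕ+} (x : Fin n → Bool) (R : Fin (r n) → Bool), (pred x R).size ≤ d n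
  run : ∀ {n : ℕ+} (x : Fin n → Bool) (R : Fin (r n) → Bool),
    HaltsWithin prog [bits x, bits R] (t n) fun out =>
      out 0 = List.ofFn (fun k => (query x R k : ℕ)) ∧ out 1 = (pred x R).code

/-- The probability of an event over uniformly random coins. -/
def prob {r : ℕ} (E : (Fin r → Bool) → Prop) : ℝ :=
  ({R | E R}.ncard : ℝ) / 2 ^ r

/-- Relative Hamming distance. -/
def relDist {q : ℕ} {A : Type} [DecidableEq A] (u v : Fin q → A) : ℝ :=
  (hammingDist u v : ℝ) / q

section

variable {r q m d t σ : ℕ+ → ℕ+} (V : Verifier r q m d t σ)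

/-- The symbols that the verifier reads from the proof `π`. -/
def Verifier.answers {n : ℕ+} (x : Fin n → Bool) (π : Fin (m n) → Fin (σ n) → Bool)
    (R : Fin (r n) → Bool) : Fin (q n) → Fin (σ n) → Bool :=
  fun k => π (V.query x R k)

/-- `V` is a PCP verifier for the language `L`, with perfect completeness and with robust-soundness
error `s` and robustness parameter `ρ`. -/
structure Verifier.IsRobustPCP (L : Language Bool) (s ρ : ℕ+ → ℝ) : Prop where
  complete : ∀ {n : ℕ+} (x : Fin n → Bool), List.ofFn x ∈ L →
    ∃ π : Fin (m n) → Fin (σ n) → Bool,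
      prob (fun R => (V.pred x R).Accepts (V.answers x π R)) = 1
  robust : ∀ {n : ℕ+} (x : Fin n → Bool), List.ofFn x ∉ L →
    ∀ π : Fin (m n) → Fin (σ n) → Bool,
      prob (fun R => ∃ a : Fin (q n) → Fin (σ n) → Bool,
        (V.pred x R).Accepts a ∧ relDist a (V.answers x π R) ≤ ρ n) < s n

end

/-! ## Rectangular neighbor listing -/

/-- A partition of the `r n` coins into a row part and a column part of `(1 - τ) r / 2` coins each,
and a row-shared part and a column-shared part of `τ r / 2` coins each. -/
structure CoinPartition (r : ℕ+ → ℕ+) (τ : ℕ+ → ℝ) where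
  own : ℕ+ → ℕ
  shared : ℕ+ → ℕ
  own_eq : ∀ n, (own n : ℝ) = (1 - τ n) * (r n : ℕ) / 2
  shared_eq : ∀ n, (shared n : ℝ) = τ n * (r n : ℕ) / 2
  split : ∀ n, (Fin (own n) ⊕ Fin (own n)) ⊕ (Fin (shared n) ⊕ Fin (shared n)) ≃ Fin (r n)

namespace CoinPartition

variable {r : ℕ+ → ℕ+} {τ : ℕ+ → ℝ} (P : CoinPartition r τ) {n : ℕ+}

def row (R : Fin (r n) → Bool) : Fin (P.own n) → Bool := fun i => R (P.split n (.inl (.inl i)))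

def col (R : Fin (r n) → Bool) : Fin (P.own n) → Bool := fun i => R (P.split n (.inl (.inr i)))

def sharedRow (R : Fin (r n) → Bool) : Fin (P.shared n) → Bool :=
  fun i => R (P.split n (.inr (.inl i)))

def sharedCol (R : Fin (r n) → Bool) : Fin (P.shared n) → Bool :=
  fun i => R (P.split n (.inr (.inr i)))

/-- The coins with the given row, column, row-shared and column-shared parts. -/
def join (u v : Fin (P.own n) → Bool) (w z : Fin (P.shared n) → Bool) : Fin (r n) → Bool :=
  fun i => Sum.elim (Sum.elim u v) (Sum.elim w z) ((P.split n).symm i)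

/-- The list entries of the agents: `(R'_row, R'_shared.row, k')` for the row agent, and
`(R'_col, R'_shared.col, k')` for the column agent. -/
abbrev Entry (n : ℕ+) (q : ℕ) : Type :=
  (Fin (P.own n) → Bool) × (Fin (P.shared n) → Bool) × Fin q

/-- What an agent answers to each of its inputs, a row (or column) configuration
`(R_row, R_shared.row, R_shared.col, k)`: a list of entries and an index. -/
abbrev Answer (n : ℕ+) (q : ℕ) : Type :=
  (Fin (P.own n) → Bool) → (Fin (P.shared n) → Bool) → (Fin (P.shared n) → Bool) → Fin q →
    List (P.Entry n q) × ℕ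

/-- On the input `x`, the program `A` computes the answer function `F` within time `T`. -/
def Computes {q : ℕ} (A : Cmd) (x : Fin n → Bool) (T : ℕ) (F : P.Answer n q) : Prop :=
  ∀ u w z (k : Fin q), HaltsWithin A [bits x, bits u, bits w, bits z, [(k : ℕ)]] T fun out =>
    out 0 = (F u w z k).1.flatMap (fun e => bits e.1) ∧
    out 1 = (F u w z k).1.flatMap (fun e => bits e.2.1) ∧
    out 2 = (F u w z k).1.map (fun e => (e.2.2 : ℕ)) ∧
    out 3 = [(F u w z k).2]

def rowAnswer {q : ℕ} (F : P.Answer n q) (R : Fin (r n) → Bool) (k : Fin q) :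
    List (P.Entry n q) × ℕ :=
  F (P.row R) (P.sharedRow R) (P.sharedCol R) k

def colAnswer {q : ℕ} (F : P.Answer n q) (R : Fin (r n) → Bool) (k : Fin q) :
    List (P.Entry n q) × ℕ :=
  F (P.col R) (P.sharedRow R) (P.sharedCol R) k

/-- The list of full configurations that is zipped from the answers of the two agents. -/
def zipped {q : ℕ} (F G : P.Answer n q) (R : Fin (r n) → Bool) (k : Fin q) :
    List ((Fin (r n) → Bool) × Fin q) :=
  List.zipWith (fun e f => (P.join e.1 f.1 e.2.1 f.2.1, e.2.2))
    (P.rowAnswer F R k).1 (P.colAnswer G R k).1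

end CoinPartition

section

variable {r q m d t σ : ℕ+ → ℕ+} (V : Verifier r q m d t σ)

/-- Two configurations are neighbors if they yield the same query location. -/
def Verifier.Neighbors {n : ℕ+} (x : Fin n → Bool) (c c' : (Fin (r n) → Bool) × Fin (q n)) : Prop :=
  V.query x c.1 c.2 = V.query x c'.1 c'.2

/-- The verifier has the `τ`-rectangular neighbor listing property with time `T`, with respect to
the partition `P` of its coins. -/
def Verifier.HasRNL {τ : ℕ+ → ℝ} (P : CoinPartition r τ) (T : ℕ+ → ℕ) : Prop :=
  ∃ Arow Acol : Cmd, ∀ (n : ℕ+) (x : Fin n → Bool), ∃ F G : P.Answer n (q n),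
    P.Computes Arow x (T n) F ∧ P.Computes Acol x (T n) G ∧
    ∀ (R : Fin (r n) → Bool) (k : Fin (q n)),
      -- the two lists have equal lengths and entrywise equal query indices
      (P.rowAnswer F R k).1.map (fun e => e.2.2) = (P.colAnswer G R k).1.map (fun e => e.2.2) ∧
      -- zipped, they list all neighbors, each of them once
      (P.zipped F G R k).Nodup ∧
      (∀ c, c ∈ P.zipped F G R k ↔ V.Neighbors x (R, k) c) ∧
      -- neighbors get the same ordered list
      (∀ R' k', V.Neighbors x (R, k) (R', k') → P.zipped F G R' k' = P.zipped F G R k) ∧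
      -- both agents know the position of `(R, k)` in the list
      (P.zipped F G R k)[(P.rowAnswer F R k).2]? = some (R, k) ∧
      (P.zipped F G R k)[(P.colAnswer G R k).2]? = some (R, k)

end

/-- The number `σ n` can be computed from any input of length `n` within time `T n`. -/
def ComputableInTime (σ : ℕ+ → ℕ+) (T : ℕ+ → ℕ) : Prop :=
  ∃ A : Cmd, ∀ (n : ℕ+) (x : Fin n → Bool),
    HaltsWithin A [bits x] (T n) fun out => out 0 = [(σ n : ℕ)]

end RobustPCP

end

noncomputable section

namespace RobustPCP

/-! ## Arithmetic expressions with bounded iteration -/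

/-! Each symbol of the proof is replaced by its encoding under a binary code of constant rate and
constant relative distance, and the new verifier checks that every block it reads is a codeword
before it runs the old circuit on the decoded messages. The code is systematic, so decoding a
codeword just means reading its first `σ` bits.

Soundness. Given a binary proof, decode each block to the message `u` of a nearest codeword; this
defines an old proof. The code has relative distance at least 1/144, so any message other than `u`
has its codeword at relative distance at least 1/288 from the block (`exists_decode`). If the new
circuit accepts a word near the answers, all its blocks are codewords and their messages satisfy the
old circuit. Each message that differs from the decoded symbol forces a 1/288 fraction of
differences in its block, so the relative distance of the messages is at most 288 times that of the
words (`hammingDist_mul_le`). The bad event for the new verifier is thus contained in the one for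
the old verifier, and the error `s` is unchanged; `δ` is 1/288.

The code. Let `m` be least with `4 * σ ≤ m * 2 ^ m`, and view the message as a polynomial `f` over
the field with `2 ^ m` elements, `m` bits per coefficient. The parity part lists `f(α)` and `α f(α)`
for powers `α` of a generator. Since the degree of `f` is below a quarter of the field size, `f(α)`
is nonzero for at least half of the `α`; for these the pair `(f(α), α f(α))` is nonzero and
determines `α`, so the pairs are distinct words of length `2 * m`. Few words have low weight, hence
the total weight is proportional to the length (`mul_two_pow_le_sum_card`,
`codeLen_le_mul_card_parityBit`). This is Justesen's argument with Wozencraft's inner codes.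

Computability. One uniform program must produce the generator matrix in time polynomial in `σ`,
without a multiplication instruction. Field elements are represented by the states of a linear
feedback shift register of length `m`: bit `i` after `e` steps is the constant coefficient of `g ^
(e + i)` (`bitOf_lfsr`). The taps are found by exhaustive search for a register that visits all
nonzero states. Such taps exist because the multiplicative group of a finite field is cyclic
(`exists_fullPeriod`), and conversely full period alone makes the quotient ring a field generated by
`g` (`isDomain_of_fullPeriod`).

Running times. All quantities are written as expressions that a verified compiler turns into
programs (`exec_comp`). The time bounds may contain powers of `σ`, but `q`, the length of the
circuit and the query number may enter only through `t` or `T`; therefore the bounds record which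
variables count as small (`Small`, `Tame`).

Neighbor listing. A new location is a pair of an old location and an offset in the block, so new
neighbors are old neighbors with equal offsets. The new agents run the old ones on the number of the
block and put the offset back into the answers. For this they need `σ`, which they get either from a
given program, or by running the verifier on zero coins and dividing the number of circuit inputs,
`q * σ`, by the number of queries. -/

/-- Arithmetic expressions over an environment, a list of naturals. `fold n a e` iterates
`x ↦ e (i, x)` for `i < n`, starting from `a`; `call f a b c` evaluates `f` in the environment that
consists of the values of `a`, `b`, `c`. -/
inductive Arith
  | var (i : ℕ)
  | const (c : ℕ)
  | op (o : Op) (a b : Arith)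
  | ite (c a b : Arith)
  | load (A : ℕ) (e : Arith)
  | fold (n a e : Arith)
  | call (f a b c : Arith)

namespace Arith

/-- The value of an expression, given the contents `M` of the arrays. -/
def eval (M : ℕ → ℕ → ℕ) : Arith → List ℕ → ℕ
  | var i, env => env.getD i 0
  | const c, _ => c
  | op o a b, env => o.eval (a.eval M env) (b.eval M env)
  | ite c a b, env => if c.eval M env = 0 then b.eval M env else a.eval M env
  | load A e, env => M A (e.eval M env)
  | fold n a e, env => Nat.rec (a.eval M env) (fun j x => e.eval M (j :: x :: env)) (n.eval M env)
  | call f a b c, env => f.eval M [a.eval M env, b.eval M env, c.eval M env]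

/-- The value of the accumulator of a `fold` after `j` rounds. -/
def iter (M : ℕ → ℕ → ℕ) (a e : Arith) (env : List ℕ) (j : ℕ) : ℕ :=
  Nat.rec (a.eval M env) (fun j x => e.eval M (j :: x :: env)) j

/-- A bound for the running time of the compiled expression. -/
def cost (M : ℕ → ℕ → ℕ) : Arith → List ℕ → ℕ
  | var _, _ => 2
  | const _, _ => 1
  | op _ a b, env => a.cost M env + b.cost M env + 1
  -- Both branches are charged, so the bound needs no knowledge of the condition.
  | ite c a b, env => c.cost M env + (a.cost M env + b.cost M env) + 1
  | load _ e, env => e.cost M env + 1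
  | fold n a e, env => a.cost M env + n.cost M env + 3 +
      ∑ j ∈ Finset.range (n.eval M env), (e.cost M (j :: iter M a e env j :: env) + 5)
  | call f a b c, env => a.cost M env + b.cost M env + c.cost M env +
      f.cost M [a.eval M env, b.eval M env, c.eval M env] + 2

/-- Copy the variable `a` to the variable `v ≠ a`. -/
def copy (v a : ℕ) : Cmd := .seq (.const v 0) (.arith .add v a v)

/-- The program that computes an expression; the environment is held by the variables `3 * v` for
`v` in `vars`, the result goes to the variable `3 * l`, and the only other variables that change are
`3 * v` with `l < v`. -/
def comp : Arith → List ℕ → ℕ → Cmd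
  | var i, vars, l =>
    match vars[i]? with
    | some a => copy (3 * l) (3 * a)
    | none => .const (3 * l) 0
  | const c, _, l => .const (3 * l) c
  | op o a b, vars, l =>
    .seq (a.comp vars l) (.seq (b.comp vars (l + 1)) (.arith o (3 * l) (3 * l) (3 * (l + 1))))
  | ite c a b, vars, l =>
    .seq (c.comp vars l) (.cond (3 * l) (a.comp vars l) (b.comp vars l))
  | load A e, vars, l => .seq (e.comp vars l) (.load (3 * l) A (3 * l))
  | fold n a e, vars, l =>
    -- Slot `l` holds the accumulator, `l + 1` the rounds left, `l + 2` the index of the round and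
    -- `l + 3` the constant 1; the body works from slot `l + 4` on.
    .seq (a.comp vars l) <| .seq (n.comp vars (l + 1)) <| .seq (.const (3 * (l + 2)) 0) <|
    .seq (.const (3 * (l + 3)) 1) <| .loop (3 * (l + 1)) <|
      .seq (e.comp ((l + 2) :: l :: vars) (l + 4)) <| .seq (copy (3 * l) (3 * (l + 4))) <|
      .seq (.arith .sub (3 * (l + 1)) (3 * (l + 1)) (3 * (l + 3))) <|
      .arith .add (3 * (l + 2)) (3 * (l + 2)) (3 * (l + 3))
  | call f a b c, vars, l =>
    .seq (a.comp vars l) <| .seq (b.comp vars (l + 1)) <| .seq (c.comp vars (l + 2)) <|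
    .seq (f.comp [l, l + 1, l + 2] (l + 3)) <| copy (3 * l) (3 * (l + 3))

end Arith

/-- `s'` differs from `s` only in the variables `3 * v` with `l ≤ v`. -/
structure State.Frame (l : ℕ) (s s' : State) : Prop where
  var : ∀ v, (v % 3 ≠ 0 ∨ v < 3 * l) → s'.var v = s.var v
  arr : s'.arr = s.arr
  out : s'.out = s.out

theorem State.Frame.refl (l : ℕ) (s : State) : State.Frame l s s := ⟨fun _ _ => rfl, rfl, rfl⟩

theorem State.Frame.trans {l : ℕ} {s₁ s₂ s₃ : State} (h : State.Frame l s₁ s₂)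
    (h' : State.Frame l s₂ s₃) : State.Frame l s₁ s₃ :=
  ⟨fun v hv => (h'.var v hv).trans (h.var v hv), h'.arr.trans h.arr, h'.out.trans h.out⟩

theorem State.Frame.mono {l l' : ℕ} {s₁ s₂ : State} (h : State.Frame l' s₁ s₂) (hl : l ≤ l') :
    State.Frame l s₁ s₂ :=
  ⟨fun v hv => h.var v (by omega), h.arr, h.out⟩

theorem State.Frame.setVar {l v a : ℕ} {s₁ s₂ : State} (h : State.Frame l s₁ s₂) (hl : l ≤ v) :
    State.Frame l s₁ (s₂.setVar (3 * v) a) :=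
  ⟨fun w hw => by
    rw [← h.var w hw]
    exact Function.update_of_ne (by omega) _ _, h.arr, h.out⟩

theorem State.Frame.slot {l v : ℕ} {s₁ s₂ : State} (h : State.Frame l s₁ s₂) (hl : v < l) :
    s₂.var (3 * v) = s₁.var (3 * v) := h.var _ (by omega)

theorem State.setVar_same (s : State) (v a : ℕ) : (s.setVar v a).var v = a :=
  Function.update_self ..

theorem State.setVar_ne (s : State) {v w : ℕ} (a : ℕ) (h : w ≠ v) :
    (s.setVar v a).var w = s.var w := Function.update_of_ne h ..

/-- The values of the slots in `vars`. -/
def State.env (s : State) (vars : List ℕ) : List ℕ := vars.map fun v => s.var (3 * v)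

theorem State.Frame.env {l : ℕ} {s₁ s₂ : State} (h : State.Frame l s₁ s₂) {vars : List ℕ}
    (hv : ∀ v ∈ vars, v < l) : s₂.env vars = s₁.env vars :=
  List.map_congr_left fun v hv' => h.slot (hv v hv')

/-- The copy clears `v` before adding `a`, which is why the two must differ. -/
theorem exec_copy (inp : List (List ℕ)) (s : State) {v a : ℕ} (h : a ≠ v) :
    ∃ s', Exec inp (Arith.copy v a) s 2 s' ∧ s' = s.setVar v (s.var a) := by
  refine ⟨_, .seq (.const v 0 s) (.arith .add v a v _), ?_⟩
  simp [State.setVar, Op.eval, Function.update_of_ne h]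

/-- A counting loop: if the body preserves an invariant that is indexed by the number of rounds and
decreases the counter, the loop runs through all rounds. -/
theorem exec_loop {inp : List (List ℕ)} {v : ℕ} {p : Cmd} (I : ℕ → State → Prop) (n : ℕ)
    (t : ℕ → ℕ) (hv : ∀ j s, j ≤ n → I j s → s.var v = n - j)
    (hp : ∀ j s, j < n → I j s → ∃ T ≤ t j, ∃ s', Exec inp p s T s' ∧ I (j + 1) s')
    {s : State} (hs : I 0 s) :
    ∃ T ≤ ∑ j ∈ Finset.range n, (t j + 1) + 1, ∃ s', Exec inp (.loop v p) s T s' ∧ I n s' := by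
  -- Induction on the number `k` of rounds left, for an arbitrary starting round `j`.
  have key : ∀ k j s, j + k = n → I j s →
      ∃ T ≤ ∑ i ∈ Finset.range k, (t (j + i) + 1) + 1, ∃ s',
        Exec inp (.loop v p) s T s' ∧ I n s' := by
    intro k
    induction k with
    | zero =>
      intro j s hj hI
      obtain rfl : j = n := by omega
      exact ⟨1, by simp, s, .loopStop (by rw [hv j s le_rfl hI]; omega), hI⟩
    | succ k ih =>
      intro j s hj hI
      obtain ⟨T, hT, s', hs', hI'⟩ := hp j s (by omega) hI
      obtain ⟨T', hT', s'', hs'', hI''⟩ := ih (j + 1) s' (by omega) hI'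
      refine ⟨T + T' + 1, ?_, s'', .loopStep (by rw [hv j s (by omega) hI]; omega) hs' hs'', hI''⟩
      rw [Finset.sum_range_succ']
      simp only [Nat.add_assoc, Nat.add_comm 1] at hT' ⊢
      simp only [Nat.add_zero]
      omega
  simpa using key n 0 s (by omega) hs

namespace Arith

theorem eval_fold (M : ℕ → ℕ → ℕ) (n a e : Arith) (env : List ℕ) :
    (fold n a e).eval M env = iter M a e env (n.eval M env) := rfl

/-- Correctness and cost of the compiler. Results are stacked: an expression compiled at level `l`
disturbs only slots from `l` on, so earlier operands survive while later ones are computed. Only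
multiples of 3 are used; the other residue classes are left for simulated programs. -/
theorem exec_comp (inp : List (List ℕ)) (e : Arith) :
    ∀ (vars : List ℕ) (l : ℕ) (s : State), (∀ v ∈ vars, v < l) →
      ∃ T ≤ e.cost s.arr (s.env vars), ∃ s', Exec inp (e.comp vars l) s T s' ∧
        s'.var (3 * l) = e.eval s.arr (s.env vars) ∧ s.Frame l s' := by
  induction e with
  | var i =>
    intro vars l s hv
    by_cases hi : i < vars.length
    · have hlt : vars[i] < l := hv _ (List.getElem_mem hi)
      obtain ⟨s', h, rfl⟩ := exec_copy inp s (v := 3 * l) (a := 3 * vars[i]) (by omega)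
      refine ⟨2, le_rfl, _, by simpa [comp, List.getElem?_eq_getElem hi] using h, ?_,
        (State.Frame.refl l s).setVar le_rfl⟩
      simp [State.setVar_same, eval, State.env, hi]
    · refine ⟨1, by simp [cost], s.setVar (3 * l) 0, ?_, ?_, (State.Frame.refl l s).setVar le_rfl⟩
      · simpa [comp, List.getElem?_eq_none (not_lt.1 hi)] using Exec.const (3 * l) 0 s
      · simp [State.setVar_same, eval, State.env, List.getElem?_eq_none (not_lt.1 hi)]
  | const c =>
    intro vars l s hv
    exact ⟨1, le_rfl, _, .const _ _ _, State.setVar_same .., (State.Frame.refl l s).setVar le_rfl⟩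
  | op o a b iha ihb =>
    intro vars l s hv
    obtain ⟨T, hT, s', h, hr, hf⟩ := iha vars l s hv
    obtain ⟨T', hT', s'', h', hr', hf'⟩ := ihb vars (l + 1) s' fun v hv' => by
      have := hv v hv'; omega
    rw [hf.env hv, hf.arr] at hT' hr'
    refine ⟨T + (T' + 1), by simp only [cost]; omega, _, .seq h (.seq h' (.arith _ _ _ _ _)), ?_,
      (hf.trans (hf'.mono (by omega))).setVar le_rfl⟩
    rw [State.setVar_same, hr', hf'.slot (by omega), hr, eval]
  | ite c a b ihc iha ihb =>
    intro vars l s hv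
    obtain ⟨T, hT, s', h, hr, hf⟩ := ihc vars l s hv
    by_cases hc : c.eval s.arr (s.env vars) = 0
    · obtain ⟨T', hT', s'', h', hr', hf'⟩ := ihb vars l s' hv
      rw [hf.env hv, hf.arr] at hT' hr'
      exact ⟨T + (T' + 1), by simp only [cost]; omega, _, .seq h (.condFalse (by rw [hr, hc]) h'),
        by simp [eval, hc, hr'], hf.trans hf'⟩
    · obtain ⟨T', hT', s'', h', hr', hf'⟩ := iha vars l s' hv
      rw [hf.env hv, hf.arr] at hT' hr'
      exact ⟨T + (T' + 1), by simp only [cost]; omega, _, .seq h (.condTrue (by rwa [hr]) h'),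
        by simp [eval, hc, hr'], hf.trans hf'⟩
  | load A e ih =>
    intro vars l s hv
    obtain ⟨T, hT, s', h, hr, hf⟩ := ih vars l s hv
    refine ⟨T + 1, by simp only [cost]; omega, _, .seq h (.load _ _ _ _), ?_, hf.setVar le_rfl⟩
    rw [State.setVar_same, hr, hf.arr, eval]
  | call f a b c ihf iha ihb ihc =>
    intro vars l s hv
    obtain ⟨T₁, hT₁, s₁, h₁, hr₁, hf₁⟩ := iha vars l s hv
    obtain ⟨T₂, hT₂, s₂, h₂, hr₂, hf₂⟩ := ihb vars (l + 1) s₁ fun v hv' => by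
      have := hv v hv'; omega
    rw [hf₁.env hv, hf₁.arr] at hT₂ hr₂
    have hf₁₂ := hf₁.trans (hf₂.mono (Nat.le_succ l))
    obtain ⟨T₃, hT₃, s₃, h₃, hr₃, hf₃⟩ := ihc vars (l + 2) s₂ fun v hv' => by
      have := hv v hv'; omega
    rw [hf₁₂.env hv, hf₁₂.arr] at hT₃ hr₃
    have hf₁₃ := hf₁₂.trans (hf₃.mono (by omega))
    obtain ⟨T₄, hT₄, s₄, h₄, hr₄, hf₄⟩ := ihf [l, l + 1, l + 2] (l + 3) s₃ (by simp)
    have henv : s₃.env [l, l + 1, l + 2] =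
        [a.eval s.arr (s.env vars), b.eval s.arr (s.env vars), c.eval s.arr (s.env vars)] := by
      change [s₃.var (3 * l), s₃.var (3 * (l + 1)), s₃.var (3 * (l + 2))] = _
      rw [hr₃, hf₃.slot (by omega), hf₃.slot (by omega), hr₂, hf₂.slot (by omega), hr₁]
    rw [henv, hf₁₃.arr] at hT₄ hr₄
    obtain ⟨s₅, h₅, rfl⟩ := exec_copy inp s₄ (v := 3 * l) (a := 3 * (l + 3)) (by omega)
    refine ⟨T₁ + (T₂ + (T₃ + (T₄ + 2))), by simp only [cost]; omega, _,
      .seq h₁ (.seq h₂ (.seq h₃ (.seq h₄ h₅))), ?_,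
      (hf₁₃.trans (hf₄.mono (by omega))).setVar le_rfl⟩
    rw [State.setVar_same, hr₄, eval]
  | fold n a e ihn iha ihe =>
    intro vars l s hv
    obtain ⟨T₁, hT₁, s₁, h₁, hr₁, hf₁⟩ := iha vars l s hv
    obtain ⟨T₂, hT₂, s₂, h₂, hr₂, hf₂⟩ := ihn vars (l + 1) s₁ fun v hv' => by
      have := hv v hv'; omega
    rw [hf₁.env hv, hf₁.arr] at hT₂ hr₂
    have hf₁₂ := hf₁.trans (hf₂.mono (Nat.le_succ l))
    set k := n.eval s.arr (s.env vars) with hk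
    set x := iter s.arr a e (s.env vars) with hx
    -- The invariant after `j` rounds: the accumulator is the `j`-th iterate, `k - j` rounds are
    -- left, and the index is `j`.
    let I : ℕ → State → Prop := fun j s' => s.Frame l s' ∧ s'.var (3 * l) = x j ∧
      s'.var (3 * (l + 1)) = k - j ∧ s'.var (3 * (l + 2)) = j ∧ s'.var (3 * (l + 3)) = 1
    have hI0 : I 0 ((s₂.setVar (3 * (l + 2)) 0).setVar (3 * (l + 3)) 1) := by
      refine ⟨(hf₁₂.setVar (by omega)).setVar (by omega), ?_, ?_, ?_, ?_⟩
      · rw [State.setVar_ne _ _ (by omega), State.setVar_ne _ _ (by omega), hf₂.slot (by omega),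
          hr₁]
        rfl
      · rw [State.setVar_ne _ _ (by omega), State.setVar_ne _ _ (by omega), hr₂]
        rfl
      · rw [State.setVar_ne _ _ (by omega), State.setVar_same]
      · rw [State.setVar_same]
    obtain ⟨T₃, hT₃, s₃, h₃, hs₃⟩ := exec_loop (inp := inp) (v := 3 * (l + 1))
      (p := .seq (e.comp ((l + 2) :: l :: vars) (l + 4)) <| .seq (copy (3 * l) (3 * (l + 4))) <|
        .seq (.arith .sub (3 * (l + 1)) (3 * (l + 1)) (3 * (l + 3))) <|
        .arith .add (3 * (l + 2)) (3 * (l + 2)) (3 * (l + 3))) I k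
      (fun j => e.cost s.arr (j :: x j :: s.env vars) + 4) (fun j s' _ h => h.2.2.1)
      (by
        rintro j s' hj ⟨hf, hx', hc, hi, ho⟩
        obtain ⟨T, hT, t, ht, hr, hft⟩ := ihe ((l + 2) :: l :: vars) (l + 4) s' (by
          simp only [List.mem_cons]
          rintro v (rfl | rfl | hv')
          · omega
          · omega
          · have := hv v hv'; omega)
        have henv : s'.env ((l + 2) :: l :: vars) = j :: x j :: s.env vars := by
          rw [← hf.env hv]
          simp [State.env, hi, hx']
        rw [henv, hf.arr] at hT hr
        obtain ⟨t', ht', rfl⟩ := exec_copy inp t (v := 3 * l) (a := 3 * (l + 4)) (by omega)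
        refine ⟨T + (2 + (1 + 1)), by omega, _, .seq ht (.seq ht' (.seq (.arith _ _ _ _ _)
          (.arith _ _ _ _ _))), (((hf.trans (hft.mono (by omega))).setVar le_rfl).setVar
          (by omega)).setVar (by omega), ?_, ?_, ?_, ?_⟩
        · rw [State.setVar_ne _ _ (by omega), State.setVar_ne _ _ (by omega), State.setVar_same, hr]
          rfl
        · rw [State.setVar_ne _ _ (by omega), State.setVar_same, State.setVar_ne _ _ (by omega),
            State.setVar_ne _ _ (by omega), hft.slot (by omega), hft.slot (by omega), hc, ho]
          simp only [Op.eval]; omega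
        · rw [State.setVar_same, State.setVar_ne _ _ (by omega), State.setVar_ne _ _ (by omega),
            State.setVar_ne _ _ (by omega), State.setVar_ne _ _ (by omega), hft.slot (by omega),
            hft.slot (by omega), hi, ho]
          rfl
        · rw [State.setVar_ne _ _ (by omega), State.setVar_ne _ _ (by omega),
            State.setVar_ne _ _ (by omega), hft.slot (by omega), ho])
      hI0
    refine ⟨T₁ + (T₂ + (1 + (1 + T₃))), ?_, s₃,
      .seq h₁ (.seq h₂ (.seq (.const _ _ _) (.seq (.const _ _ _) h₃))), hs₃.2.1, hs₃.1⟩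
    simp only [Nat.add_assoc, Nat.reduceAdd] at hT₃
    change _ ≤ _ + _ + 3 + ∑ j ∈ Finset.range k, (e.cost s.arr (j :: x j :: s.env vars) + 5)
    omega

end Arith

section

open Arith

/-! ## Polynomial bounds -/

/-- The entries of the environment that are marked in `S` are at most `B`. -/
def EnvLE (S : List Bool) (B : ℕ) (env : List ℕ) : Prop :=
  ∀ i, S.getD i false = true → env.getD i 0 ≤ B

/-- A quantity is bounded by a fixed power of the marked entries of the environment. -/
def PolyBdd (S : List Bool) (g : (ℕ → ℕ → ℕ) → List ℕ → ℕ) : Prop :=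
  ∃ c, ∀ M B env, 2 ≤ B → EnvLE S B env → g M env ≤ B ^ c

theorem le_pow_of_le_pow {B x c c' : ℕ} (hB : 2 ≤ B) (h : x ≤ B ^ c) (hc : c ≤ c') : x ≤ B ^ c' :=
  h.trans (Nat.pow_le_pow_right (by omega) hc)

/-- The extra 1 in the exponent absorbs a factor 2, since the base is at least 2. -/
theorem add_le_pow {B x y a b : ℕ} (hB : 2 ≤ B) (hx : x ≤ B ^ a) (hy : y ≤ B ^ b) :
    x + y ≤ B ^ (a + b + 1) := by
  have h1 := le_pow_of_le_pow hB hx (Nat.le_add_right a b)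
  have h2 := le_pow_of_le_pow hB hy (Nat.le_add_left b a)
  have h3 : 2 * B ^ (a + b) ≤ B ^ (a + b + 1) := by
    rw [pow_succ, mul_comm]; exact Nat.mul_le_mul_left _ hB
  omega

theorem const_le_pow {B : ℕ} (hB : 2 ≤ B) (k : ℕ) : k ≤ B ^ k :=
  Nat.lt_two_pow_self.le.trans (Nat.pow_le_pow_left hB k)

namespace PolyBdd

variable {S : List Bool} {g g' : (ℕ → ℕ → ℕ) → List ℕ → ℕ}

theorem mono (h : PolyBdd S g') (hg : ∀ M env, g M env ≤ g' M env) : PolyBdd S g := by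
  obtain ⟨c, hc⟩ := h
  exact ⟨c, fun M B env hB he => (hg M env).trans (hc M B env hB he)⟩

theorem const (k : ℕ) : PolyBdd S fun _ _ => k := ⟨k, fun _ _ _ hB _ => const_le_pow hB k⟩

theorem add (h : PolyBdd S g) (h' : PolyBdd S g') : PolyBdd S fun M env => g M env + g' M env := by
  obtain ⟨c, hc⟩ := h
  obtain ⟨c', hc'⟩ := h'
  exact ⟨_, fun M B env hB he => add_le_pow hB (hc M B env hB he) (hc' M B env hB he)⟩

theorem var {i : ℕ} (h : S.getD i false = true) : PolyBdd S fun _ env => env.getD i 0 :=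
  ⟨1, fun _ _ _ _ he => by simpa using he i h⟩

end PolyBdd

/-- The value of the expression is bounded by a power of the marked variables. -/
def Small (S : List Bool) (e : Arith) : Prop :=
  ∃ c, ∀ M B env, 2 ≤ B → EnvLE S B env → e.eval M env ≤ B ^ c

/-- The cost of the expression is bounded by a power of the marked variables. -/
def Tame (S : List Bool) (e : Arith) : Prop :=
  ∃ c, ∀ M B env, 2 ≤ B → EnvLE S B env → e.cost M env ≤ B ^ c

section

variable {S : List Bool}

theorem Small.var {i : ℕ} (h : S.getD i false = true) : Small S (.var i) := PolyBdd.var h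

theorem Small.const (k : ℕ) : Small S (.const k) := PolyBdd.const k

theorem Small.add {a b : Arith} (ha : Small S a) (hb : Small S b) : Small S (.op .add a b) :=
  PolyBdd.add ha hb

/-- Truncated subtraction, like division and remainder below, never exceeds its first argument, so
nothing is asked of the second. -/
theorem Small.sub {a : Arith} (ha : Small S a) (b : Arith) : Small S (.op .sub a b) :=
  PolyBdd.mono ha fun _ _ => Nat.sub_le _ _

theorem Small.div {a : Arith} (ha : Small S a) (b : Arith) : Small S (.op .div a b) :=
  PolyBdd.mono ha fun _ _ => Nat.div_le_self _ _

theorem Small.mod {a : Arith} (ha : Small S a) (b : Arith) : Small S (.op .mod a b) :=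
  PolyBdd.mono ha fun _ _ => Nat.mod_le _ _

theorem Small.ite {a b : Arith} (c : Arith) (ha : Small S a) (hb : Small S b) :
    Small S (.ite c a b) :=
  PolyBdd.mono (PolyBdd.add ha hb) fun M env => by
    simp only [eval]; split <;> omega

theorem EnvLE.call {M : ℕ → ℕ → ℕ} {B k : ℕ} {env : List ℕ} {a b c : Arith} {sa sb sc : Bool}
    (ha : sa = true → a.eval M env ≤ B ^ k) (hb : sb = true → b.eval M env ≤ B ^ k)
    (hc : sc = true → c.eval M env ≤ B ^ k) :
    EnvLE [sa, sb, sc] (B ^ k) [a.eval M env, b.eval M env, c.eval M env] := by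
  rintro (_ | _ | _ | i) h
  · exact ha h
  · exact hb h
  · exact hc h
  · simp at h

/-- Polynomial bounds compose: if the marked arguments are at most `B ^ K`, the bound for `g` is
applied with base `B ^ K`, and exponents multiply. Unmarked arguments may be arbitrarily large. -/
theorem PolyBdd.call {g : (ℕ → ℕ → ℕ) → List ℕ → ℕ} {a b c : Arith} {sa sb sc : Bool}
    (hg : PolyBdd [sa, sb, sc] g) (ha : sa = true → Small S a) (hb : sb = true → Small S b)
    (hc : sc = true → Small S c) :
    PolyBdd S fun M env => g M [a.eval M env, b.eval M env, c.eval M env] := by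
  have aux : ∀ {s : Bool} {e : Arith}, (s = true → Small S e) → ∃ k, ∀ M B env, 2 ≤ B →
      EnvLE S B env → s = true → e.eval M env ≤ B ^ k := by
    rintro (_ | _) e h
    · exact ⟨0, by simp⟩
    · obtain ⟨k, hk⟩ := h rfl
      exact ⟨k, fun M B env hB he _ => hk M B env hB he⟩
  obtain ⟨k, hk⟩ := hg
  obtain ⟨ka, hka⟩ := aux ha
  obtain ⟨kb, hkb⟩ := aux hb
  obtain ⟨kc, hkc⟩ := aux hc
  refine ⟨(ka + kb + kc + 1) * k, fun M B env hB he => ?_⟩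
  rw [pow_mul]
  refine hk M _ _ (hB.trans (Nat.le_self_pow (by omega) B)) (EnvLE.call ?_ ?_ ?_)
  · exact fun h => le_pow_of_le_pow hB (hka M B env hB he h) (by omega)
  · exact fun h => le_pow_of_le_pow hB (hkb M B env hB he h) (by omega)
  · exact fun h => le_pow_of_le_pow hB (hkc M B env hB he h) (by omega)

theorem Small.call (sa sb sc : Bool) {f a b c : Arith} (hf : Small [sa, sb, sc] f)
    (ha : sa = true → Small S a) (hb : sb = true → Small S b) (hc : sc = true → Small S c) :
    Small S (.call f a b c) := PolyBdd.call hf ha hb hc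

theorem EnvLE.cons {B B' x : ℕ} {b : Bool} {env : List ℕ} (h : EnvLE S B env) (hB : B ≤ B')
    (hx : b = true → x ≤ B') : EnvLE (b :: S) B' (x :: env) := by
  rintro (_ | i) hi
  · exact hx hi
  · exact (h i hi).trans hB

/-- The mark `false` on the accumulator says that the body is bounded regardless of the previous
iterate. The last round alone then bounds the result, and iteration causes no blow-up. -/
theorem Small.fold {n a e : Arith} (hn : Small S n) (ha : Small S a)
    (he : Small (true :: false :: S) e) : Small S (.fold n a e) := by
  obtain ⟨kn, hkn⟩ := hn
  obtain ⟨ka, hka⟩ := ha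
  obtain ⟨ke, hke⟩ := he
  refine ⟨ka + (kn + 1) * ke, fun M B env hB henv => ?_⟩
  rw [eval_fold]
  rcases hj : n.eval M env with _ | j
  · exact le_pow_of_le_pow hB (hka M B env hB henv) (by omega)
  · have hB' : B ≤ B ^ (kn + 1) := Nat.le_self_pow (by omega) B
    have h := hke M (B ^ (kn + 1)) (j :: iter M a e env j :: env) (hB.trans hB')
      ((henv.cons hB' (by simp)).cons le_rfl fun _ => by
        have := le_pow_of_le_pow hB (hkn M B env hB henv) (show kn ≤ kn + 1 by omega)
        omega)
    rw [← pow_mul] at h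
    exact le_pow_of_le_pow hB h (by omega)

/-- The sum of `e j` over `j < n`; the second variable of `e` is not for use. -/
def Arith.sum (n e : Arith) : Arith := .fold n (.const 0) (.op .add (.var 1) e)

/-- The minimum of two expressions. -/
def Arith.min (a b : Arith) : Arith := .op .sub a (.op .sub a b)

theorem Arith.eval_min (M : ℕ → ℕ → ℕ) (a b : Arith) (env : List ℕ) :
    (Arith.min a b).eval M env = Nat.min (a.eval M env) (b.eval M env) := by
  simp only [Arith.min, eval, Op.eval, Nat.min_def]
  split <;> omega

/-- Capping makes any value small. Caps that never take effect are inserted below wherever a bound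
would otherwise depend on semantic facts. -/
theorem Small.min {b : Arith} (a : Arith) (hb : Small S b) : Small S (Arith.min a b) :=
  PolyBdd.mono hb fun M env => by
    rw [eval_min]
    exact Nat.min_le_right _ _

/-- Here each iterate depends on the previous one, but only additively: `j` rounds contribute at
most `j` times the bound for a summand. -/
theorem Small.sum {n e : Arith} (hn : Small S n) (he : Small (true :: false :: S) e) :
    Small S (Arith.sum n e) := by
  obtain ⟨kn, hkn⟩ := hn
  obtain ⟨ke, hke⟩ := he
  refine ⟨kn + (kn + 1) * ke, fun M B env hB henv => ?_⟩
  have hB' : B ≤ B ^ (kn + 1) := Nat.le_self_pow (by omega) B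
  have hn' := hkn M B env hB henv
  rw [Arith.sum, eval_fold]
  have key : ∀ j, j ≤ n.eval M env →
      iter M (.const 0) (.op .add (.var 1) e) env j ≤ j * B ^ ((kn + 1) * ke) := by
    intro j
    induction j with
    | zero => intro _; simp [iter, eval]
    | succ j ih =>
      intro hj
      have h := hke M (B ^ (kn + 1))
        (j :: iter M (.const 0) (.op .add (.var 1) e) env j :: env) (hB.trans hB')
        ((henv.cons hB' (by simp)).cons le_rfl fun _ => by
          have := le_pow_of_le_pow hB hn' (show kn ≤ kn + 1 by omega)
          omega)
      rw [← pow_mul] at h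
      have := ih (by omega)
      rw [add_mul, one_mul]
      exact Nat.add_le_add this h
  refine (key _ le_rfl).trans ?_
  rw [pow_add]
  exact Nat.mul_le_mul_right _ hn'

theorem Tame.var (i : ℕ) : Tame S (.var i) := PolyBdd.const 2

theorem Tame.const (k : ℕ) : Tame S (.const k) := PolyBdd.const 1

theorem Tame.op (o : Op) {a b : Arith} (ha : Tame S a) (hb : Tame S b) : Tame S (.op o a b) :=
  PolyBdd.add (PolyBdd.add ha hb) (PolyBdd.const 1)

theorem Tame.ite {c a b : Arith} (hc : Tame S c) (ha : Tame S a) (hb : Tame S b) :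
    Tame S (.ite c a b) :=
  PolyBdd.add (PolyBdd.add hc (PolyBdd.add ha hb)) (PolyBdd.const 1)

theorem Tame.load (A : ℕ) {e : Arith} (he : Tame S e) : Tame S (.load A e) :=
  PolyBdd.add he (PolyBdd.const 1)

theorem Tame.call (sa sb sc : Bool) {f a b c : Arith} (hf : Tame [sa, sb, sc] f) (ha' : Tame S a)
    (hb' : Tame S b) (hc' : Tame S c)
    (ha : sa = true → Small S a) (hb : sb = true → Small S b) (hc : sc = true → Small S c) :
    Tame S (.call f a b c) :=
  PolyBdd.add (PolyBdd.add (PolyBdd.add (PolyBdd.add ha' hb') hc') (PolyBdd.call hf ha hb hc))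
    (PolyBdd.const 2)

/-- The flag `x` tells whether the cost of the body depends on the accumulator; only then must all
intermediate iterates be bounded. -/
theorem Tame.fold_of_iter {n a e : Arith} (x : Bool) (hn : Small S n) (hn' : Tame S n)
    (ha : Tame S a) (he : Tame (true :: x :: S) e)
    (hx : x = true → ∃ k, ∀ M B env, 2 ≤ B → EnvLE S B env → ∀ j < n.eval M env,
      iter M a e env j ≤ B ^ k) : Tame S (.fold n a e) := by
  have hx' : ∃ k, ∀ M B env, 2 ≤ B → EnvLE S B env → ∀ j < n.eval M env, x = true →
      iter M a e env j ≤ B ^ k := by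
    rcases x with _ | _
    · exact ⟨0, by simp⟩
    · obtain ⟨k, hk⟩ := hx rfl
      exact ⟨k, fun M B env hB h j hj _ => hk M B env hB h j hj⟩
  obtain ⟨kx, hkx⟩ := hx'
  refine PolyBdd.add (PolyBdd.add (PolyBdd.add ha hn') (PolyBdd.const 3)) ?_
  obtain ⟨kn, hkn⟩ := hn
  obtain ⟨ke, hke⟩ := he
  -- `kn` accounts for the number of rounds, the product for the body evaluated at base `B ^ (kn +
  -- kx + 1)`, and the rest for the overhead of 5 steps per round.
  refine ⟨kn + ((kn + kx + 1) * ke + 5 + 1), fun M B env hB henv => ?_⟩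
  rw [pow_add]
  have hB' : B ≤ B ^ (kn + kx + 1) := Nat.le_self_pow (by omega) B
  have hn' := hkn M B env hB henv
  refine (Finset.sum_le_card_nsmul _ _ (B ^ ((kn + kx + 1) * ke + 5 + 1)) fun j hj => ?_).trans ?_
  · rw [Finset.mem_range] at hj
    refine add_le_pow hB ?_ (const_le_pow hB 5)
    rw [pow_mul]
    refine hke M _ _ (hB.trans hB') ((henv.cons hB' fun h => ?_).cons le_rfl fun _ => ?_)
    · exact le_pow_of_le_pow hB (hkx M B env hB henv j hj h) (by omega)
    · have := le_pow_of_le_pow hB hn' (show kn ≤ kn + kx + 1 by omega)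
      omega
  · rw [Finset.card_range, smul_eq_mul]
    exact Nat.mul_le_mul_right _ hn'

theorem Tame.sum {n e : Arith} (hn : Small S n) (hn' : Tame S n)
    (he : Tame (true :: false :: S) e) : Tame S (Arith.sum n e) :=
  Tame.fold_of_iter false hn hn' (Tame.const 0) (Tame.op _ (Tame.var 1) he) (by simp)

theorem Tame.fold {n a e : Arith} (hn : Small S n) (hn' : Tame S n) (ha : Small S a)
    (ha' : Tame S a) (he : Small (true :: false :: S) e) (he' : Tame (true :: true :: S) e) :
    Tame S (.fold n a e) := by
  refine Tame.fold_of_iter true hn hn' ha' he' fun _ => ?_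
  obtain ⟨kn, hkn⟩ := hn
  obtain ⟨ka, hka⟩ := ha
  obtain ⟨ke, hke⟩ := he
  refine ⟨ka + (kn + 1) * ke, fun M B env hB henv j hj => ?_⟩
  rcases j with _ | j
  · exact le_pow_of_le_pow hB (hka M B env hB henv) (by omega)
  · have hB' : B ≤ B ^ (kn + 1) := Nat.le_self_pow (by omega) B
    have h := hke M (B ^ (kn + 1)) (j :: iter M a e env j :: env) (hB.trans hB')
      ((henv.cons hB' (by simp)).cons le_rfl fun _ => by
        have := le_pow_of_le_pow hB (hkn M B env hB henv) (show kn ≤ kn + 1 by omega)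
        omega)
    rw [← pow_mul] at h
    exact le_pow_of_le_pow hB h (by omega)

theorem Tame.fold_pure {n a e : Arith} (hn : Small S n) (hn' : Tame S n) (ha : Tame S a)
    (he : Tame (true :: false :: S) e) : Tame S (.fold n a e) :=
  Tame.fold_of_iter false hn hn' ha he (by simp)

theorem Tame.min {a b : Arith} (ha : Tame S a) (hb : Tame S b) : Tame S (Arith.min a b) :=
  Tame.op _ ha (Tame.op _ ha hb)

theorem Arith.eval_sum (M : ℕ → ℕ → ℕ) (n e : Arith) (env : List ℕ) (f : ℕ → ℕ)
    (h : ∀ j < n.eval M env, ∀ x, e.eval M (j :: x :: env) = f j) :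
    (Arith.sum n e).eval M env = ∑ j ∈ Finset.range (n.eval M env), f j := by
  rw [Arith.sum, eval_fold]
  have key : ∀ j ≤ n.eval M env, iter M (.const 0) (.op .add (.var 1) e) env j =
      ∑ i ∈ Finset.range j, f i := by
    intro j
    induction j with
    | zero => intro _; simp [iter, eval]
    | succ j ih =>
      intro hj
      rw [Finset.sum_range_succ, ← ih (by omega), ← h j (by omega)]
      rfl
  exact key _ le_rfl

attribute [irreducible] Arith.sum Arith.min

end

/-! ## The expressions that describe the code -/

section

variable {S : List Bool}

theorem Small.call_all {f a b c : Arith} (hf : Small [true, true, true] f) (ha : Small S a)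
    (hb : Small S b) (hc : Small S c) : Small S (.call f a b c) :=
  Small.call _ _ _ hf (fun _ => ha) (fun _ => hb) fun _ => hc

theorem Tame.call_all {f a b c : Arith} (hf : Tame [true, true, true] f) (ha : Small S a)
    (hb : Small S b) (hc : Small S c) (ha' : Tame S a) (hb' : Tame S b) (hc' : Tame S c) :
    Tame S (.call f a b c) :=
  Tame.call _ _ _ hf ha' hb' hc' (fun _ => ha) (fun _ => hb) fun _ => hc

end

/-- `a * b`. -/
def mulA : Arith := Arith.sum (.var 0) (.var 3)

theorem eval_mulA (M a b c) : mulA.eval M [a, b, c] = a * b := by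
  rw [mulA, eval_sum (f := fun _ => b)]
  · simp [eval]
  · intros; rfl

/-- The product is a repeated addition of the second factor, so its cost depends on the first factor
only. This permits products of a small number with unbounded ones such as `q`. -/
theorem tame_mulA : Tame [true, false, false] mulA :=
  Tame.sum (Small.var rfl) (Tame.var _) (Tame.var _)

theorem small_mulA : Small [true, true, true] mulA :=
  Small.sum (Small.var rfl) (Small.var rfl)

theorem tame_mulA_all : Tame [true, true, true] mulA :=
  Tame.sum (Small.var rfl) (Tame.var _) (Tame.var _)

attribute [irreducible] mulA

/-- `a / 2 ^ i`. -/
def shiftA : Arith := .fold (.var 1) (.var 0) (.op .div (.var 1) (.const 2))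

theorem eval_shiftA (M y i c) : shiftA.eval M [y, i, c] = y / 2 ^ i := by
  rw [shiftA, eval_fold]
  have key : ∀ j, iter M (.var 0) (.op .div (.var 1) (.const 2)) [y, i, c] j = y / 2 ^ j := by
    intro j
    induction j with
    | zero => simp [iter, eval]
    | succ j ih => rw [pow_succ, ← Nat.div_div_eq_div_mul, ← ih]; rfl
  exact key i

theorem tame_shiftA : Tame [true, true, true] shiftA :=
  Tame.fold_pure (Small.var rfl) (Tame.var _) (Tame.var _) (Tame.op _ (Tame.var _) (Tame.const _))

attribute [irreducible] shiftA

/-- The bit number `i` of `y`. -/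
def bitOf (y i : ℕ) : ℕ := y / 2 ^ i % 2

def bitA (y i : Arith) : Arith := .op .mod (.call shiftA y i (.const 0)) (.const 2)

theorem eval_bitA (M y i env) : (bitA y i).eval M env = bitOf (y.eval M env) (i.eval M env) := by
  simp [bitA, eval, eval_shiftA, Op.eval, bitOf]

theorem tame_bitA {S : List Bool} {y i : Arith} (hy : Small S y) (hi : Small S i)
    (hy' : Tame S y) (hi' : Tame S i) : Tame S (bitA y i) :=
  Tame.op _ (Tame.call_all tame_shiftA hy hi (Small.const _) hy' hi' (Tame.const _)) (Tame.const _)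

attribute [irreducible] bitA

/-- `min (2 ^ i) c`. -/
def powA : Arith :=
  .fold (.var 0) (Arith.min (.const 1) (.var 1)) (Arith.min (.op .add (.var 1) (.var 1)) (.var 3))

theorem eval_powA (M i c d) : powA.eval M [i, c, d] = min (2 ^ i) c := by
  rw [powA, eval_fold]
  have key : ∀ j, iter M (Arith.min (.const 1) (.var 1))
      (Arith.min (.op .add (.var 1) (.var 1)) (.var 3)) [i, c, d] j = min (2 ^ j) c := by
    intro j
    induction j with
    | zero => rw [iter, eval_min]; rfl
    | succ j ih =>
      change (Arith.min (.op .add (.var 1) (.var 1)) (.var 3)).eval M (j :: iter M _ _ _ j :: _) = _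
      rw [eval_min, ih]
      change min (min (2 ^ j) c + min (2 ^ j) c) c = _
      rw [pow_succ]
      omega
  exact key i

/-- The power itself is exponential in `i`; the cap `c` is what makes it small. -/
theorem small_powA : Small [true, true, true] powA :=
  Small.fold (Small.var rfl) (Small.min _ (Small.var rfl)) (Small.min _ (Small.var rfl))

theorem tame_powA : Tame [true, true, true] powA :=
  Tame.fold_pure (Small.var rfl) (Tame.var _) (Tame.min (Tame.const _) (Tame.var _))
    (Tame.min (Tame.op _ (Tame.var _) (Tame.var _)) (Tame.var _))

attribute [irreducible] powA

/-- The least `m` with `4 * σ ≤ m * 2 ^ m`, see `le_codeExp_mul` and `codeExp_mul_lt`. -/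
def codeExp (σ : ℕ) : ℕ :=
  ∑ i ∈ Finset.range (4 * σ), if i * min (2 ^ i) (4 * σ) < 4 * σ then 1 else 0

/-- `a < b` as a number. -/
def ltA (a b : Arith) : Arith := .ite (.op .sub b a) (.const 1) (.const 0)

theorem eval_ltA (M a b env) :
    (ltA a b).eval M env = if a.eval M env < b.eval M env then 1 else 0 := by
  by_cases h : a.eval M env < b.eval M env
  · simp [ltA, eval, Op.eval, h, Nat.sub_eq_zero_iff_le]
  · simp [ltA, eval, Op.eval, h, not_lt.1 h]

/-- `4 * a` -/
def fourA (a : Arith) : Arith := .op .add (.op .add a a) (.op .add a a)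

theorem eval_fourA (M a env) : (fourA a).eval M env = 4 * a.eval M env := by
  simp only [fourA, eval, Op.eval]
  omega

theorem Small.four {S : List Bool} {a : Arith} (h : Small S a) : Small S (fourA a) :=
  (h.add h).add (h.add h)

theorem Tame.four {S : List Bool} {a : Arith} (h : Tame S a) : Tame S (fourA a) :=
  Tame.op _ (Tame.op _ h h) (Tame.op _ h h)

theorem small_ltA {S : List Bool} (a b : Arith) : Small S (ltA a b) :=
  Small.ite _ (Small.const _) (Small.const _)

theorem tame_ltA {S : List Bool} {a b : Arith} (ha : Tame S a) (hb : Tame S b) :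
    Tame S (ltA a b) :=
  Tame.ite (Tame.op _ hb ha) (Tame.const _) (Tame.const _)

attribute [irreducible] ltA fourA

def codeExpA : Arith :=
  Arith.sum (fourA (.var 0))
    (ltA (.call mulA (.var 0) (.call powA (.var 0) (fourA (.var 2)) (.const 0)) (.const 0))
      (fourA (.var 2)))

theorem eval_codeExpA (M σ a b) : codeExpA.eval M [σ, a, b] = codeExp σ := by
  rw [codeExpA, eval_sum (f := fun i => if i * min (2 ^ i) (4 * σ) < 4 * σ then 1 else 0)]
  · simp [eval_fourA, eval, codeExp]
  · intro j _ x
    simp [eval_ltA, eval, eval_fourA, eval_mulA, eval_powA]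

theorem small_codeExpA : Small [true, true, true] codeExpA :=
  Small.sum (Small.var rfl).four (small_ltA _ _)

theorem tame_codeExpA : Tame [true, true, true] codeExpA := by
  refine Tame.sum (Small.var rfl).four (Tame.var _).four (tame_ltA (Tame.call_all tame_mulA_all
    (Small.var rfl) ?_ (Small.const _) (Tame.var _) ?_ (Tame.const _)) (Tame.var _).four)
  · exact Small.call_all small_powA (Small.var rfl) (Small.var rfl).four (Small.const _)
  · exact Tame.call_all tame_powA (Small.var rfl) (Small.var rfl).four (Small.const _)
      (Tame.var _) (Tame.var _).four (Tame.const _)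

attribute [irreducible] codeExpA

/-- `codeExp` of an expression. -/
def expA (a : Arith) : Arith := .call codeExpA a (.const 0) (.const 0)

theorem eval_expA (M a env) : (expA a).eval M env = codeExp (a.eval M env) := by
  simp [expA, eval, eval_codeExpA]

theorem Small.exp {S : List Bool} {a : Arith} (h : Small S a) : Small S (expA a) :=
  Small.call_all small_codeExpA h (Small.const _) (Small.const _)

theorem Tame.exp {S : List Bool} {a : Arith} (h : Small S a) (h' : Tame S a) : Tame S (expA a) :=
  Tame.call_all tame_codeExpA h (Small.const _) (Small.const _) h' (Tame.const _) (Tame.const _)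

attribute [irreducible] expA

/-- The size `2 ^ codeExp σ` of the field. -/
def codeSize (σ : ℕ) : ℕ := min (2 ^ codeExp σ) (2 * (4 * σ))

def sizeA (a : Arith) : Arith := .call powA (expA a) (.op .add (fourA a) (fourA a)) (.const 0)

theorem eval_sizeA (M a env) : (sizeA a).eval M env = codeSize (a.eval M env) := by
  simp [sizeA, eval, eval_powA, eval_expA, eval_fourA, codeSize, Op.eval, two_mul]

theorem Small.size {S : List Bool} {a : Arith} (h : Small S a) : Small S (sizeA a) :=
  Small.call_all small_powA h.exp (h.four.add h.four) (Small.const _)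

theorem Tame.size {S : List Bool} {a : Arith} (h : Small S a) (h' : Tame S a) :
    Tame S (sizeA a) :=
  Tame.call_all tame_powA h.exp (h.four.add h.four) (Small.const _) (Tame.exp h h')
    (Tame.op _ h'.four h'.four) (Tame.const _)

attribute [irreducible] sizeA

/-- One step of the linear feedback shift register with `codeExp σ` cells and the taps `p`. -/
def lfsrStep (σ p y : ℕ) : ℕ :=
  y / 2 + if (∑ i ∈ Finset.range (codeExp σ), if bitOf y i = 0 then 0 else bitOf p i) % 2 = 0
    then 0 else codeSize σ / 2

def lfsrStepA : Arith :=
  .op .add (.op .div (.var 2) (.const 2)) <|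
    .ite (.op .mod (Arith.sum (expA (.var 0))
        (.ite (bitA (.var 4) (.var 0)) (bitA (.var 3) (.var 0)) (.const 0))) (.const 2))
      (.op .div (sizeA (.var 0)) (.const 2)) (.const 0)

theorem eval_lfsrStepA (M σ p y) : lfsrStepA.eval M [σ, p, y] = lfsrStep σ p y := by
  have h : (Arith.sum (expA (.var 0)) (.ite (bitA (.var 4) (.var 0)) (bitA (.var 3) (.var 0))
      (.const 0))).eval M [σ, p, y] =
      ∑ i ∈ Finset.range (codeExp σ), if bitOf y i = 0 then 0 else bitOf p i := by
    rw [eval_sum (f := fun i => if bitOf y i = 0 then 0 else bitOf p i)]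
    · simp [eval_expA, eval]
    · intro j _ x
      simp [eval, eval_bitA]
  simp [lfsrStepA, eval, Op.eval, h, eval_sizeA, lfsrStep]

theorem tame_lfsrStepA : Tame [true, true, true] lfsrStepA := by
  refine Tame.op _ (Tame.op _ (Tame.var _) (Tame.const _)) (Tame.ite (Tame.op _ (Tame.sum
    (Small.var rfl).exp (Tame.exp (Small.var rfl) (Tame.var _)) ?_) (Tame.const _))
    (Tame.op _ (Tame.size (Small.var rfl) (Tame.var _)) (Tame.const _)) (Tame.const _))
  exact Tame.ite (tame_bitA (Small.var rfl) (Small.var rfl) (Tame.var _) (Tame.var _))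
    (tame_bitA (Small.var rfl) (Small.var rfl) (Tame.var _) (Tame.var _)) (Tame.const _)

attribute [irreducible] lfsrStepA

/-- The state of the register after `e` steps (the cap `codeSize σ` has no effect). -/
def lfsr (σ p e : ℕ) : ℕ := Nat.rec 1 (fun _ x => min (lfsrStep σ p x) (codeSize σ)) e

def lfsrA : Arith :=
  .fold (.var 2) (.const 1)
    (Arith.min (.call lfsrStepA (.var 2) (.var 3) (.var 1)) (sizeA (.var 2)))

theorem eval_lfsrA (M σ p e) : lfsrA.eval M [σ, p, e] = lfsr σ p e := by
  rw [lfsrA, eval_fold]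
  have key : ∀ j, iter M (.const 1)
      (Arith.min (.call lfsrStepA (.var 2) (.var 3) (.var 1)) (sizeA (.var 2))) [σ, p, e] j =
      lfsr σ p j := by
    intro j
    induction j with
    | zero => rfl
    | succ j ih =>
      change (Arith.min _ _).eval M (j :: iter M _ _ _ j :: _) = _
      rw [eval_min, ih]
      simp [eval_sizeA, eval, eval_lfsrStepA, lfsr]
  exact key e

/-- The cost of a step depends on the current state, and the cap by the size of the field bounds all
states without any reasoning about the register. -/
theorem tame_lfsrA : Tame [true, true, true] lfsrA := by
  refine Tame.fold (Small.var rfl) (Tame.var _) (Small.const _) (Tame.const _)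
    (Small.min _ (Small.var rfl).size) (Tame.min ?_ (Tame.size (Small.var rfl) (Tame.var _)))
  exact Tame.call_all tame_lfsrStepA (Small.var rfl) (Small.var rfl) (Small.var rfl)
    (Tame.var _) (Tame.var _) (Tame.var _)

attribute [irreducible] lfsrA

/-- The number of nonzero states that the register misses. -/
def missed (σ p : ℕ) : ℕ :=
  ∑ y ∈ Finset.range (codeSize σ - 1),
    if (∑ e ∈ Finset.range (codeSize σ), if lfsr σ p e = y + 1 then 1 else 0) = 0 then 1 else 0

/-- `a = 0` as a number. -/
def zeroA (a : Arith) : Arith := .ite a (.const 0) (.const 1)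

theorem eval_zeroA (M a env) : (zeroA a).eval M env = if a.eval M env = 0 then 1 else 0 := rfl

theorem small_zeroA {S : List Bool} (a : Arith) : Small S (zeroA a) :=
  Small.ite _ (Small.const _) (Small.const _)

theorem Tame.zero {S : List Bool} {a : Arith} (h : Tame S a) : Tame S (zeroA a) :=
  Tame.ite h (Tame.const _) (Tame.const _)

/-- `a = b` as a number. -/
def eqA (a b : Arith) : Arith := zeroA (.op .add (.op .sub a b) (.op .sub b a))

theorem eval_eqA (M a b env) :
    (eqA a b).eval M env = if a.eval M env = b.eval M env then 1 else 0 := by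
  simp only [eqA, eval_zeroA, eval, Op.eval]
  congr 1
  simp only [eq_iff_iff]
  omega

theorem tame_eqA {S : List Bool} {a b : Arith} (ha : Tame S a) (hb : Tame S b) :
    Tame S (eqA a b) :=
  Tame.zero (Tame.op _ (Tame.op _ ha hb) (Tame.op _ hb ha))

attribute [irreducible] zeroA eqA

def missedA : Arith :=
  Arith.sum (.op .sub (sizeA (.var 0)) (.const 1)) <| zeroA <|
    Arith.sum (sizeA (.var 2)) <|
      eqA (.call lfsrA (.var 4) (.var 5) (.var 0)) (.op .add (.var 2) (.const 1))

theorem eval_missedA (M σ p c) : missedA.eval M [σ, p, c] = missed σ p := by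
  rw [missedA, eval_sum (f := fun y =>
    if (∑ e ∈ Finset.range (codeSize σ), if lfsr σ p e = y + 1 then 1 else 0) = 0 then 1 else 0)]
  · simp [eval_sizeA, eval, Op.eval, missed]
  · intro y _ x
    rw [eval_zeroA, eval_sum (f := fun e => if lfsr σ p e = y + 1 then 1 else 0)]
    · simp [eval_sizeA, eval]
    · intro e _ x
      simp [eval_eqA, eval, Op.eval, eval_lfsrA]

theorem tame_missedA : Tame [true, true, true] missedA := by
  refine Tame.sum ((Small.var rfl).size.sub _) (Tame.op _ (Tame.size (Small.var rfl) (Tame.var _))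
    (Tame.const _)) (Tame.zero (Tame.sum (Small.var rfl).size (Tame.size (Small.var rfl)
    (Tame.var _)) (tame_eqA ?_ (Tame.op _ (Tame.var _) (Tame.const _)))))
  exact Tame.call_all tame_lfsrA (Small.var rfl) (Small.var rfl) (Small.var rfl)
    (Tame.var _) (Tame.var _) (Tame.var _)

attribute [irreducible] missedA

/-- The least taps for which the register runs through all nonzero states. -/
def codeTaps (σ : ℕ) : ℕ :=
  ∑ p ∈ Finset.range (codeSize σ),
    if (∑ p' ∈ Finset.range (p + 1), if missed σ p' = 0 then 1 else 0) = 0 then 1 else 0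

def tapsA : Arith :=
  Arith.sum (sizeA (.var 0)) <| zeroA <| Arith.sum (.op .add (.var 0) (.const 1)) <|
    zeroA (.call missedA (.var 4) (.var 0) (.const 0))

theorem eval_tapsA (M σ b c) : tapsA.eval M [σ, b, c] = codeTaps σ := by
  rw [tapsA, eval_sum (f := fun p =>
    if (∑ p' ∈ Finset.range (p + 1), if missed σ p' = 0 then 1 else 0) = 0 then 1 else 0)]
  · simp [eval_sizeA, eval, codeTaps]
  · intro y _ x
    rw [eval_zeroA, eval_sum (f := fun p' => if missed σ p' = 0 then 1 else 0)]
    · simp [eval, Op.eval]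
    · intro e _ x
      simp [eval_zeroA, eval, eval_missedA]

theorem small_tapsA : Small [true, true, true] tapsA :=
  Small.sum (Small.var rfl).size (small_zeroA _)

theorem tame_tapsA : Tame [true, true, true] tapsA := by
  refine Tame.sum (Small.var rfl).size (Tame.size (Small.var rfl) (Tame.var _))
    (Tame.zero (Tame.sum ((Small.var rfl).add (Small.const _))
      (Tame.op _ (Tame.var _) (Tame.const _)) (Tame.zero ?_)))
  exact Tame.call_all tame_missedA (Small.var rfl) (Small.var rfl) (Small.const _)
    (Tame.var _) (Tame.var _) (Tame.const _)

attribute [irreducible] tapsA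

/-- The exponent that belongs to the row `i` and the column `j` of the generator matrix. -/
def codeDeg (m i j : ℕ) : ℕ := (i / m / 2) * (j / m + i / m % 2) + (j % m + i % m)

/-- The entry of the generator matrix in the row `i` and the column `j`. -/
def codeGen (σ i j : ℕ) : ℕ := lfsr σ (codeTaps σ) (codeDeg (codeExp σ) i j) % 2

def degA : Arith :=
  .op .add
    (.call mulA (.op .div (.op .div (.var 1) (.var 0)) (.const 2))
      (.op .add (.op .div (.var 2) (.var 0)) (.op .mod (.op .div (.var 1) (.var 0)) (.const 2)))
      (.const 0))
    (.op .add (.op .mod (.var 2) (.var 0)) (.op .mod (.var 1) (.var 0)))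

theorem eval_degA (M m i j) : degA.eval M [m, i, j] = codeDeg m i j := by
  simp [degA, eval, Op.eval, eval_mulA, codeDeg]

theorem small_degA : Small [true, true, true] degA := by
  refine (Small.call_all small_mulA (((Small.var rfl).div _).div _)
    (((Small.var rfl).div _).add (((Small.var rfl).div _).mod _)) (Small.const _)).add
    (((Small.var rfl).mod _).add ((Small.var rfl).mod _))

theorem tame_degA : Tame [true, true, true] degA := by
  have h := fun i => Tame.var (S := [true, true, true]) i
  refine Tame.op _ (Tame.call_all tame_mulA_all (((Small.var rfl).div _).div _)
    (((Small.var rfl).div _).add (((Small.var rfl).div _).mod _)) (Small.const _) ?_ ?_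
    (Tame.const _)) (Tame.op _ (Tame.op _ (h _) (h _)) (Tame.op _ (h _) (h _)))
  · exact Tame.op _ (Tame.op _ (h _) (h _)) (Tame.const _)
  · exact Tame.op _ (Tame.op _ (h _) (h _)) (Tame.op _ (Tame.op _ (h _) (h _)) (Tame.const _))

attribute [irreducible] degA

def genA : Arith :=
  .op .mod (.call lfsrA (.var 0) (.call tapsA (.var 0) (.const 0) (.const 0))
    (.call degA (expA (.var 0)) (.var 1) (.var 2))) (.const 2)

theorem eval_genA (M σ i j) : genA.eval M [σ, i, j] = codeGen σ i j := by
  simp [genA, eval, Op.eval, eval_lfsrA, eval_tapsA, eval_degA, eval_expA, codeGen]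

theorem tame_genA : Tame [true, true, true] genA := by
  refine Tame.op _ (Tame.call_all tame_lfsrA (Small.var rfl) ?_ ?_ (Tame.var _) ?_ ?_)
    (Tame.const _)
  · exact Small.call_all small_tapsA (Small.var rfl) (Small.const _) (Small.const _)
  · exact Small.call_all small_degA (Small.var rfl).exp (Small.var rfl) (Small.var rfl)
  · exact Tame.call_all tame_tapsA (Small.var rfl) (Small.const _) (Small.const _) (Tame.var _)
      (Tame.const _) (Tame.const _)
  · exact Tame.call_all tame_degA (Small.var rfl).exp (Small.var rfl) (Small.var rfl)
      (Tame.exp (Small.var rfl) (Tame.var _)) (Tame.var _) (Tame.var _)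

attribute [irreducible] genA

/-- The number of parity checks. -/
def codeRows (σ : ℕ) : ℕ := 2 * (codeExp σ * codeSize σ)

def rowsA : Arith := .call mulA (.const 2) (.call mulA (expA (.var 0)) (sizeA (.var 0)) (.const 0))
  (.const 0)

theorem eval_rowsA (M σ b c) : rowsA.eval M [σ, b, c] = codeRows σ := by
  simp [rowsA, eval, eval_mulA, eval_expA, eval_sizeA, codeRows]

theorem tame_rowsA : Tame [true, true, true] rowsA :=
  Tame.call_all tame_mulA_all (Small.const _) (Small.call_all small_mulA (Small.var rfl).exp
    (Small.var rfl).size (Small.const _)) (Small.const _) (Tame.const _)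
    (Tame.call_all tame_mulA_all (Small.var rfl).exp (Small.var rfl).size (Small.const _)
      (Tame.exp (Small.var rfl) (Tame.var _)) (Tame.size (Small.var rfl) (Tame.var _))
      (Tame.const _)) (Tame.const _)

attribute [irreducible] rowsA

end

/-! ## The parameters of the code -/

theorem four_mul_le_mul_two_pow (σ : ℕ) : ∃ m, 4 * σ ≤ m * 2 ^ m :=
  ⟨4 * σ, Nat.le_mul_of_pos_right _ (by positivity)⟩

/-- Since `i * 2 ^ i` is increasing, the exponents that are too small form an initial segment, and
counting them gives the least good one. It is at most `4 * σ`, so the range of the sum suffices, and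
capping the power at `4 * σ` does not change the comparison. -/
theorem codeExp_eq_find (σ : ℕ) : codeExp σ = Nat.find (four_mul_le_mul_two_pow σ) := by
  set m := Nat.find (four_mul_le_mul_two_pow σ) with hm
  have hmono : Monotone fun m : ℕ => m * 2 ^ m := fun a b hab =>
    Nat.mul_le_mul hab (Nat.pow_le_pow_right (by norm_num) hab)
  have hle : m ≤ 4 * σ := Nat.find_min' _ (Nat.le_mul_of_pos_right _ (by positivity))
  have key : ∀ i, i < 4 * σ → (i * min (2 ^ i) (4 * σ) < 4 * σ ↔ i < m) := by
    intro i hi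
    rw [hm, Nat.lt_find_iff]
    constructor
    · intro h j hj
      rw [not_le]
      refine lt_of_le_of_lt (hmono hj) ?_
      rcases le_total (2 ^ i) (4 * σ) with h' | h'
      · rwa [min_eq_left h'] at h
      -- If the cap is active, then `i * (4 * σ) < 4 * σ` forces `i = 0`, where both products
      -- vanish.
      · rw [min_eq_right h'] at h
        rcases i with _ | i
        · simpa using hi
        · rw [add_mul, one_mul] at h
          omega
    · intro h
      have := h i le_rfl
      rw [not_le] at this
      exact lt_of_le_of_lt (Nat.mul_le_mul_left _ (min_le_left _ _)) this
  rw [codeExp, ← Finset.sum_filter, Finset.sum_const, smul_eq_mul, mul_one]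
  have : (Finset.range (4 * σ)).filter (fun i => i * min (2 ^ i) (4 * σ) < 4 * σ) =
      Finset.range m := by
    ext i
    simp only [Finset.mem_filter, Finset.mem_range]
    constructor
    · exact fun h => (key i h.1).1 h.2
    · exact fun h => ⟨by omega, (key i (by omega)).2 h⟩
  rw [this, Finset.card_range]

theorem le_codeExp_mul (σ : ℕ) : 4 * σ ≤ codeExp σ * 2 ^ codeExp σ := by
  rw [codeExp_eq_find]
  exact Nat.find_spec (four_mul_le_mul_two_pow σ)

theorem codeExp_mul_lt {σ k : ℕ} (hk : k < codeExp σ) : k * 2 ^ k < 4 * σ := by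
  rw [codeExp_eq_find] at hk
  exact not_le.1 (Nat.find_min (four_mul_le_mul_two_pow σ) hk)

theorem two_le_codeExp {σ : ℕ} (hσ : 1 ≤ σ) : 2 ≤ codeExp σ := by
  by_contra! h
  have := le_codeExp_mul σ
  interval_cases codeExp σ <;> omega

/-- The cap has no effect: with `k = codeExp σ - 1 ≥ 1`, minimality gives `2 ^ k ≤ k * 2 ^ k < 4 *
σ`. -/
theorem codeSize_eq {σ : ℕ} (hσ : 1 ≤ σ) : codeSize σ = 2 ^ codeExp σ := by
  have h2 := two_le_codeExp hσ
  obtain ⟨k, hk⟩ : ∃ k, codeExp σ = k + 1 := ⟨codeExp σ - 1, by omega⟩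
  have h := codeExp_mul_lt (σ := σ) (k := k) (by omega)
  have h1 : 2 ^ k ≤ k * 2 ^ k := Nat.le_mul_of_pos_left _ (by omega)
  rw [codeSize, min_eq_left]
  rw [hk, pow_succ]
  omega

/-- The length of the codewords. -/
def codeLen (σ : ℕ) : ℕ := σ + codeRows σ

/-- Linear length follows from minimality of `m = k + 1`: the parity part has `4 * (k + 1) * 2 ^ k ≤
8 * k * 2 ^ k < 32 * σ` bits. -/
theorem codeLen_le {σ : ℕ} (hσ : 1 ≤ σ) : codeLen σ ≤ 33 * σ := by
  have h2 := two_le_codeExp hσ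
  obtain ⟨k, hk⟩ : ∃ k, codeExp σ = k + 1 := ⟨codeExp σ - 1, by omega⟩
  have h := codeExp_mul_lt (σ := σ) (k := k) (by omega)
  have h1 : (k + 1) * 2 ^ k ≤ 2 * (k * 2 ^ k) := by
    rw [← mul_assoc]; exact Nat.mul_le_mul_right _ (by omega)
  rw [codeLen, codeRows, codeSize_eq hσ, hk, pow_succ, ← mul_assoc (k + 1)]
  omega

theorem codeLen_le_mul {σ : ℕ} (hσ : 1 ≤ σ) : codeLen σ ≤ 3 * (codeExp σ * 2 ^ codeExp σ) := by
  have := le_codeExp_mul σ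
  rw [codeLen, codeRows, codeSize_eq hσ]
  omega

/-! ## Words of low weight -/

/-- A large family of nonempty subsets of a set of size `2 * m` has a large total size. -/
theorem mul_two_pow_le_sum_card {ι : Type*} (m : ℕ) (u : Finset ι) (hu : u.card = 2 * m)
    (T : Finset (Finset ι)) (hT : ∀ w ∈ T, w ⊆ u) (hT0 : ∀ w ∈ T, w.Nonempty)
    (hcard : 2 ^ m ≤ 2 * T.card) : m * 2 ^ m ≤ 48 * ∑ w ∈ T, w.card := by
  classical
  -- The light sets, of size at most `m / 12`, are at most a quarter of `2 ^ m`; so at least another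
  -- quarter of `2 ^ m` of the sets in `T` are heavy.
  set L := T.filter fun w => 12 * w.card ≤ m with hL
  have hLcard : 4 * L.card ≤ 2 ^ m := by
    rcases lt_or_ge m 12 with hm | hm
    -- For `m < 12` a light set would be empty, which is excluded.
    · have : L = ∅ := Finset.filter_eq_empty_iff.2 fun w hw => by
        have := (hT0 w hw).card_pos
        omega
      rw [this]; simp
    -- A Chernoff-type count: with weight `8 ^ (2 * m - |w|)` all subsets together weigh `9 ^ (2 *
    -- m)`, while each light set weighs at least `8 ^ (2 * m - m / 12)`.
    · have h1 : ∑ w ∈ u.powerset, 1 ^ w.card * 8 ^ (u.card - w.card) = (1 + 8) ^ u.card :=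
        Finset.sum_pow_mul_eq_add_pow 1 8 u
      have h2 : L.card * 8 ^ (2 * m - m / 12) ≤ 9 ^ (2 * m) := by
        calc L.card * 8 ^ (2 * m - m / 12)
            ≤ ∑ w ∈ L, 1 ^ w.card * 8 ^ (u.card - w.card) := by
              rw [← smul_eq_mul]
              refine Finset.card_nsmul_le_sum _ _ _ fun w hw => ?_
              rw [one_pow, one_mul, hu]
              have := (Finset.mem_filter.1 hw).2
              exact Nat.pow_le_pow_right (by norm_num) (by omega)
          _ ≤ ∑ w ∈ u.powerset, 1 ^ w.card * 8 ^ (u.card - w.card) :=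
              Finset.sum_le_sum_of_subset fun w hw =>
                Finset.mem_powerset.2 (hT w (Finset.mem_filter.1 hw).1)
          _ = _ := by rw [h1, hu]
      have h3 : L.card * 8 ^ (2 * m) ≤ 9 ^ (2 * m) * 8 ^ (m / 12) := by
        have : (8 : ℕ) ^ (2 * m) = 8 ^ (2 * m - m / 12) * 8 ^ (m / 12) := by
          rw [← pow_add]; congr 1; omega
        rw [this, ← mul_assoc]
        exact Nat.mul_le_mul_right _ h2
      -- The numerical core is `4 * 81 ^ 12 * 8 ≤ 128 ^ 12`, applied once for every full dozen in
      -- `m`; there is at least one, which also pays for the leading factor 4.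
      have h4 : 4 * (81 ^ m * 8 ^ (m / 12)) ≤ 128 ^ m := by
        obtain ⟨k, r, hk, hkr⟩ : ∃ k r, 1 ≤ k ∧ m = 12 * k + r ∧ m / 12 = k :=
          ⟨m / 12, m % 12, by omega, by omega, rfl⟩
        rw [hkr.2, hkr.1, pow_add, pow_add, pow_mul, pow_mul]
        calc 4 * ((81 ^ 12) ^ k * 81 ^ r * 8 ^ k) ≤ 4 ^ k * ((81 ^ 12) ^ k * 128 ^ r * 8 ^ k) := by
              gcongr
              · exact Nat.le_self_pow (by omega) 4
              · norm_num
          _ = (4 * 81 ^ 12 * 8) ^ k * 128 ^ r := by rw [mul_pow, mul_pow]; ring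
          _ ≤ (128 ^ 12) ^ k * 128 ^ r := by gcongr; norm_num
      have h5 : (128 : ℕ) ^ m = 2 ^ m * 8 ^ (2 * m) := by
        rw [pow_mul, ← mul_pow]; norm_num
      have h6 : (9 : ℕ) ^ (2 * m) = 81 ^ m := by rw [pow_mul]; norm_num
      rw [h6] at h3
      refine Nat.le_of_mul_le_mul_right (c := 8 ^ (2 * m)) ?_ (by positivity)
      rw [← h5]
      calc 4 * L.card * 8 ^ (2 * m) = 4 * (L.card * 8 ^ (2 * m)) := by ring
        _ ≤ 4 * (81 ^ m * 8 ^ (m / 12)) := Nat.mul_le_mul_left _ h3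
        _ ≤ _ := h4
  have hsplit := Finset.card_filter_add_card_filter_not (s := T) fun w => 12 * w.card ≤ m
  rw [← hL] at hsplit
  set H := T.filter fun w => ¬ 12 * w.card ≤ m with hH
  have h1 : m * H.card ≤ 12 * ∑ w ∈ T, w.card := by
    calc m * H.card = H.card • m := by rw [smul_eq_mul, mul_comm]
      _ ≤ ∑ w ∈ H, 12 * w.card := Finset.card_nsmul_le_sum _ _ _ fun w hw => by
          have := (Finset.mem_filter.1 hw).2
          omega
      _ = 12 * ∑ w ∈ H, w.card := by rw [Finset.mul_sum]
      _ ≤ _ := Nat.mul_le_mul_left _ (Finset.sum_le_sum_of_subset (Finset.filter_subset _ _))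
  calc m * 2 ^ m ≤ m * (4 * H.card) := Nat.mul_le_mul_left _ (by omega)
    _ = 4 * (m * H.card) := by ring
    _ ≤ 4 * (12 * ∑ w ∈ T, w.card) := Nat.mul_le_mul_left _ h1
    _ = _ := by ring

/-! ## The shift register and its field -/

theorem bitOf_lt_two (y i : ℕ) : bitOf y i < 2 := Nat.mod_lt _ (by norm_num)

theorem bitOf_div_two (y i : ℕ) : bitOf (y / 2) i = bitOf y (i + 1) := by
  rw [bitOf, bitOf, pow_succ', Nat.div_div_eq_div_mul]

theorem eq_of_bitOf_eq {m y y' : ℕ} (hy : y < 2 ^ m) (hy' : y' < 2 ^ m)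
    (h : ∀ i < m, bitOf y i = bitOf y' i) : y = y' := by
  refine Nat.eq_of_testBit_eq fun i => ?_
  rcases lt_or_ge i m with hi | hi
  · have := h i hi
    simp only [bitOf] at this
    rw [Nat.testBit_eq_decide_div_mod_eq, Nat.testBit_eq_decide_div_mod_eq, this]
  · have := Nat.pow_le_pow_right (n := 2) (by norm_num) hi
    rw [Nat.testBit_lt_two_pow (by omega), Nat.testBit_lt_two_pow (by omega)]

theorem exists_bitOf_eq {m : ℕ} (v : ℕ → ZMod 2) :
    ∃ y < 2 ^ m, ∀ i < m, (bitOf y i : ZMod 2) = v i := by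
  refine ⟨Nat.ofBits fun i : Fin m => decide (v i = 1), Nat.ofBits_lt_two_pow _, fun i hi => ?_⟩
  have h := Nat.testBit_ofBits_lt (fun i : Fin m => decide (v i = 1)) i hi
  rw [Nat.testBit_eq_decide_div_mod_eq] at h
  have h2 := bitOf_lt_two (Nat.ofBits fun i : Fin m => decide (v i = 1)) i
  have h3 : ∀ x : ZMod 2, x ≠ 1 → x = 0 := by decide
  simp only [decide_eq_decide] at h
  rw [bitOf] at h2 ⊢
  by_cases hv : v i = 1
  · rw [h.2 hv, hv]; rfl
  · rw [h3 _ hv]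
    have : Nat.ofBits (fun i : Fin m => decide (v i = 1)) / 2 ^ i % 2 = 0 := by
      have := mt h.1 hv
      omega
    rw [this]; rfl

section

variable {σ p : ℕ}

theorem lfsrStep_lt (hσ : 1 ≤ σ) {y : ℕ} (hy : y < 2 ^ codeExp σ) :
    lfsrStep σ p y < 2 ^ codeExp σ := by
  have h2 := two_le_codeExp hσ
  obtain ⟨k, hk⟩ : ∃ k, codeExp σ = k + 1 := ⟨codeExp σ - 1, by omega⟩
  rw [lfsrStep, codeSize_eq hσ]
  rw [hk, pow_succ] at hy ⊢
  split <;> omega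

/-- All states have `codeExp σ` bits, so the cap in `lfsr` is never active and the recursion is the
plain iteration of the step. -/
theorem lfsr_lt (hσ : 1 ≤ σ) (e : ℕ) : lfsr σ p e < 2 ^ codeExp σ ∧
    lfsr σ p (e + 1) = lfsrStep σ p (lfsr σ p e) := by
  have h2 := two_le_codeExp hσ
  have key : ∀ e, lfsr σ p e < 2 ^ codeExp σ → lfsr σ p (e + 1) = lfsrStep σ p (lfsr σ p e) := by
    intro e he
    change min (lfsrStep σ p (lfsr σ p e)) (codeSize σ) = _
    rw [codeSize_eq hσ, min_eq_left (lfsrStep_lt hσ he).le]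
  have hlt : lfsr σ p e < 2 ^ codeExp σ := by
    induction e with
    | zero =>
      change 1 < _
      exact Nat.one_lt_two_pow (by omega)
    | succ e ih => rw [key e ih]; exact lfsrStep_lt hσ ih
  exact ⟨hlt, key e hlt⟩

/-- The feedback only adds a bit at the top position, so below it the step is a shift. -/
theorem bitOf_lfsrStep_of_lt (hσ : 1 ≤ σ) {y i : ℕ} (hi : i + 1 < codeExp σ) :
    bitOf (lfsrStep σ p y) i = bitOf y (i + 1) := by
  obtain ⟨k, hk⟩ : ∃ k, codeExp σ = k + 1 := ⟨codeExp σ - 1, by omega⟩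
  rw [← bitOf_div_two, lfsrStep, codeSize_eq hσ]
  split
  · rfl
  · obtain ⟨d, hd⟩ : ∃ d, k = i + 1 + d := ⟨k - (i + 1), by omega⟩
    have h : 2 ^ codeExp σ / 2 = 2 ^ i * (2 * 2 ^ d) := by
      rw [hk, pow_succ, Nat.mul_div_cancel _ (by norm_num), hd, pow_add, pow_succ, mul_assoc]
    rw [h, bitOf, bitOf, Nat.add_mul_div_left _ _ (by positivity), Nat.add_mul_mod_self_left]

theorem bitOf_lfsrStep_last (hσ : 1 ≤ σ) {y i : ℕ} (hy : y < 2 ^ codeExp σ)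
    (hi : i + 1 = codeExp σ) :
    (bitOf (lfsrStep σ p y) i : ZMod 2) =
      ∑ i ∈ Finset.range (codeExp σ), (bitOf y i : ZMod 2) * bitOf p i := by
  have hsum : ((∑ i ∈ Finset.range (codeExp σ), if bitOf y i = 0 then 0 else bitOf p i : ℕ) :
      ZMod 2) = ∑ i ∈ Finset.range (codeExp σ), (bitOf y i : ZMod 2) * bitOf p i := by
    push_cast
    refine Finset.sum_congr rfl fun i _ => ?_
    have := bitOf_lt_two y i
    rcases (show bitOf y i = 0 ∨ bitOf y i = 1 by omega) with h | h <;> simp [h]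
  rw [← hsum, lfsrStep, codeSize_eq hσ]
  rw [← hi, pow_succ] at hy ⊢
  have hlt : y / 2 < 2 ^ i := by omega
  generalize (∑ i ∈ Finset.range (i + 1), if bitOf y i = 0 then 0 else bitOf p i) = S
  rcases Nat.mod_two_eq_zero_or_one S with h | h
  · rw [if_pos h, bitOf, Nat.add_zero, Nat.div_eq_of_lt hlt, ← ZMod.natCast_mod S, h]
  · rw [if_neg (by omega), bitOf, Nat.mul_div_cancel _ (by norm_num),
      Nat.add_div_right _ (by positivity), Nat.div_eq_of_lt hlt, ← ZMod.natCast_mod S, h]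

end

/-! ### The ring belonging to a shift register -/

section

variable {R : Type} [CommRing R] [Algebra (ZMod 2) R]

/-- The coefficient of the `k`-th power of the generator. -/
def powCoeff (pb : PowerBasis (ZMod 2) R) (k : ℕ) : R →ₗ[ZMod 2] ZMod 2 :=
  if h : k < pb.dim then pb.basis.coord ⟨k, h⟩ else 0

theorem powCoeff_pow (pb : PowerBasis (ZMod 2) R) {k i : ℕ} (hk : k < pb.dim) (hi : i < pb.dim) :
    powCoeff pb k (pb.gen ^ i) = if i = k then 1 else 0 := by
  have : pb.gen ^ i = pb.basis ⟨i, hi⟩ := (pb.basis_eq_pow ⟨i, hi⟩).symm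
  rw [powCoeff, dif_pos hk, this, Module.Basis.coord_apply, Module.Basis.repr_self,
    Finsupp.single_apply]
  simp

/-- The taps `p` describe the minimal equation of the generator. -/
def IsTaps (pb : PowerBasis (ZMod 2) R) (p : ℕ) : Prop :=
  pb.gen ^ pb.dim = ∑ i ∈ Finset.range pb.dim, (bitOf p i : ZMod 2) • pb.gen ^ i

/-- The initial state 1 lists the constant coefficients of `1, g, …, g ^ (m - 1)`. A step shifts
this window by one power, and the feedback bit is right because multiplying the tap equation by `g ^
e` expresses `g ^ (e + m)` by the powers in the window. -/
theorem bitOf_lfsr (pb : PowerBasis (ZMod 2) R) {σ p : ℕ} (hσ : 1 ≤ σ)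
    (hdim : pb.dim = codeExp σ) (hp : IsTaps pb p) (e : ℕ) {i : ℕ} (hi : i < codeExp σ) :
    (bitOf (lfsr σ p e) i : ZMod 2) = powCoeff pb 0 (pb.gen ^ (e + i)) := by
  have h2 := two_le_codeExp hσ
  induction e generalizing i with
  | zero =>
    rw [Nat.zero_add, powCoeff_pow pb (by omega) (by omega)]
    change ((1 / 2 ^ i % 2 : ℕ) : ZMod 2) = _
    rcases i with _ | i
    · simp
    · rw [Nat.div_eq_of_lt (Nat.one_lt_two_pow (by omega))]
      simp
  | succ e ih =>
    rw [(lfsr_lt hσ e).2]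
    rcases (show i + 1 < codeExp σ ∨ i + 1 = codeExp σ by omega) with h | h
    · rw [bitOf_lfsrStep_of_lt hσ h, ih h]
      congr 2; omega
    · rw [bitOf_lfsrStep_last hσ (lfsr_lt hσ e).1 h]
      have : pb.gen ^ (e + 1 + i) = pb.gen ^ e * pb.gen ^ pb.dim := by
        rw [← pow_add]; congr 1; omega
      rw [this, hp, Finset.mul_sum, map_sum, hdim]
      refine Finset.sum_congr rfl fun j hj => ?_
      rw [ih (Finset.mem_range.1 hj), mul_smul_comm, map_smul, ← pow_add, smul_eq_mul, mul_comm]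

theorem natCard_of_powerBasis (pb : PowerBasis (ZMod 2) R) : Nat.card R = 2 ^ pb.dim := by
  rw [Nat.card_congr pb.basis.equivFun.toEquiv]
  simp

theorem finite_of_powerBasis (pb : PowerBasis (ZMod 2) R) : Finite R :=
  Finite.of_equiv _ pb.basis.equivFun.toEquiv.symm

/-- The states of the register, as vectors. -/
def stateMap (pb : PowerBasis (ZMod 2) R) (r : R) : Fin pb.dim → ZMod 2 :=
  fun i => powCoeff pb 0 (r * pb.gen ^ (i : ℕ))

/-- The register with the taps `p` runs through all nonzero states. -/
def FullPeriod (σ p : ℕ) : Prop :=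
  ∀ y, 0 < y → y < codeSize σ → ∃ e < codeSize σ, lfsr σ p e = y

theorem missed_eq_zero_iff (σ p : ℕ) : missed σ p = 0 ↔ FullPeriod σ p := by
  simp only [missed, Finset.sum_eq_zero_iff, Finset.mem_range, ite_eq_right_iff, one_ne_zero,
    imp_false, not_forall, not_not, exists_prop]
  constructor
  · intro h y hy hy'
    obtain ⟨e, he, heq⟩ := h (y - 1) (by omega)
    exact ⟨e, he, by omega⟩
  · intro h y hy
    exact h (y + 1) (by omega) (by omega)

end

section

variable {R : Type} [CommRing R] [Algebra (ZMod 2) R] (pb : PowerBasis (ZMod 2) R) {σ p : ℕ}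

theorem stateMap_pow (hσ : 1 ≤ σ) (hdim : pb.dim = codeExp σ) (hp : IsTaps pb p) (e : ℕ)
    (i : Fin pb.dim) : stateMap pb (pb.gen ^ e) i = (bitOf (lfsr σ p e) i : ZMod 2) := by
  rw [bitOf_lfsr pb hσ hdim hp e (hdim ▸ i.2), stateMap, pow_add]

theorem natCast_bitOf_inj {y y' i : ℕ} (h : (bitOf y i : ZMod 2) = bitOf y' i) :
    bitOf y i = bitOf y' i := by
  have := (ZMod.natCast_eq_natCast_iff' _ _ _).1 h
  rwa [Nat.mod_eq_of_lt (bitOf_lt_two _ _), Nat.mod_eq_of_lt (bitOf_lt_two _ _)] at this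

theorem exists_stateMap_eq (hσ : 1 ≤ σ) (hdim : pb.dim = codeExp σ) (hp : IsTaps pb p)
    (hfull : FullPeriod σ p) {v : Fin pb.dim → ZMod 2} (hv : v ≠ 0) :
    ∃ e < codeSize σ, stateMap pb (pb.gen ^ e) = v := by
  obtain ⟨y, hy, hyv⟩ := exists_bitOf_eq (m := codeExp σ) fun i =>
    if h : i < pb.dim then v ⟨i, h⟩ else 0
  have hv' : ∀ i : Fin pb.dim, (bitOf y i : ZMod 2) = v i := fun i => by
    rw [hyv i (hdim ▸ i.2), dif_pos i.2]
  obtain ⟨e, he, heq⟩ := hfull y (Nat.pos_of_ne_zero fun h0 => hv (funext fun i => by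
    rw [← hv' i, h0]; simp [bitOf])) (by rwa [codeSize_eq hσ])
  exact ⟨e, he, funext fun i => by rw [stateMap_pow pb hσ hdim hp, heq, hv']⟩

theorem natCard_state : Nat.card R = Nat.card (Fin pb.dim → ZMod 2) := by
  rw [natCard_of_powerBasis pb]
  simp

theorem stateMap_zero : stateMap pb 0 = 0 := by
  funext i
  simp [stateMap]

/-- Full period makes the map surjective, since every nonzero vector is the state of some power and
zero is the state of 0. Domain and codomain are finite of equal size. The ring is not yet known to
be a field. -/
theorem stateMap_injective (hσ : 1 ≤ σ) (hdim : pb.dim = codeExp σ) (hp : IsTaps pb p)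
    (hfull : FullPeriod σ p) : Function.Injective (stateMap pb) := by
  have := finite_of_powerBasis pb
  refine (Function.Surjective.bijective_of_nat_card_le (fun v => ?_)
    (natCard_state pb).le).injective
  by_cases hv : v = 0
  · exact ⟨0, by rw [hv, stateMap_zero]⟩
  · obtain ⟨e, _, he⟩ := exists_stateMap_eq pb hσ hdim hp hfull hv
    exact ⟨_, he⟩

theorem exists_pow_eq (hσ : 1 ≤ σ) (hdim : pb.dim = codeExp σ) (hp : IsTaps pb p)
    (hfull : FullPeriod σ p) {r : R} (hr : r ≠ 0) : ∃ e : ℕ, pb.gen ^ e = r := by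
  have hinj := stateMap_injective pb hσ hdim hp hfull
  obtain ⟨e, _, he⟩ := exists_stateMap_eq pb hσ hdim hp hfull (v := stateMap pb r)
    (fun h => hr (hinj (h.trans (stateMap_zero pb).symm)))
  exact ⟨e, hinj he⟩

/-- The nonzero element `1 + g` is a power of `g`, and not the zeroth one because its coefficient at
`g` is 1. So `1 + g = g * g ^ e`, which gives `g * (g ^ e - 1) = 1`. -/
theorem isUnit_gen (hσ : 1 ≤ σ) (hdim : pb.dim = codeExp σ) (hp : IsTaps pb p)
    (hfull : FullPeriod σ p) : IsUnit pb.gen := by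
  have h2 := two_le_codeExp hσ
  have h1 : powCoeff pb 1 pb.gen = 1 := by
    simpa using powCoeff_pow pb (k := 1) (i := 1) (by omega) (by omega)
  have h1' : powCoeff pb 1 1 = 0 := by
    simpa using powCoeff_pow pb (k := 1) (i := 0) (by omega) (by omega)
  obtain ⟨e, he⟩ := exists_pow_eq pb hσ hdim hp hfull (r := 1 + pb.gen) fun h => by
    have := congrArg (powCoeff pb 1) h
    rw [map_add, h1, h1', map_zero] at this
    exact absurd this (by decide)
  rcases e with _ | e
  · have := congrArg (powCoeff pb 1) he
    rw [map_add, h1, pow_zero, h1'] at this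
    exact absurd this (by decide)
  · refine IsUnit.of_mul_eq_one (pb.gen ^ e - 1) ?_
    rw [mul_sub, ← pow_succ', he]
    ring

theorem nontrivial_of_powCoeff (hσ : 1 ≤ σ) (hdim : pb.dim = codeExp σ) : Nontrivial R := by
  have h2 := two_le_codeExp hσ
  refine ⟨⟨1, 0, fun h => ?_⟩⟩
  have h1 := powCoeff_pow pb (k := 0) (i := 0) (by omega) (by omega)
  rw [pow_zero, h, map_zero, if_pos rfl] at h1
  exact absurd h1 (by decide)

/-- Every nonzero element is a power of the unit `g`. Thus the exhaustive search on registers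
certifies a field, and no irreducibility test is needed. -/
theorem isDomain_of_fullPeriod (hσ : 1 ≤ σ) (hdim : pb.dim = codeExp σ) (hp : IsTaps pb p)
    (hfull : FullPeriod σ p) : IsDomain R := by
  have := nontrivial_of_powCoeff pb hσ hdim
  refine IsField.isDomain ⟨exists_pair_ne R, mul_comm, fun {r} hr => ?_⟩
  obtain ⟨e, rfl⟩ := exists_pow_eq pb hσ hdim hp hfull hr
  exact ((isUnit_gen pb hσ hdim hp hfull).pow e).exists_right_inv

/-- The powers of `g` and 0 exhaust the ring, so the powers with exponent below `2 ^ m - 1` are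
distinct. -/
theorem le_orderOf_gen (hσ : 1 ≤ σ) (hdim : pb.dim = codeExp σ) (hp : IsTaps pb p)
    (hfull : FullPeriod σ p) : 2 ^ codeExp σ ≤ orderOf pb.gen + 1 := by
  classical
  have := finite_of_powerBasis pb
  have := Fintype.ofFinite R
  rw [← hdim, ← natCard_of_powerBasis pb, Nat.card_eq_fintype_card, ← Finset.card_univ]
  have hfin : 0 < orderOf pb.gen := by
    obtain ⟨u, hu⟩ := isUnit_gen pb hσ hdim hp hfull
    rw [← hu, orderOf_units]
    exact orderOf_pos u
  have hsub : (Finset.univ : Finset R) ⊆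
      insert 0 ((Finset.range (orderOf pb.gen)).image fun e => pb.gen ^ e) := by
    intro r _
    rw [Finset.mem_insert, Finset.mem_image]
    by_cases hr : r = 0
    · exact .inl hr
    · obtain ⟨e, rfl⟩ := exists_pow_eq pb hσ hdim hp hfull hr
      exact .inr ⟨e % orderOf pb.gen, Finset.mem_range.2 (Nat.mod_lt _ hfin),
        pow_mod_orderOf _ _⟩
  refine (Finset.card_le_card hsub).trans ((Finset.card_insert_le _ _).trans ?_)
  exact Nat.succ_le_succ (Finset.card_image_le.trans (Finset.card_range _).le)

end

/-! ### Existence and search of taps with full period -/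

/-- If a nonzero `r` had zero state, the constant-coefficient functional would vanish on all
multiples of `r`, that is on the whole field, although it is 1 at 1. -/
theorem stateMap_injective_of_field {F : Type} [Field F] [Algebra (ZMod 2) F]
    (pb : PowerBasis (ZMod 2) F) (h : 0 < pb.dim) : Function.Injective (stateMap pb) := by
  intro a b hab
  by_contra hne
  have hr : a - b ≠ 0 := sub_ne_zero.2 hne
  have hzero : powCoeff pb 0 ∘ₗ LinearMap.mulLeft (ZMod 2) (a - b) = 0 := by
    refine pb.basis.ext fun i => ?_
    rw [pb.basis_eq_pow]
    have := congrFun hab i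
    simp only [stateMap] at this
    simp [sub_mul, this]
  have h1 := LinearMap.congr_fun hzero (a - b)⁻¹
  have h2 := powCoeff_pow pb h h
  simp [hr] at h1 h2
  rw [h1] at h2
  exact absurd h2 (by decide)

/-- The taps come from the minimal equation of a generator `g` of the multiplicative group of the
field with `2 ^ m` elements. Every nonzero state belongs to a nonzero element, hence to a power of
`g`, and the register reaches it after that many steps. -/
theorem exists_fullPeriod {σ : ℕ} (hσ : 1 ≤ σ) : ∃ p < codeSize σ, FullPeriod σ p := by
  classical
  have h2 := two_le_codeExp hσ
  set m := codeExp σ with hm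
  have hm0 : m ≠ 0 := by omega
  let F := GaloisField 2 m
  have hcard : Nat.card F = 2 ^ m := GaloisField.card 2 m hm0
  have := Nat.finite_of_card_ne_zero (α := F) (by rw [hcard]; positivity)
  have := Fintype.ofFinite F
  obtain ⟨g, hg⟩ := IsCyclic.exists_generator (α := Fˣ)
  have hpow : ∀ r : F, r ≠ 0 → ∃ e < codeSize σ, (g : F) ^ e = r := by
    intro r hr
    have h1 := hg (Units.mk0 r hr)
    rw [mem_zpowers_iff_mem_range_orderOf, Finset.mem_image] at h1
    obtain ⟨e, he, heq⟩ := h1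
    refine ⟨e, ?_, by rw [← Units.val_pow_eq_pow_val, heq]; rfl⟩
    rw [codeSize_eq hσ, ← hm, ← hcard]
    exact (Finset.mem_range.1 he).trans_le
      (orderOf_le_card.trans (Nat.card_le_card_of_injective _ Units.val_injective))
  have htop : Algebra.adjoin (ZMod 2) {(g : F)} = ⊤ := by
    refine eq_top_iff.2 fun r _ => ?_
    by_cases hr : r = 0
    · rw [hr]; exact zero_mem _
    · obtain ⟨e, _, rfl⟩ := hpow r hr
      exact pow_mem (Algebra.self_mem_adjoin_singleton _ _) e
  let pb := PowerBasis.ofAdjoinEqTop (Algebra.IsIntegral.isIntegral (g : F)) htop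
  have hgen : pb.gen = g := PowerBasis.ofAdjoinEqTop_gen _ _
  have hdim : pb.dim = m := by rw [← pb.finrank, GaloisField.finrank 2 hm0]
  -- The bits of `p` are the coordinates of `g ^ m` in the power basis.
  obtain ⟨p, hp, hpv⟩ := exists_bitOf_eq (m := m) fun i =>
    if h : i < pb.dim then pb.basis.repr (pb.gen ^ pb.dim) ⟨i, h⟩ else 0
  have htaps : IsTaps pb p := by
    rw [IsTaps, Finset.sum_range]
    conv_lhs => rw [← pb.basis.sum_repr (pb.gen ^ pb.dim)]
    refine Finset.sum_congr rfl fun i _ => ?_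
    rw [pb.basis_eq_pow, hpv i (i.2.trans_eq hdim), dif_pos i.2]
  refine ⟨p, by rwa [codeSize_eq hσ], fun y hy hy' => ?_⟩
  have hinj := stateMap_injective_of_field pb (by omega)
  obtain ⟨r, hr⟩ := (hinj.bijective_of_nat_card_le (natCard_state pb).ge).surjective
    fun i => (bitOf y i : ZMod 2)
  rw [codeSize_eq hσ] at hy'
  have hbit : ∀ {y'}, y' < 2 ^ m →
      (∀ i : Fin pb.dim, (bitOf y i : ZMod 2) = bitOf y' i) → y = y' := fun h' h =>
    eq_of_bitOf_eq hy' h' fun i hi => natCast_bitOf_inj (h ⟨i, hi.trans_eq hdim.symm⟩)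
  have hr0 : r ≠ 0 := by
    rintro rfl
    have := hbit (y' := 0) (by positivity) fun i => by
      rw [← congrFun hr i, stateMap_zero]; simp [bitOf]
    omega
  obtain ⟨e, he, heq⟩ := hpow r hr0
  refine ⟨e, he, (hbit (lfsr_lt hσ e).1 fun i => ?_).symm⟩
  rw [← stateMap_pow pb hσ hdim htaps e i, hgen, heq, hr]

/-- `codeTaps` counts the `p` for which no number up to `p` works; these are the numbers below the
least one that works, so the count is that number. -/
theorem fullPeriod_codeTaps {σ : ℕ} (hσ : 1 ≤ σ) : FullPeriod σ (codeTaps σ) := by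
  have hex : ∃ p, FullPeriod σ p := by
    obtain ⟨p, _, hp⟩ := exists_fullPeriod hσ
    exact ⟨p, hp⟩
  classical
  suffices codeTaps σ = Nat.find hex by rw [this]; exact Nat.find_spec hex
  have hlt : Nat.find hex < codeSize σ := by
    obtain ⟨p, hlt, hp⟩ := exists_fullPeriod hσ
    exact (Nat.find_min' hex hp).trans_lt hlt
  rw [codeTaps, ← Finset.sum_filter, Finset.sum_const, smul_eq_mul, mul_one]
  conv_rhs => rw [← Finset.card_range (Nat.find hex)]
  congr 1
  ext p
  simp only [Finset.mem_filter, Finset.mem_range, Finset.sum_eq_zero_iff, ite_eq_right_iff,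
    one_ne_zero, imp_false, missed_eq_zero_iff, Nat.lt_find_iff, Nat.lt_succ_iff]
  exact ⟨fun h => h.2, fun h => ⟨((Nat.lt_find_iff hex p).2 h).trans hlt, h⟩⟩

/-- The field that belongs to the shift register of the code. -/
theorem exists_powerBasis (σ : ℕ) :
    ∃ (R : Type) (_ : CommRing R) (_ : Algebra (ZMod 2) R) (pb : PowerBasis (ZMod 2) R),
      pb.dim = codeExp σ ∧ IsTaps pb (codeTaps σ) := by
  open Polynomial in
  set m := codeExp σ
  -- The ring is the quotient by the monic polynomial `X ^ m - q` with the taps as coefficients of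
  -- `q`. Irreducibility is not used.
  let q : (ZMod 2)[X] := ∑ i : Fin m, C (bitOf (codeTaps σ) i : ZMod 2) * X ^ (i : ℕ)
  have hdeg : (-q).degree < m := by
    rw [degree_neg]
    exact degree_sum_fin_lt _
  have hmonic : (X ^ m + -q).Monic := monic_X_pow_add hdeg
  have hdim : (AdjoinRoot.powerBasis' hmonic).dim = m := by
    rw [AdjoinRoot.powerBasis'_dim]
    refine natDegree_eq_of_degree_eq_some ?_
    rw [degree_add_eq_left_of_degree_lt, degree_X_pow]
    rwa [degree_X_pow]
  refine ⟨_, _, _, AdjoinRoot.powerBasis' hmonic, hdim, ?_⟩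
  have hroot : aeval (AdjoinRoot.root (X ^ m + -q)) (X ^ m + -q) = 0 := by
    rw [AdjoinRoot.aeval_eq, AdjoinRoot.mk_self]
  rw [IsTaps, hdim, AdjoinRoot.powerBasis'_gen, Finset.sum_range]
  rw [map_add, map_neg, add_neg_eq_zero, map_pow, aeval_X, map_sum] at hroot
  rw [hroot]
  refine Finset.sum_congr rfl fun i _ => ?_
  rw [map_mul, map_pow, aeval_X, aeval_C, Algebra.smul_def]

/-! ## The distance of the code -/

/-- The sum modulo two of `f j` over `j < n`. -/
def xorSum (f : ℕ → Bool) (n : ℕ) : Bool := Nat.rec false (fun j acc => acc ^^ f j) n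

/-- The parity check number `i` of the message `z`. -/
def parityBit (σ : ℕ) (z : ℕ → Bool) (i : ℕ) : Bool :=
  xorSum (fun j => decide (codeGen σ i j ≠ 0) && z j) σ

theorem toNat_xor_cast (a b : Bool) :
    ((a ^^ b).toNat : ZMod 2) = (a.toNat : ZMod 2) + (b.toNat : ZMod 2) := by
  cases a <;> cases b <;> decide

theorem xorSum_cast (f : ℕ → Bool) (n : ℕ) :
    ((xorSum f n).toNat : ZMod 2) = ∑ j ∈ Finset.range n, ((f j).toNat : ZMod 2) := by
  induction n with
  | zero => rfl
  | succ n ih => rw [Finset.sum_range_succ, ← ih, ← toNat_xor_cast]; rfl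

theorem xorSum_xor (f g : ℕ → Bool) (n : ℕ) :
    xorSum (fun j => f j ^^ g j) n = (xorSum f n ^^ xorSum g n) := by
  induction n with
  | zero => rfl
  | succ n ih =>
    change (xorSum (fun j => f j ^^ g j) n ^^ (f n ^^ g n)) = ((xorSum f n ^^ f n) ^^
      (xorSum g n ^^ g n))
    rw [ih]
    cases xorSum f n <;> cases xorSum g n <;> cases f n <;> cases g n <;> rfl

/-- Linearity of the code, which reduces distance to weight. -/
theorem parityBit_xor (σ : ℕ) (z z' : ℕ → Bool) (i : ℕ) :
    parityBit σ (fun j => z j ^^ z' j) i = (parityBit σ z i ^^ parityBit σ z' i) := by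
  rw [parityBit, parityBit, parityBit, ← xorSum_xor]
  congr 1
  funext j
  cases z j <;> cases z' j <;> simp

theorem xorSum_congr {f g : ℕ → Bool} {n : ℕ} (h : ∀ j < n, f j = g j) :
    xorSum f n = xorSum g n := by
  induction n with
  | zero => rfl
  | succ n ih =>
    change (xorSum f n ^^ f n) = (xorSum g n ^^ g n)
    rw [ih fun j hj => h j (by omega), h n (by omega)]

theorem parityBit_congr {σ : ℕ} {z z' : ℕ → Bool} (h : ∀ j < σ, z j = z' j) (i : ℕ) :
    parityBit σ z i = parityBit σ z' i :=
  xorSum_congr fun j hj => by rw [h j hj]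

theorem parityBit_cast (σ : ℕ) (z : ℕ → Bool) (i : ℕ) : ((parityBit σ z i).toNat : ZMod 2) =
    ∑ j ∈ Finset.range σ, ((z j).toNat : ZMod 2) * codeGen σ i j := by
  rw [parityBit, xorSum_cast]
  refine Finset.sum_congr rfl fun j _ => ?_
  have h : codeGen σ i j < 2 := Nat.mod_lt _ (by norm_num)
  rcases (show codeGen σ i j = 0 ∨ codeGen σ i j = 1 by omega) with h | h <;> simp [h]

/-! ### The polynomial behind the message and the weight of codewords -/

open Polynomial in
/-- The message polynomial. -/
def msgPoly {R : Type} [CommRing R] (g : R) (m σ : ℕ) (z : ℕ → Bool) : R[X] :=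
  ∑ j ∈ Finset.range σ, if z j then monomial (j / m) (g ^ (j % m)) else 0

theorem eval_msgPoly {R : Type} [CommRing R] (g : R) (m σ : ℕ) (z : ℕ → Bool) (r : R) :
    (msgPoly g m σ z).eval r =
      ∑ j ∈ Finset.range σ, if z j then g ^ (j % m) * r ^ (j / m) else 0 := by
  rw [msgPoly, Polynomial.eval_finsetSum]
  refine Finset.sum_congr rfl fun j _ => ?_
  split <;> simp

theorem natDegree_msgPoly {R : Type} [CommRing R] (g : R) (m σ : ℕ) (z : ℕ → Bool) :
    (msgPoly g m σ z).natDegree ≤ (σ - 1) / m := by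
  refine Polynomial.natDegree_sum_le_of_forall_le _ _ fun j hj => ?_
  split
  · refine (Polynomial.natDegree_monomial_le _).trans (Nat.div_le_div_right ?_)
    have := Finset.mem_range.1 hj
    omega
  · simp

section

variable {R : Type} [CommRing R] [Algebra (ZMod 2) R] (pb : PowerBasis (ZMod 2) R) {σ : ℕ}

/-- Bit `k` of the message is the coordinate at `g ^ (k % m)` of the coefficient at `X ^ (k / m)`,
so no bit can cancel another. -/
theorem msgPoly_ne_zero (hσ : 1 ≤ σ) (hdim : pb.dim = codeExp σ) {z : ℕ → Bool} {k : ℕ}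
    (hk : k < σ) (hz : z k = true) : msgPoly pb.gen (codeExp σ) σ z ≠ 0 := by
  have h2 := two_le_codeExp hσ
  set m := codeExp σ
  intro h
  have h1 := congrArg (fun f => powCoeff pb (k % m) (f.coeff (k / m))) h
  simp only [msgPoly, Polynomial.finsetSum_coeff, Polynomial.coeff_zero, map_zero, map_sum] at h1
  rw [Finset.sum_eq_single k] at h1
  · rw [if_pos hz, Polynomial.coeff_monomial, if_pos rfl, powCoeff_pow, if_pos rfl] at h1
    · exact absurd h1 (by decide)
    · rw [hdim]; exact Nat.mod_lt _ (by omega)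
    · rw [hdim]; exact Nat.mod_lt _ (by omega)
  · intro j _ hj
    split
    · rw [Polynomial.coeff_monomial]
      split
      · rw [powCoeff_pow, if_neg]
        · intro h'
          rename_i h''
          exact hj (by rw [← Nat.div_add_mod j m, ← Nat.div_add_mod k m, h', h''])
        · rw [hdim]; exact Nat.mod_lt _ (by omega)
        · rw [hdim]; exact Nat.mod_lt _ (by omega)
      · simp
    · simp
  · intro h; exact absurd (Finset.mem_range.2 hk) h

/-- This explains `codeDeg`: row `(2 * a + t) * m + s` is bit `s` of the state of `α ^ t * f(α)`
with `α = g ^ a`. Message bit `j` enters through `g ^ (j % m) * α ^ (j / m)`, and collecting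
exponents of `g` gives the degree. -/
theorem parityBit_eq_powCoeff (hσ : 1 ≤ σ) (hdim : pb.dim = codeExp σ)
    (hp : IsTaps pb (codeTaps σ)) (z : ℕ → Bool) {a t s : ℕ} (ht : t < 2) (hs : s < codeExp σ) :
    ((parityBit σ z ((2 * a + t) * codeExp σ + s)).toNat : ZMod 2) =
      powCoeff pb 0 ((pb.gen ^ a) ^ t * (msgPoly pb.gen (codeExp σ) σ z).eval (pb.gen ^ a) *
        pb.gen ^ s) := by
  have h2 := two_le_codeExp hσ
  set m := codeExp σ with hm
  have hgen : ∀ i j, (codeGen σ i j : ZMod 2) = powCoeff pb 0 (pb.gen ^ codeDeg m i j) := by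
    intro i j
    have := bitOf_lfsr pb hσ hdim hp (codeDeg m i j) (i := 0) (by omega)
    rw [Nat.add_zero] at this
    rw [← this, codeGen, bitOf, pow_zero, Nat.div_one]
  have h1 : ((2 * a + t) * m + s) / m = 2 * a + t := by
    rw [mul_comm, Nat.mul_add_div (by omega), Nat.div_eq_of_lt hs, Nat.add_zero]
  have h3 : ((2 * a + t) * m + s) % m = s := by
    rw [mul_comm, Nat.mul_add_mod, Nat.mod_eq_of_lt hs]
  rw [parityBit_cast, eval_msgPoly, Finset.mul_sum, Finset.sum_mul, map_sum]
  refine Finset.sum_congr rfl fun j _ => ?_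
  rw [hgen, codeDeg, h1, h3, show (2 * a + t) / 2 = a by omega, show (2 * a + t) % 2 = t by omega]
  rcases z j
  · simp
  · simp only [Bool.toNat_true, Nat.cast_one, one_mul, if_true]
    congr 1
    rw [pow_add, pow_add, mul_add, pow_add, pow_mul, pow_mul]
    ring

/-- The weight of the parity part of a nonzero codeword. -/
theorem codeLen_le_mul_card_parityBit (hσ : 1 ≤ σ) (z : ℕ → Bool) {k : ℕ} (hk : k < σ)
    (hz : z k = true) : codeLen σ ≤
      144 * ((Finset.range (codeRows σ)).filter fun i => parityBit σ z i = true).card := by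
  classical
  obtain ⟨R, _, _, pb, hdim, hp⟩ := exists_powerBasis σ
  have hfull := fullPeriod_codeTaps hσ
  have h2 := two_le_codeExp hσ
  have hinj := stateMap_injective pb hσ hdim hp hfull
  have hunit := isUnit_gen pb hσ hdim hp hfull
  have hord := le_orderOf_gen pb hσ hdim hp hfull
  have := isDomain_of_fullPeriod pb hσ hdim hp hfull
  have hlen := codeLen_le_mul hσ
  have h4 := le_codeExp_mul σ
  have hrows : codeRows σ = 2 * (codeExp σ * 2 ^ codeExp σ) := by rw [codeRows, codeSize_eq hσ]
  set m := codeExp σ with hm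
  set f := msgPoly pb.gen m σ z with hf
  have hf0 : f ≠ 0 := msgPoly_ne_zero pb hσ hdim hk hz
  -- The good exponents. The last of the `2 ^ m` blocks is ignored, since only `2 ^ m - 1` powers
  -- are guaranteed to be distinct.
  let A := (Finset.range (2 ^ m - 1)).filter fun a => f.eval (pb.gen ^ a) ≠ 0
  have hpowinj : ∀ {a b}, a < 2 ^ m - 1 → b < 2 ^ m - 1 → pb.gen ^ a = pb.gen ^ b → a = b := by
    intro a b ha hb h
    exact pow_injOn_Iio_orderOf (x := pb.gen) (Set.mem_Iio.2 (by omega))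
      (Set.mem_Iio.2 (by omega)) h
  have hAcard : 2 ^ m ≤ 2 * A.card := by
    -- The bad exponents give distinct roots of `f`, so they are bounded by its degree.
    have hB : ((Finset.range (2 ^ m - 1)).filter fun a => ¬ f.eval (pb.gen ^ a) ≠ 0).card ≤
        (σ - 1) / m := by
      calc _ = (((Finset.range (2 ^ m - 1)).filter fun a => ¬ f.eval (pb.gen ^ a) ≠ 0).image
              fun a => pb.gen ^ a).card := by
            refine (Finset.card_image_of_injOn fun a ha b hb h => ?_).symm
            simp only [Finset.coe_filter, Finset.mem_range, Set.mem_ofPred_eq] at ha hb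
            exact hpowinj ha.1 hb.1 h
        _ ≤ f.roots.toFinset.card := by
            refine Finset.card_le_card fun r hr => ?_
            obtain ⟨a, ha, rfl⟩ := Finset.mem_image.1 hr
            rw [Multiset.mem_toFinset, Polynomial.mem_roots hf0]
            exact not_not.1 (Finset.mem_filter.1 ha).2
        _ ≤ f.roots.card := Multiset.toFinset_card_le _
        _ ≤ f.natDegree := Polynomial.card_roots' f
        _ ≤ _ := natDegree_msgPoly _ _ _ _
    have hsplit := Finset.card_filter_add_card_filter_not (s := Finset.range (2 ^ m - 1))
      fun a => f.eval (pb.gen ^ a) ≠ 0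
    rw [Finset.card_range] at hsplit
    have hq : (σ - 1) / m < 2 ^ m / 4 := by
      rw [Nat.div_lt_iff_lt_mul (by omega)]
      have h : 2 ^ m = 4 * (2 ^ m / 4) := by
        obtain ⟨d, hd⟩ : ∃ d, m = 2 + d := ⟨m - 2, by omega⟩
        rw [hd, pow_add]; omega
      rw [h] at h4
      have : m * (4 * (2 ^ m / 4)) = 4 * (2 ^ m / 4 * m) := by ring
      omega
    have hA : A.card =
      ((Finset.range (2 ^ m - 1)).filter fun a => f.eval (pb.gen ^ a) ≠ 0).card := rfl
    omega
  -- The support of block `a`, which holds the states of `f(α)` and `α f(α)`.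
  let w : ℕ → Finset ℕ := fun a =>
    (Finset.range (2 * m)).filter fun i => parityBit σ z (2 * m * a + i) = true
  have hw : ∀ a t s, t < 2 → s < m → (t * m + s ∈ w a ↔
      powCoeff pb 0 ((pb.gen ^ a) ^ t * f.eval (pb.gen ^ a) * pb.gen ^ s) = 1) := by
    intro a t s ht hs
    rw [← parityBit_eq_powCoeff pb hσ hdim hp z ht hs, Finset.mem_filter, Finset.mem_range,
      show (2 * a + t) * m + s = 2 * m * a + (t * m + s) by ring]
    have : t * m + s < 2 * m := by
      have : t * m ≤ 1 * m := Nat.mul_le_mul_right _ (by omega)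
      omega
    rw [and_iff_right this]
    cases parityBit σ z (2 * m * a + (t * m + s)) <;> decide
  have hstate : ∀ a b t, t < 2 → w a = w b →
      (pb.gen ^ a) ^ t * f.eval (pb.gen ^ a) = (pb.gen ^ b) ^ t * f.eval (pb.gen ^ b) := by
    intro a b t ht hab
    refine hinj (funext fun s => ?_)
    have hs := s.2.trans_eq hdim
    have h1 := hw a t s ht hs
    rw [hab, hw b t s ht hs] at h1
    have h3 : ∀ x y : ZMod 2, (x = 1 ↔ y = 1) → y = x := by decide
    exact h3 _ _ h1
  -- Equal blocks have equal `f(α)` and equal `α f(α)`; cancelling the nonzero value `f(α)` recovers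
  -- `α`, and hence `a`.
  have hwinj : Set.InjOn w A := by
    intro a ha b hb hab
    simp only [A, Finset.coe_filter, Finset.mem_range, Set.mem_ofPred_eq] at ha hb
    have h0 := hstate a b 0 (by norm_num) hab
    have h1 := hstate a b 1 (by norm_num) hab
    simp only [pow_zero, one_mul, pow_one] at h0 h1
    rw [h0] at h1
    exact hpowinj ha.1 hb.1 (mul_right_cancel₀ hb.2 h1)
  have hmain := mul_two_pow_le_sum_card m (Finset.range (2 * m)) (Finset.card_range _) (A.image w)
    (by
      intro v hv
      obtain ⟨a, _, rfl⟩ := Finset.mem_image.1 hv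
      exact Finset.filter_subset _ _)
    (by
      intro v hv
      obtain ⟨a, ha, rfl⟩ := Finset.mem_image.1 hv
      by_contra hempty
      rw [Finset.not_nonempty_iff_eq_empty] at hempty
      refine (Finset.mem_filter.1 ha).2 (hinj ?_)
      rw [stateMap_zero]
      funext s
      have h1 := hw a 0 s (by norm_num) (s.2.trans_eq hdim)
      rw [hempty, pow_zero, one_mul] at h1
      have h3 : ∀ x : ZMod 2, ¬ x = 1 → x = 0 := by decide
      exact h3 _ fun h => absurd (h1.2 h) (Finset.notMem_empty _))
    (by rwa [Finset.card_image_of_injOn hwinj])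
  rw [Finset.sum_image hwinj, ← Finset.card_sigma] at hmain
  have hle : (A.sigma w).card ≤
      ((Finset.range (codeRows σ)).filter fun i => parityBit σ z i = true).card := by
    -- The blocks occupy disjoint ranges of rows, so their weights add up.
    refine Finset.card_le_card_of_injOn (fun x => 2 * m * x.1 + x.2) ?_ ?_
    · rintro ⟨a, i⟩ hx
      simp only [A, w, Finset.coe_sigma, Set.mem_sigma_iff, Finset.mem_coe, Finset.mem_filter,
        Finset.mem_range] at hx ⊢
      refine ⟨?_, hx.2.2⟩
      rw [hrows, ← mul_assoc]
      calc 2 * m * a + i < 2 * m * a + 2 * m := by omega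
        _ = 2 * m * (a + 1) := by ring
        _ ≤ _ := Nat.mul_le_mul_left _ (by omega)
    · rintro ⟨a, i⟩ hx ⟨b, j⟩ hy h
      simp only [w, Finset.coe_sigma, Set.mem_sigma_iff, Finset.mem_coe, Finset.mem_filter,
        Finset.mem_range] at hx hy h
      have h1 := congrArg (· / (2 * m)) h
      have h3 := congrArg (· % (2 * m)) h
      simp only [Nat.mul_add_div (show 2 * m > 0 by omega), Nat.mul_add_mod,
        Nat.div_eq_of_lt hx.2.1, Nat.div_eq_of_lt hy.2.1, Nat.mod_eq_of_lt hx.2.1,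
        Nat.mod_eq_of_lt hy.2.1, Nat.add_zero] at h1 h3
      rw [h1, h3]
  omega

end

/-! ## Circuits as systems of equations -/

/-- The value of a gate under a valuation of the vertices. -/
def Gate.value (val : ℕ → Bool) : Gate → Bool
  | .and a b => val a && val b
  | .or a b => val a || val b
  | .not a => !val a

theorem Gate.value_congr {val val' : ℕ → Bool} {k : ℕ} {g : Gate} (hg : g.Below k)
    (h : ∀ i < k, val i = val' i) : g.value val = g.value val' := by
  cases g with
  | and a b => rw [value, value, h a hg.1, h b hg.2]
  | or a b => rw [value, value, h a hg.1, h b hg.2]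
  | not a => rw [value, value, h a hg]

/-- Entries never change once appended, so every gate equation holds with respect to the final list
as well. The evaluation loop becomes a system of equations. -/
theorem foldl_gates (gs : List Gate) : ∀ (init : List Bool),
    (∀ (i : ℕ) (h : i < gs.length), (gs[i]).Below (init.length + i)) →
    ∃ r, gs.foldl (fun vals g => vals ++ [g.eval vals]) init = r ∧
      r.length = init.length + gs.length ∧
      (∀ i < init.length, r.getD i false = init.getD i false) ∧
      ∀ (i : ℕ) (h : i < gs.length),
        r.getD (init.length + i) false = (gs[i]).value fun i => r.getD i false := by
  induction gs with
  | nil => exact fun init _ => ⟨init, rfl, rfl, fun _ _ => rfl, fun i h => absurd h (by simp)⟩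
  | cons g gs ih =>
    intro init hb
    obtain ⟨r, hr, hlen, hold, hnew⟩ := ih (init ++ [g.eval init]) fun i h => by
      have := hb (i + 1) (by simpa using h)
      rw [List.length_append, List.length_singleton, add_assoc, add_comm 1]
      simpa using this
    rw [List.length_append, List.length_singleton] at hlen hold hnew
    have hold' : ∀ i < init.length, r.getD i false = init.getD i false := fun i hi => by
      rw [hold i (by omega), List.getD_append _ _ _ _ hi]
    refine ⟨r, by rw [List.foldl_cons, hr], by rw [hlen, List.length_cons]; omega, hold', ?_⟩
    rintro (_ | i) h
    · rw [Nat.add_zero, hold _ (by omega), List.getD_append_right _ _ _ _ le_rfl, Nat.sub_self]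
      refine Gate.value_congr (val := fun i => init.getD i false) (hb 0 (by simp)) fun i hi => ?_
      exact (hold' i hi).symm
    · have := hnew i (by simpa using h)
      rw [add_assoc, add_comm 1 i] at this
      exact this

/-- The values of the vertices of a circuit. -/
theorem Circuit.exists_val {N : ℕ} (D : Circuit N) (z : ℕ → Bool) (hpos : 0 < D.size) :
    ∃ val : ℕ → Bool, (∀ i < N, val i = z i) ∧
      (∀ (i : ℕ) (h : i < D.gates.length), val (N + i) = (D.gates[i]).value val) ∧
      D.eval (fun i => z i) = val (D.size - 1) := by
  obtain ⟨r, hr, hlen, hold, hnew⟩ := foldl_gates D.gates (List.ofFn fun i : Fin N => z i) (by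
    simpa using D.acyclic)
  rw [List.length_ofFn] at hlen hold hnew
  refine ⟨fun i => r.getD i false, fun i hi => ?_, hnew, ?_⟩
  · exact (hold i hi).trans (by simp [hi])
  · rw [Circuit.eval, hr]
    rw [size] at hpos ⊢
    rw [← hlen] at hpos ⊢
    have hne : r ≠ [] := List.ne_nil_of_length_pos hpos
    rw [List.getLastD_eq_getLast?, List.getLast?_eq_getElem?]
    simp

/-! ## The circuit that checks the codewords -/

/-- The number of vertices that check one row. -/
def rowSize (σ : ℕ) : ℕ := 4 * σ + 1

/-- The number of vertices that check the codewords. -/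
def checkSize (q σ : ℕ) : ℕ := 2 + q * codeRows σ * rowSize σ

/-- The kind of the checking gate number `x`. -/
def checkKind (σ x : ℕ) : ℕ :=
  if x = 0 then 2 else if x = 1 then 0 else
  if (x - 2) % rowSize σ = 4 * σ then 1 else
  if (x - 2) % rowSize σ % 4 = 0 then 1 else if (x - 2) % rowSize σ % 4 = 2 then 2 else 0

/-- The first argument of the checking gate number `x`. -/
def checkFst (q σ x : ℕ) : ℕ :=
  if x = 0 then 0 else if x = 1 then 0 else
  if (x - 2) % rowSize σ = 4 * σ then q * codeLen σ + x - (x - 2) % rowSize σ - 1 else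
  if (x - 2) % rowSize σ % 4 = 2 then q * codeLen σ + x - 1 else
  if (x - 2) % rowSize σ % 4 = 3 then q * codeLen σ + x - 3 else
  if (x - 2) % rowSize σ / 4 = 0 then
    (x - 2) / rowSize σ / codeRows σ * codeLen σ + σ + (x - 2) / rowSize σ % codeRows σ
  else q * codeLen σ + x - (x - 2) % rowSize σ % 4 - 1

/-- The second argument of the checking gate number `x`. -/
def checkSnd (q σ x : ℕ) : ℕ :=
  if x = 0 then 0 else if x = 1 then q * codeLen σ else
  if (x - 2) % rowSize σ = 4 * σ then q * codeLen σ + x - 1 else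
  if (x - 2) % rowSize σ % 4 = 2 then q * codeLen σ + x - 1 else
  if (x - 2) % rowSize σ % 4 = 3 then q * codeLen σ + x - 1 else
  if codeGen σ ((x - 2) / rowSize σ % codeRows σ) ((x - 2) % rowSize σ / 4) = 0 then
    q * codeLen σ + 1
  else (x - 2) / rowSize σ / codeRows σ * codeLen σ + (x - 2) % rowSize σ / 4

/-- The gate with the given code. -/
def Gate.ofCode (k a b : ℕ) : Gate := if k = 0 then .and a b else if k = 1 then .or a b else .not a

/-- Gates 0 and 1 produce the constant false as `z₀ ∧ ¬z₀`. Then each parity check has `4 * σ + 1`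
gates. For each message position, four gates replace the accumulator `u` by the exclusive or `(u ∨
y) ∧ ¬(u ∧ y)`, where `y` is the message bit or constant false according to the generator matrix;
the first accumulator is the stored parity bit. The last gate of the row adds the result to a
running disjunction of errors, which starts at gate 1. -/
def checkGate (q σ x : ℕ) : Gate := .ofCode (checkKind σ x) (checkFst q σ x) (checkSnd q σ x)

/-- The code of a negation lists its argument twice, which is why `checkSnd` repeats `checkFst` on
negations. -/
theorem code_checkGate (q σ x : ℕ) :
    (checkGate q σ x).code = [checkKind σ x, checkFst q σ x, checkSnd q σ x] := by
  rw [checkGate, checkKind, checkFst, checkSnd]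
  by_cases h0 : x = 0
  · simp [h0, Gate.ofCode, Gate.code]
  by_cases h1 : x = 1
  · simp [h1, Gate.ofCode, Gate.code]
  by_cases h2 : (x - 2) % rowSize σ = 4 * σ
  · simp [h0, h1, h2, Gate.ofCode, Gate.code]
  by_cases h3 : (x - 2) % rowSize σ % 4 = 2
  · simp [h0, h1, h2, h3, Gate.ofCode, Gate.code]
  by_cases h4 : (x - 2) % rowSize σ % 4 = 0
  · simp [h0, h1, h2, h4, Gate.ofCode, Gate.code]
  · simp [h0, h1, h2, h3, h4, Gate.ofCode, Gate.code]

/-- The new number of the vertex `v` of the original circuit. -/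
def renumber (q σ v : ℕ) : ℕ :=
  if v < q * σ then v / σ * codeLen σ + v % σ else v - q * σ + (q * codeLen σ + checkSize q σ)

def Gate.map (f : ℕ → ℕ) : Gate → Gate
  | .and a b => .and (f a) (f b)
  | .or a b => .or (f a) (f b)
  | .not a => .not (f a)

/-- The gates of the circuit that checks that the blocks are codewords and runs `D` on the
messages. -/
def robustGates {q σ : ℕ} (D : Circuit (q * σ)) : List Gate :=
  (List.range (checkSize q σ)).map (checkGate q σ) ++ (D.gates.map (Gate.map (renumber q σ)) ++
    [.not (q * codeLen σ + checkSize q σ - 1),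
      .and (renumber q σ (D.size - 1)) (q * codeLen σ + checkSize q σ + D.gates.length)])

theorem length_robustGates {q σ : ℕ} (D : Circuit (q * σ)) :
    (robustGates D).length = checkSize q σ + D.gates.length + 2 := by
  simp [robustGates, add_assoc]

theorem robustGates_check {q σ : ℕ} (D : Circuit (q * σ)) {x : ℕ} (hx : x < checkSize q σ) :
    (robustGates D)[x]'(by rw [length_robustGates]; omega) = checkGate q σ x := by
  simp only [robustGates]
  rw [List.getElem_append_left (by simpa using hx)]
  simp

theorem robustGates_gate {q σ : ℕ} (D : Circuit (q * σ)) {i : ℕ} (hi : i < D.gates.length) :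
    (robustGates D)[checkSize q σ + i]'(by rw [length_robustGates]; omega) =
      (D.gates[i]).map (renumber q σ) := by
  simp only [robustGates]
  rw [List.getElem_append_right (by simp), List.getElem_append_left (by simpa using hi)]
  simp

theorem robustGates_not {q σ : ℕ} (D : Circuit (q * σ)) :
    (robustGates D)[checkSize q σ + D.gates.length]'(by rw [length_robustGates]; omega) =
      .not (q * codeLen σ + checkSize q σ - 1) := by
  simp only [robustGates]
  rw [List.getElem_append_right (by simp), List.getElem_append_right (by simp)]
  simp

theorem robustGates_and {q σ : ℕ} (D : Circuit (q * σ)) :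
    (robustGates D)[checkSize q σ + D.gates.length + 1]'(by rw [length_robustGates]; omega) =
      .and (renumber q σ (D.size - 1)) (q * codeLen σ + checkSize q σ + D.gates.length) := by
  simp only [robustGates]
  rw [List.getElem_append_right (by simp; omega), List.getElem_append_right (by simp; omega)]
  simp [add_assoc]

theorem block_lt {q b k i : ℕ} (hk : k < q) (hi : i < b) : k * b + i < q * b := by
  calc k * b + i < k * b + b := by omega
    _ = (k + 1) * b := by ring
    _ ≤ _ := Nat.mul_le_mul_right _ hk

theorem renumber_lt {q σ v i : ℕ} (hσ : 1 ≤ σ) (hv : v < q * σ + i) :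
    renumber q σ v < q * codeLen σ + (checkSize q σ + i) := by
  rw [renumber]
  split
  · rename_i h
    have := block_lt (q := q) (b := codeLen σ) (k := v / σ) (i := v % σ)
      ((Nat.div_lt_iff_lt_mul hσ).2 h)
      ((Nat.mod_lt _ hσ).trans_le (Nat.le_add_right _ _))
    omega
  · omega

theorem below_checkGate {q σ x : ℕ} (hq : 1 ≤ q) (hσ : 1 ≤ σ) (hx : x < checkSize q σ) :
    (checkGate q σ x).Below (q * codeLen σ + x) := by
  have hlen : 1 ≤ codeLen σ := hσ.trans (Nat.le_add_right _ _)
  have hn : 1 ≤ q * codeLen σ := Nat.mul_pos hq hlen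
  have key : checkFst q σ x < q * codeLen σ + x ∧
      (checkKind σ x < 2 → checkSnd q σ x < q * codeLen σ + x) := by
    rw [checkFst, checkSnd, checkKind]
    by_cases h0 : x = 0
    · simp [h0]; omega
    by_cases h1 : x = 1
    · simp [h1]
    have hw : 0 < rowSize σ := Nat.succ_pos _
    have hrow : (x - 2) / rowSize σ < q * codeRows σ := by
      rw [Nat.div_lt_iff_lt_mul hw]
      rw [checkSize] at hx
      omega
    have hc : 0 < codeRows σ := Nat.pos_of_ne_zero fun h => by
      rw [h, mul_zero] at hrow; exact absurd hrow (Nat.not_lt_zero _)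
    have hk : (x - 2) / rowSize σ / codeRows σ < q := (Nat.div_lt_iff_lt_mul hc).2 hrow
    have ho : (x - 2) % rowSize σ < 4 * σ + 1 := Nat.mod_lt _ hw
    have hacc := block_lt (b := codeLen σ) (i := σ + (x - 2) / rowSize σ % codeRows σ) hk
      (Nat.add_lt_add_left (Nat.mod_lt _ hc) σ)
    rw [← add_assoc] at hacc
    simp only [if_neg h0, if_neg h1]
    by_cases h2 : (x - 2) % rowSize σ = 4 * σ
    · simp only [if_pos h2]; omega
    have hy := block_lt (b := codeLen σ) (i := (x - 2) % rowSize σ / 4) hk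
      ((show (x - 2) % rowSize σ / 4 < σ by omega).trans_le (Nat.le_add_right _ _))
    simp only [if_neg h2]
    refine ⟨?_, fun _ => ?_⟩ <;> split_ifs <;> omega
  rw [checkGate, Gate.ofCode]
  split
  · exact ⟨key.1, key.2 (by omega)⟩
  · split
    · exact ⟨key.1, key.2 (by omega)⟩
    · exact key.1

/-- The number of inputs is a variable with an equation because over the alphabet `{0,1}^1` it
appears as a product with 1. -/
def robustCircuit {q σ N : ℕ} (hq : 1 ≤ q) (hσ : 1 ≤ σ) (hN : N = q * codeLen σ)
    (D : Circuit (q * σ)) : Circuit N where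
  gates := robustGates D
  acyclic := by
    subst hN
    intro i hi
    rw [length_robustGates] at hi
    have hqσ : 1 ≤ q * σ := Nat.mul_pos hq hσ
    have hC : 2 ≤ checkSize q σ := Nat.le_add_right _ _
    rcases lt_or_ge i (checkSize q σ) with h | h
    · rw [robustGates_check D h]
      exact below_checkGate hq hσ h
    · obtain ⟨j, rfl⟩ := Nat.exists_eq_add_of_le h
      rcases lt_or_ge j D.gates.length with h' | h'
      · rw [robustGates_gate D h']
        have := D.acyclic j h'
        revert this
        rcases D.gates[j] with ⟨a, b⟩ | ⟨a, b⟩ | a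
        · exact fun h => ⟨renumber_lt hσ h.1, renumber_lt hσ h.2⟩
        · exact fun h => ⟨renumber_lt hσ h.1, renumber_lt hσ h.2⟩
        · exact fun h => renumber_lt hσ h
      · rcases (show j = D.gates.length ∨ j = D.gates.length + 1 by omega) with rfl | rfl
        · rw [robustGates_not]
          change _ < _
          omega
        · change ((robustGates D)[checkSize q σ + D.gates.length + 1]'_).Below _
          rw [robustGates_and]
          refine ⟨renumber_lt hσ ?_, ?_⟩
          · rw [Circuit.size]; omega
          · omega

section

variable {q σ : ℕ} {val : ℕ → Bool}

theorem checkGate_row {q σ ρ o : ℕ} (ho : o < 4 * σ) :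
    checkGate q σ (2 + ρ * rowSize σ + o) =
      if o % 4 = 2 then .not (q * codeLen σ + (2 + ρ * rowSize σ + o) - 1) else
      if o % 4 = 3 then .and (q * codeLen σ + (2 + ρ * rowSize σ + o) - 3)
        (q * codeLen σ + (2 + ρ * rowSize σ + o) - 1) else
      .ofCode (if o % 4 = 0 then 1 else 0)
        (if o / 4 = 0 then ρ / codeRows σ * codeLen σ + σ + ρ % codeRows σ
          else q * codeLen σ + (2 + ρ * rowSize σ + o) - o % 4 - 1)
        (if codeGen σ (ρ % codeRows σ) (o / 4) = 0 then q * codeLen σ + 1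
          else ρ / codeRows σ * codeLen σ + o / 4) := by
  have h1 : 2 + ρ * rowSize σ + o - 2 = rowSize σ * ρ + o := by rw [mul_comm]; omega
  have hlt : o < rowSize σ := by rw [rowSize]; omega
  have h2 : (rowSize σ * ρ + o) % rowSize σ = o := by
    rw [Nat.mul_add_mod, Nat.mod_eq_of_lt hlt]
  have h3 : (rowSize σ * ρ + o) / rowSize σ = ρ := by
    rw [Nat.mul_add_div (by omega), Nat.div_eq_of_lt hlt, Nat.add_zero]
  rw [checkGate, checkKind, checkFst, checkSnd, h1, h2, h3]
  have h4 : 2 + ρ * rowSize σ + o ≠ 0 := by omega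
  have h5 : 2 + ρ * rowSize σ + o ≠ 1 := by omega
  have h6 : o ≠ 4 * σ := by omega
  simp only [if_neg h4, if_neg h5, if_neg h6]
  by_cases h7 : o % 4 = 2
  · simp [h7, Gate.ofCode]
  by_cases h8 : o % 4 = 3
  · simp [h8, Gate.ofCode]
  simp only [if_neg h7, if_neg h8]

theorem checkGate_last {q σ ρ : ℕ} :
    checkGate q σ (2 + ρ * rowSize σ + 4 * σ) =
      .or (q * codeLen σ + (1 + ρ * rowSize σ)) (q * codeLen σ + (2 + ρ * rowSize σ + 4 * σ) - 1) := by
  have h1 : 2 + ρ * rowSize σ + 4 * σ - 2 = rowSize σ * ρ + 4 * σ := by rw [mul_comm]; omega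
  have h2 : (rowSize σ * ρ + 4 * σ) % rowSize σ = 4 * σ := by
    rw [Nat.mul_add_mod, Nat.mod_eq_of_lt (show 4 * σ < rowSize σ from Nat.lt_succ_self _)]
  rw [checkGate, checkKind, checkFst, checkSnd, h1, h2]
  have h4 : 2 + ρ * rowSize σ + 4 * σ ≠ 0 := by omega
  have h5 : 2 + ρ * rowSize σ + 4 * σ ≠ 1 := by omega
  simp only [if_neg h4, if_neg h5, if_true, Gate.ofCode, one_ne_zero, if_false]
  congr 1
  omega

/-- The error of row `ρ` of the parity checks. -/
def rowError (σ : ℕ) (val : ℕ → Bool) (ρ : ℕ) : Bool :=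
  val (ρ / codeRows σ * codeLen σ + σ + ρ % codeRows σ) ^^
    parityBit σ (fun j => val (ρ / codeRows σ * codeLen σ + j)) (ρ % codeRows σ)

theorem val_zero
    (hval : ∀ x < checkSize q σ, val (q * codeLen σ + x) = (checkGate q σ x).value val) :
    val (q * codeLen σ + 1) = false := by
  have h0 := hval 0 (by rw [checkSize]; omega)
  have h1 := hval 1 (by rw [checkSize]; omega)
  simp [checkGate, Gate.ofCode, checkKind, checkFst, checkSnd, Gate.value] at h0 h1
  rw [h1, h0]
  simp

/-- The value after the first `j` quadruples. The case distinction reflects that the initial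
accumulator is an input vertex and not a gate. -/
theorem val_row
    (hval : ∀ x < checkSize q σ, val (q * codeLen σ + x) = (checkGate q σ x).value val)
    {ρ : ℕ} (hρ : ρ < q * codeRows σ) {j : ℕ} (hj : j ≤ σ) :
    (if j = 0 then val (ρ / codeRows σ * codeLen σ + σ + ρ % codeRows σ)
      else val (q * codeLen σ + (1 + ρ * rowSize σ + 4 * j))) =
      (val (ρ / codeRows σ * codeLen σ + σ + ρ % codeRows σ) ^^
        xorSum (fun j => decide (codeGen σ (ρ % codeRows σ) j ≠ 0) &&
          val (ρ / codeRows σ * codeLen σ + j)) j) := by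
  have hsize : 2 + ρ * rowSize σ + rowSize σ ≤ checkSize q σ := by
    have : (ρ + 1) * rowSize σ ≤ q * codeRows σ * rowSize σ := Nat.mul_le_mul_right _ hρ
    rw [add_mul, one_mul] at this
    rw [checkSize]
    omega
  have hsize' : rowSize σ = 4 * σ + 1 := rfl
  have hzero := val_zero hval
  induction j with
  | zero => simp [xorSum]
  | succ j ih =>
    have ih := ih (by omega)
    rw [if_neg (Nat.succ_ne_zero j)]
    set y := if codeGen σ (ρ % codeRows σ) j = 0 then q * codeLen σ + 1
      else ρ / codeRows σ * codeLen σ + j with hy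
    set acc := if j = 0 then ρ / codeRows σ * codeLen σ + σ + ρ % codeRows σ
      else q * codeLen σ + (1 + ρ * rowSize σ + 4 * j) with hacc
    have ih' : val acc = _ := (apply_ite val _ _ _).trans ih
    have e0 := hval (2 + ρ * rowSize σ + 4 * j) (by omega)
    have e1 := hval (2 + ρ * rowSize σ + (4 * j + 1)) (by omega)
    have e2 := hval (2 + ρ * rowSize σ + (4 * j + 2)) (by omega)
    have e3 := hval (2 + ρ * rowSize σ + (4 * j + 3)) (by omega)
    rw [checkGate_row (by omega)] at e0 e1 e2 e3
    rw [show 4 * j % 4 = 0 by omega, show 4 * j / 4 = j by omega] at e0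
    rw [show (4 * j + 1) % 4 = 1 by omega, show (4 * j + 1) / 4 = j by omega] at e1
    rw [show (4 * j + 2) % 4 = 2 by omega] at e2
    rw [show (4 * j + 3) % 4 = 3 by omega] at e3
    rw [← hy, show q * codeLen σ + (2 + ρ * rowSize σ + 4 * j) - 0 - 1 =
      q * codeLen σ + (1 + ρ * rowSize σ + 4 * j) by omega, ← hacc] at e0
    rw [← hy, show q * codeLen σ + (2 + ρ * rowSize σ + (4 * j + 1)) - 1 - 1 =
      q * codeLen σ + (1 + ρ * rowSize σ + 4 * j) by omega, ← hacc] at e1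
    simp [Gate.ofCode, Gate.value] at e0 e1 e2 e3
    rw [show q * codeLen σ + (2 + ρ * rowSize σ + (4 * j + 2)) - 1 =
      q * codeLen σ + (2 + ρ * rowSize σ + (4 * j + 1)) by omega, e1] at e2
    rw [show q * codeLen σ + (2 + ρ * rowSize σ + (4 * j + 3)) - 1 =
      q * codeLen σ + (2 + ρ * rowSize σ + (4 * j + 2)) by omega, e2,
      show q * codeLen σ + (2 + ρ * rowSize σ + (4 * j + 3)) - 3 =
      q * codeLen σ + (2 + ρ * rowSize σ + 4 * j) by omega, e0] at e3
    rw [show 1 + ρ * rowSize σ + 4 * (j + 1) = 2 + ρ * rowSize σ + (4 * j + 3) by omega, e3]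
    have hyval : val y = (decide (codeGen σ (ρ % codeRows σ) j ≠ 0) &&
        val (ρ / codeRows σ * codeLen σ + j)) := by
      rw [hy]
      by_cases h : codeGen σ (ρ % codeRows σ) j = 0
      · rw [if_pos h, hzero]; simp [h]
      · rw [if_neg h]; simp [h]
    have hstep : ∀ f : ℕ → Bool, xorSum f (j + 1) = (xorSum f j ^^ f j) := fun _ => rfl
    rw [hstep, ← Bool.xor_assoc, ← ih', ← hyval]
    cases val acc <;> cases val y <;> rfl

/-- The gate before row `ρ` carries the disjunction of the errors of all earlier rows; for `ρ = 0`
it is the constant false. -/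
theorem val_check (hσ : 1 ≤ σ)
    (hval : ∀ x < checkSize q σ, val (q * codeLen σ + x) = (checkGate q σ x).value val)
    {ρ : ℕ} (hρ : ρ ≤ q * codeRows σ) :
    val (q * codeLen σ + (1 + ρ * rowSize σ)) = true ↔ ∃ ρ' < ρ, rowError σ val ρ' = true := by
  induction ρ with
  | zero => simp [val_zero hval]
  | succ ρ ih =>
    have hsize : 2 + ρ * rowSize σ + rowSize σ ≤ checkSize q σ := by
      have : (ρ + 1) * rowSize σ ≤ q * codeRows σ * rowSize σ := Nat.mul_le_mul_right _ hρ
      rw [add_mul, one_mul] at this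
      rw [checkSize]
      omega
    have hsize' : rowSize σ = 4 * σ + 1 := rfl
    have h := hval (2 + ρ * rowSize σ + 4 * σ) (by omega)
    have hrow := val_row hval (ρ := ρ) (by omega) le_rfl
    rw [if_neg (by omega)] at hrow
    rw [checkGate_last, Gate.value, show q * codeLen σ + (2 + ρ * rowSize σ + 4 * σ) - 1 =
      q * codeLen σ + (1 + ρ * rowSize σ + 4 * σ) by omega, hrow] at h
    rw [show 1 + (ρ + 1) * rowSize σ = 2 + ρ * rowSize σ + 4 * σ by
      rw [add_mul, one_mul]; omega, h, Bool.or_eq_true, ih (by omega)]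
    constructor
    · rintro (⟨ρ', h1, h2⟩ | h)
      · exact ⟨ρ', by omega, h2⟩
      · exact ⟨ρ, by omega, h⟩
    · rintro ⟨ρ', h1, h2⟩
      rcases (show ρ' < ρ ∨ ρ' = ρ by omega) with h3 | rfl
      · exact .inl ⟨ρ', h3, h2⟩
      · exact .inr h2

end

/-- The block number `k` of `z` is a codeword. -/
def IsCodeBlock (σ : ℕ) (z : ℕ → Bool) (k : ℕ) : Prop :=
  ∀ i < codeRows σ, z (k * codeLen σ + σ + i) =
    parityBit σ (fun j => z (k * codeLen σ + j)) i

/-- The output is the conjunction of the copy of `D`, fed with the message part of each block, with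
the negated error flag. -/
theorem eval_robustCircuit {q σ N : ℕ} (hq : 1 ≤ q) (hσ : 1 ≤ σ) (hN : N = q * codeLen σ)
    (D : Circuit (q * σ)) (z : ℕ → Bool) :
    (robustCircuit hq hσ hN D).eval (fun i => z i) = true ↔
      (∀ k < q, IsCodeBlock σ z k) ∧
        D.eval (fun i => z (i / σ * codeLen σ + i % σ)) = true := by
  have hqσ : 1 ≤ q * σ := Nat.mul_pos hq hσ
  have hsize : (robustCircuit hq hσ hN D).size =
      q * codeLen σ + (checkSize q σ + D.gates.length + 2) := by
    have h : (robustCircuit hq hσ hN D).size = N + (robustGates D).length := rfl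
    rw [h, length_robustGates, hN]
  obtain ⟨val, hin, hgate, heval⟩ := (robustCircuit hq hσ hN D).exists_val z (by omega)
  obtain ⟨val₀, hin₀, hgate₀, heval₀⟩ :=
    D.exists_val (fun i => z (i / σ * codeLen σ + i % σ)) (by rw [Circuit.size]; omega)
  rw [heval₀, heval, hsize]
  subst hN
  change ∀ (i : ℕ) (h : i < (robustGates D).length),
    val (q * codeLen σ + i) = ((robustGates D)[i]).value val at hgate
  have hlen := length_robustGates D
  have hcheck : ∀ x < checkSize q σ, val (q * codeLen σ + x) = (checkGate q σ x).value val :=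
    fun x hx => by rw [hgate x (by omega), robustGates_check D hx]
  have hnot := hgate (checkSize q σ + D.gates.length) (by omega)
  have hand := hgate (checkSize q σ + D.gates.length + 1) (by omega)
  rw [robustGates_not, Gate.value] at hnot
  rw [robustGates_and, Gate.value] at hand
  -- Renumbering preserves the gate equations, and these determine all values by induction along the
  -- topological order.
  have hren : ∀ v, v < D.size → val (renumber q σ v) = val₀ v := by
    intro v
    induction v using Nat.strong_induction_on with
    | _ v ih =>
      intro hv
      rcases lt_or_ge v (q * σ) with h | h
      · rw [hin₀ v h, renumber, if_pos h]
        exact hin _ (block_lt ((Nat.div_lt_iff_lt_mul hσ).2 h)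
          ((Nat.mod_lt _ hσ).trans_le (Nat.le_add_right _ _)))
      · obtain ⟨i, rfl⟩ := Nat.exists_eq_add_of_le h
        have hi : i < D.gates.length := by rw [Circuit.size] at hv; omega
        have h1 := hgate (checkSize q σ + i) (by omega)
        rw [robustGates_gate D hi] at h1
        rw [hgate₀ i hi, renumber, if_neg (by omega), Nat.add_sub_cancel_left, add_comm i,
          add_assoc, h1]
        have hb := D.acyclic i hi
        revert hb
        rcases D.gates[i] with ⟨a, b⟩ | ⟨a, b⟩ | a
        · rintro ⟨ha, hb⟩
          simp only [Gate.map, Gate.value]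
          rw [ih a ha (by omega), ih b hb (by omega)]
        · rintro ⟨ha, hb⟩
          simp only [Gate.map, Gate.value]
          rw [ih a ha (by omega), ih b hb (by omega)]
        · intro (ha : a < q * σ + i)
          simp only [Gate.map, Gate.value]
          rw [ih a ha (by omega)]
  rw [show q * codeLen σ + (checkSize q σ + D.gates.length + 2) - 1 =
    q * codeLen σ + (checkSize q σ + D.gates.length + 1) by omega, hand,
    hren _ (by rw [Circuit.size]; omega), add_assoc (q * codeLen σ), hnot, Bool.and_eq_true,
    and_comm]
  refine and_congr ?_ Iff.rfl
  rw [checkSize, show q * codeLen σ + (2 + q * codeRows σ * rowSize σ) - 1 =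
    q * codeLen σ + (1 + q * codeRows σ * rowSize σ) by omega, Bool.not_eq_true',
    ← Bool.not_eq_true, val_check hσ hcheck le_rfl]
  have herr : ∀ {k i}, k < q → i < codeRows σ → (rowError σ val (k * codeRows σ + i) = false ↔
      z (k * codeLen σ + σ + i) = parityBit σ (fun j => z (k * codeLen σ + j)) i) := by
    intro k i hk hi
    have h1 : (k * codeRows σ + i) / codeRows σ = k := by
      rw [mul_comm, Nat.mul_add_div (by omega), Nat.div_eq_of_lt hi, Nat.add_zero]
    have h2 : (k * codeRows σ + i) % codeRows σ = i := by
      rw [mul_comm, Nat.mul_add_mod, Nat.mod_eq_of_lt hi]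
    rw [rowError, h1, h2, add_assoc, hin _ (block_lt hk (by rw [codeLen]; omega)),
      parityBit_congr (z' := fun j => z (k * codeLen σ + j)) fun j hj =>
        hin _ (block_lt hk (by rw [codeLen]; omega))]
    generalize parityBit σ (fun j => z (k * codeLen σ + j)) i = B
    cases z (k * codeLen σ + (σ + i)) <;> cases B <;> decide
  constructor
  · intro h k hk i hi
    refine (herr hk hi).1 (Bool.eq_false_iff.2 fun h' => h ⟨_, block_lt hk hi, h'⟩)
  · rintro h ⟨ρ, hρ, hbad⟩
    have hc : 0 < codeRows σ := Nat.pos_of_ne_zero fun h => by rw [h] at hρ; omega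
    have := (herr ((Nat.div_lt_iff_lt_mul hc).2 hρ) (Nat.mod_lt ρ hc)).2
      (h _ ((Nat.div_lt_iff_lt_mul hc).2 hρ) _ (Nat.mod_lt ρ hc))
    rw [mul_comm, Nat.div_add_mod, hbad] at this
    exact absurd this (by decide)

/-! ## Simulation of programs -/

/-- What a simulation does instead of reading the input and writing the output. -/
structure Handler where
  read : (v j i : ℕ) → Cmd
  len : (v j : ℕ) → Cmd
  out : (w v : ℕ) → Cmd

/-- The simulation of a program on the variables and arrays with numbers `3 * v + o`. -/
def Cmd.sim (o : ℕ) (h : Handler) : Cmd → Cmd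
  | skip => skip
  | const v c => const (3 * v + o) c
  | arith op v a b => arith op (3 * v + o) (3 * a + o) (3 * b + o)
  | load v A i => load (3 * v + o) (3 * A + o) (3 * i + o)
  | store A i v => store (3 * A + o) (3 * i + o) (3 * v + o)
  | read v j i => h.read (3 * v + o) j (3 * i + o)
  | len v j => h.len (3 * v + o) j
  | out w v => h.out w (3 * v + o)
  | seq p p' => seq (p.sim o h) (p'.sim o h)
  | cond v p p' => cond (3 * v + o) (p.sim o h) (p'.sim o h)
  | loop v p => loop (3 * v + o) (p.sim o h)

/-- The state `s'` holds the variables and arrays of `s` at the numbers `3 * v + o`. -/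
def SimRel (o : ℕ) (s s' : State) : Prop :=
  (∀ v, s'.var (3 * v + o) = s.var v) ∧ ∀ A, s'.arr (3 * A + o) = s.arr A

/-- The two states agree apart from the variables and arrays with numbers `3 * v + o`. -/
structure AgreeOff (o : ℕ) (s s' : State) : Prop where
  var : ∀ v, v % 3 ≠ o → s'.var v = s.var v
  arr : ∀ A, A % 3 ≠ o → s'.arr A = s.arr A
  out : s'.out = s.out

/-- The two states have the same variables and arrays with numbers `3 * v + o`, except that the
variable number `3 * v + o` is set to `a`. -/
def SetsTo (o : ℕ) (v a : ℕ) (s s' : State) : Prop :=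
  (∀ u, s'.var (3 * u + o) = if u = v then a else s.var (3 * u + o)) ∧
    ∀ A, s'.arr (3 * A + o) = s.arr (3 * A + o)

/-- The handler simulates access to the inputs `inp` in at most `M` steps. The invariant `I` links
the simulated outputs to the state. -/
structure Handler.Correct (h : Handler) (o : ℕ) (inp inp' : List (List ℕ)) (M : ℕ)
    (I : (ℕ → List ℕ) → State → Prop) : Prop where
  pos : 1 ≤ M
  lt : o < 3
  stable : ∀ {outs s s'}, AgreeOff o s s' → I outs s → I outs s'
  read : ∀ v j i outs s, I outs s → ∃ T ≤ M, ∃ s',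
    Exec inp' (h.read (3 * v + o) j (3 * i + o)) s T s' ∧
      SetsTo o v ((inp.getD j []).getD (s.var (3 * i + o)) 0) s s' ∧ I outs s'
  len : ∀ v j outs s, I outs s → ∃ T ≤ M, ∃ s', Exec inp' (h.len (3 * v + o) j) s T s' ∧
    SetsTo o v (inp.getD j []).length s s' ∧ I outs s'
  out : ∀ w v outs s, I outs s → ∃ T ≤ M, ∃ s', Exec inp' (h.out w (3 * v + o)) s T s' ∧
    (∀ u, s'.var (3 * u + o) = s.var (3 * u + o)) ∧
    (∀ A, s'.arr (3 * A + o) = s.arr (3 * A + o)) ∧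
    I (Function.update outs w (outs w ++ [s.var (3 * v + o)])) s'

theorem agreeOff_setVar {o : ℕ} (ho : o < 3) (s : State) (v a : ℕ) :
    AgreeOff o s (s.setVar (3 * v + o) a) :=
  ⟨fun _ hw => State.setVar_ne _ _ (by omega), fun _ _ => rfl, rfl⟩

theorem setsTo_setVar (o : ℕ) (s : State) (v a : ℕ) :
    SetsTo o v a s (s.setVar (3 * v + o) a) := by
  refine ⟨fun u => ?_, fun _ => rfl⟩
  split
  · rename_i h; rw [h, State.setVar_same]
  · exact State.setVar_ne _ _ (by omega)

theorem SetsTo.simRel {o v a : ℕ} {s t t' : State} (h : SetsTo o v a t t') (hs : SimRel o s t) :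
    SimRel o (s.setVar v a) t' := by
  refine ⟨fun u => ?_, fun A => (h.2 A).trans (hs.2 A)⟩
  rw [h.1, hs.1]
  split
  · rename_i h; rw [h, State.setVar_same]
  · rename_i h; exact (State.setVar_ne _ _ h).symm

/-- Residue classes modulo 3 keep memories apart: class 0 belongs to the surrounding program, class
1 to a simulated verifier or probe, class 2 to a simulated agent. Every step of the original costs
at most `M` steps, the price of one input or output access. -/
theorem exec_sim {h : Handler} {o : ℕ} {inp inp' : List (List ℕ)} {M : ℕ}
    {I : (ℕ → List ℕ) → State → Prop} (hc : h.Correct o inp inp' M I) {p : Cmd} {s s₂ : State}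
    {T : ℕ} (hp : Exec inp p s T s₂) : ∀ t, SimRel o s t → I s.out t →
      ∃ T' ≤ M * T, ∃ t₂, Exec inp' (p.sim o h) t T' t₂ ∧ SimRel o s₂ t₂ ∧ I s₂.out t₂ := by
  have hM := hc.pos
  have ho := hc.lt
  have set : ∀ {s t : State} (v a : ℕ), SimRel o s t → I s.out t →
      SimRel o (s.setVar v a) (t.setVar (3 * v + o) a) ∧
        I (s.setVar v a).out (t.setVar (3 * v + o) a) := fun v a hs hI =>
    ⟨(setsTo_setVar o _ v a).simRel hs, hc.stable (agreeOff_setVar ho _ v a) hI⟩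
  induction hp with
  | skip s => exact fun t hs hI => ⟨1, by omega, t, .skip t, hs, hI⟩
  | const v c s => exact fun t hs hI => ⟨1, by omega, _, .const _ _ _, set v c hs hI⟩
  | arith op v a b s =>
    intro t hs hI
    refine ⟨1, by omega, _, .arith _ _ _ _ _, ?_⟩
    rw [hs.1, hs.1]
    exact set v _ hs hI
  | load v A i s =>
    intro t hs hI
    refine ⟨1, by omega, _, .load _ _ _ _, ?_⟩
    rw [hs.1, hs.2]
    exact set v _ hs hI
  | store A i v s =>
    intro t hs hI
    refine ⟨1, by omega, _, .store _ _ _ _, ⟨hs.1, fun B => ?_⟩, hc.stable (s := t)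
      ⟨fun _ _ => rfl, fun B hB => ?_, rfl⟩ hI⟩
    · simp only
      rw [hs.1, hs.1, hs.2]
      by_cases hB : B = A
      · rw [hB, Function.update_self, Function.update_self]
      · rw [Function.update_of_ne (by omega), Function.update_of_ne hB, hs.2]
    · exact Function.update_of_ne (show B ≠ 3 * A + o by omega) _ _
  | read v j i s =>
    intro t hs hI
    obtain ⟨T, hT, t', ht, hset, hI'⟩ := hc.read v j i _ t hI
    rw [hs.1] at hset
    exact ⟨T, by omega, t', ht, hset.simRel hs, hI'⟩
  | len v j s =>
    intro t hs hI
    obtain ⟨T, hT, t', ht, hset, hI'⟩ := hc.len v j _ t hI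
    exact ⟨T, by omega, t', ht, hset.simRel hs, hI'⟩
  | out w v s =>
    intro t hs hI
    obtain ⟨T, hT, t', ht, hvar, harr, hI'⟩ := hc.out w v _ t hI
    rw [hs.1] at hI'
    exact ⟨T, by omega, t', ht, ⟨fun u => (hvar u).trans (hs.1 u),
      fun A => (harr A).trans (hs.2 A)⟩, hI'⟩
  | seq _ _ ih ih' =>
    intro t hs hI
    obtain ⟨T, hT, t', ht, hs', hI'⟩ := ih t hs hI
    obtain ⟨T', hT', t'', ht', hs'', hI''⟩ := ih' t' hs' hI'
    exact ⟨T + T', by rw [mul_add]; omega, t'', .seq ht ht', hs'', hI''⟩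
  | condTrue hv _ ih =>
    intro t hs hI
    obtain ⟨T, hT, t', ht, hs', hI'⟩ := ih t hs hI
    exact ⟨T + 1, by rw [mul_add]; omega, t', .condTrue (by rwa [hs.1]) ht, hs', hI'⟩
  | condFalse hv _ ih =>
    intro t hs hI
    obtain ⟨T, hT, t', ht, hs', hI'⟩ := ih t hs hI
    exact ⟨T + 1, by rw [mul_add]; omega, t', .condFalse (by rwa [hs.1]) ht, hs', hI'⟩
  | loopStop hv =>
    exact fun t hs hI => ⟨1, by omega, t, .loopStop (by rwa [hs.1]), hs, hI⟩
  | loopStep hv _ _ ih ih' =>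
    intro t hs hI
    obtain ⟨T, hT, t', ht, hs', hI'⟩ := ih t hs hI
    obtain ⟨T', hT', t'', ht', hs'', hI''⟩ := ih' t' hs' hI'
    exact ⟨T + T' + 1, by rw [mul_add, mul_add]; omega, t'',
      .loopStep (by rwa [hs.1]) ht ht', hs'', hI''⟩

/-- A step writes at most one number. This bounds the number of queries and the length of the
circuit description by `t`, which no hypothesis states directly. -/
theorem length_out_le {inp : List (List ℕ)} {p : Cmd} {s s' : State} {T : ℕ}
    (hp : Exec inp p s T s') (w : ℕ) : (s'.out w).length ≤ (s.out w).length + T := by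
  induction hp with
  | out w' v s =>
    by_cases h : w = w'
    · subst h; simp
    · simp [Function.update_of_ne h]
  | skip | const | arith | load | store | read | len => simp [State.setVar]
  | seq _ _ ih ih' => omega
  | condTrue _ _ ih => omega
  | condFalse _ _ ih => omega
  | loopStop => omega
  | loopStep _ _ _ ih ih' => omega

theorem exec_pos {inp : List (List ℕ)} {p : Cmd} {s s' : State} {T : ℕ}
    (hp : Exec inp p s T s') : 1 ≤ T := by
  induction hp <;> omega

section

open Arith

/-! ## Programs that write lists -/

/-- The environment that consists of the first `l` slots. -/
def State.slots (s : State) (l : ℕ) : List ℕ := s.env (List.range l)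

theorem State.slots_succ (s : State) (l : ℕ) :
    s.slots (l + 1) = s.slots l ++ [s.var (3 * l)] := by
  simp [slots, env, List.range_succ]

theorem State.Frame.slots {l l' : ℕ} {s₁ s₂ : State} (h : State.Frame l' s₁ s₂) (hl : l ≤ l') :
    s₂.slots l = s₁.slots l :=
  h.env fun v hv => by
    have := List.mem_range.1 hv
    omega

/-- Compute the expressions one after the other, each of them from the previous ones. -/
def lets : List Arith → ℕ → Cmd
  | [], _ => .skip
  | e :: es, l => .seq (e.comp (List.range l) l) (lets es (l + 1))

/-- The environment after `lets`. -/
def letsEnv (M : ℕ → ℕ → ℕ) : List Arith → List ℕ → List ℕ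
  | [], env => env
  | e :: es, env => letsEnv M es (env ++ [e.eval M env])

def letsCost (M : ℕ → ℕ → ℕ) : List Arith → List ℕ → ℕ
  | [], _ => 1
  | e :: es, env => e.cost M env + letsCost M es (env ++ [e.eval M env])

theorem exec_lets (inp : List (List ℕ)) (es : List Arith) : ∀ (l : ℕ) (s : State),
    ∃ T ≤ letsCost s.arr es (s.slots l), ∃ s', Exec inp (lets es l) s T s' ∧
      s'.slots (l + es.length) = letsEnv s.arr es (s.slots l) ∧ s.Frame l s' := by
  induction es with
  | nil => exact fun l s => ⟨1, le_rfl, s, .skip s, rfl, State.Frame.refl l s⟩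
  | cons e es ih =>
    intro l s
    obtain ⟨T, hT, s', h, hr, hf⟩ := exec_comp inp e (List.range l) l s fun v => List.mem_range.1
    obtain ⟨T', hT', s'', h', hr', hf'⟩ := ih (l + 1) s'
    have hslots : s'.slots (l + 1) = s.slots l ++ [e.eval s.arr (s.slots l)] := by
      rw [State.slots_succ, hf.slots le_rfl, hr]; rfl
    rw [hslots, hf.arr] at hT' hr'
    refine ⟨T + T', Nat.add_le_add hT hT', s'', .seq h h', ?_, hf.trans (hf'.mono (Nat.le_succ l))⟩
    rw [letsEnv, ← hr', List.length_cons]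
    congr 1
    omega

/-- `s'` differs from `s` in the variables `3 * v` with `l ≤ v`, and by the list `L` that is
appended to the output stream `w`. -/
structure State.Emits (l w : ℕ) (L : List ℕ) (s s' : State) : Prop where
  var : ∀ v, (v % 3 ≠ 0 ∨ v < 3 * l) → s'.var v = s.var v
  arr : s'.arr = s.arr
  out : s'.out = Function.update s.out w (s.out w ++ L)

theorem State.Frame.emits {l : ℕ} (w : ℕ) {s s' : State} (h : s.Frame l s') :
    s.Emits l w [] s' :=
  ⟨h.var, h.arr, by rw [h.out, List.append_nil, Function.update_eq_self]⟩

theorem State.Emits.trans {l w : ℕ} {L L' : List ℕ} {s₁ s₂ s₃ : State} (h : s₁.Emits l w L s₂)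
    (h' : s₂.Emits l w L' s₃) : s₁.Emits l w (L ++ L') s₃ :=
  ⟨fun v hv => (h'.var v hv).trans (h.var v hv), h'.arr.trans h.arr, by
    rw [h'.out, h.out, Function.update_self, Function.update_idem, List.append_assoc]⟩

theorem State.Emits.mono {l l' w : ℕ} {L : List ℕ} {s₁ s₂ : State} (h : s₁.Emits l' w L s₂)
    (hl : l ≤ l') : s₁.Emits l w L s₂ :=
  ⟨fun v hv => h.var v (by omega), h.arr, h.out⟩

theorem State.Emits.slot {l w v : ℕ} {L : List ℕ} {s₁ s₂ : State} (h : s₁.Emits l w L s₂)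
    (hl : v < l) : s₂.var (3 * v) = s₁.var (3 * v) := h.var _ (by omega)

theorem State.Emits.env {l w : ℕ} {L : List ℕ} {s₁ s₂ : State} (h : s₁.Emits l w L s₂)
    {vars : List ℕ} (hv : ∀ v ∈ vars, v < l) : s₂.env vars = s₁.env vars :=
  List.map_congr_left fun v hv' => h.slot (hv v hv')

theorem State.Emits.slots {l w : ℕ} {L : List ℕ} {s₁ s₂ : State} (h : s₁.Emits l w L s₂) :
    s₂.slots l = s₁.slots l := h.env fun _ => List.mem_range.1

/-- Write the values of the expressions to the stream `w`. -/
def writeAll (w : ℕ) (vars : List ℕ) (l : ℕ) : List Arith → Cmd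
  | [] => .skip
  | e :: es => .seq (e.comp vars l) (.seq (.out w (3 * l)) (writeAll w vars l es))

theorem exec_writeAll (inp : List (List ℕ)) (w : ℕ) (vars : List ℕ) (l : ℕ)
    (hv : ∀ v ∈ vars, v < l) (K : ℕ) (es : List Arith) : ∀ s : State,
    (∀ e ∈ es, e.cost s.arr (s.env vars) ≤ K) →
    ∃ T ≤ es.length * (K + 1) + 1, ∃ s', Exec inp (writeAll w vars l es) s T s' ∧
      s.Emits l w (es.map fun e => e.eval s.arr (s.env vars)) s' := by
  induction es with
  | nil => exact fun s _ => ⟨1, by simp, s, .skip s, (State.Frame.refl l s).emits w⟩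
  | cons e es ih =>
    intro s hK
    obtain ⟨T, hT, s', h, hr, hf⟩ := exec_comp inp e vars l s hv
    obtain ⟨t, ht, hem⟩ : ∃ t, Exec inp (.out w (3 * l)) s' 1 t ∧
        s.Emits l w [e.eval s.arr (s.env vars)] t :=
      ⟨{ s' with out := Function.update s'.out w (s'.out w ++ [s'.var (3 * l)]) }, .out _ _ _,
        hf.var, hf.arr, by rw [← hf.out, ← hr]⟩
    obtain ⟨T', hT', s'', h', hem'⟩ := ih t (by
      rw [hem.env hv, hem.arr]
      exact fun e he => hK e (List.mem_cons_of_mem _ he))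
    rw [hem.env hv, hem.arr] at hem'
    refine ⟨T + (1 + T'), ?_, s'', .seq h (.seq ht h'), hem.trans hem'⟩
    have := hK e List.mem_cons_self
    rw [List.length_cons, add_mul]
    omega

/-- For all `x` below the value of `n`, write the values of the expressions at `x` to the stream
`w`. -/
def emit (w : ℕ) (n : Arith) (es : List Arith) (l : ℕ) : Cmd :=
  .seq (n.comp (List.range l) l) <| .seq (.const (3 * (l + 1)) 0) <| .seq (.const (3 * (l + 2)) 1) <|
    .loop (3 * l) <| .seq (writeAll w ((l + 1) :: List.range l) (l + 3) es) <|
      .seq (.arith .sub (3 * l) (3 * l) (3 * (l + 2))) <|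
      .arith .add (3 * (l + 1)) (3 * (l + 1)) (3 * (l + 2))

def emitted (M : ℕ → ℕ → ℕ) (n : ℕ) (es : List Arith) (env : List ℕ) : List ℕ :=
  (List.range n).flatMap fun x => es.map fun e => e.eval M (x :: env)

theorem State.Emits.setVar {l w v a : ℕ} {L : List ℕ} {s₁ s₂ : State} (h : s₁.Emits l w L s₂)
    (hl : l ≤ v) : s₁.Emits l w L (s₂.setVar (3 * v) a) :=
  ⟨fun u hu => by
    rw [← h.var u hu]
    exact Function.update_of_ne (by omega) _ _, h.arr, h.out⟩

theorem exec_emit (inp : List (List ℕ)) (w : ℕ) (n : Arith) (es : List Arith) (l K : ℕ) (s : State)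
    (hK : ∀ e ∈ es, ∀ x, e.cost s.arr (x :: s.slots l) ≤ K) :
    ∃ T ≤ n.cost s.arr (s.slots l) + 3 +
        n.eval s.arr (s.slots l) * (es.length * (K + 1) + 4),
      ∃ s', Exec inp (emit w n es l) s T s' ∧
        s.Emits l w (emitted s.arr (n.eval s.arr (s.slots l)) es (s.slots l)) s' := by
  obtain ⟨T₁, hT₁, s₁, h₁, hr₁, hf₁⟩ := exec_comp inp n (List.range l) l s fun v => List.mem_range.1
  change T₁ ≤ n.cost s.arr (s.slots l) at hT₁
  change s₁.var (3 * l) = n.eval s.arr (s.slots l) at hr₁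
  set k := n.eval s.arr (s.slots l)
  let I : ℕ → State → Prop := fun j s' => s.Emits l w (emitted s.arr j es (s.slots l)) s' ∧
    s'.var (3 * l) = k - j ∧ s'.var (3 * (l + 1)) = j ∧ s'.var (3 * (l + 2)) = 1
  obtain ⟨T₂, hT₂, s₂, h₂, hs₂⟩ := exec_loop (inp := inp) (v := 3 * l)
    (p := .seq (writeAll w ((l + 1) :: List.range l) (l + 3) es) <|
      .seq (.arith .sub (3 * l) (3 * l) (3 * (l + 2))) <|
      .arith .add (3 * (l + 1)) (3 * (l + 1)) (3 * (l + 2))) I k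
    (fun _ => es.length * (K + 1) + 3) (fun j s' _ h => h.2.1)
    (by
      rintro j s' hj ⟨hem, hc, hi, ho⟩
      have henv : s'.env ((l + 1) :: List.range l) = j :: s.slots l := by
        rw [← hem.slots]
        simp [State.env, State.slots, hi]
      obtain ⟨T, hT, t, ht, hemt⟩ := exec_writeAll inp w ((l + 1) :: List.range l) (l + 3)
        (by
          simp only [List.mem_cons, List.mem_range]
          rintro v (rfl | h) <;> omega) K es s' (by
          rw [henv, hem.arr]; exact fun e he => hK e he j)
      rw [henv, hem.arr] at hemt
      refine ⟨T + (1 + 1), by omega, _, .seq ht (.seq (.arith _ _ _ _ _) (.arith _ _ _ _ _)),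
        ?_, ?_, ?_, ?_⟩
      · have h := ((hem.trans (hemt.mono (by omega))).setVar
          (a := Op.eval .sub (t.var (3 * l)) (t.var (3 * (l + 2)))) le_rfl).setVar (v := l + 1)
          (a := Op.eval .add ((t.setVar (3 * l) (Op.eval .sub (t.var (3 * l))
            (t.var (3 * (l + 2))))).var (3 * (l + 1))) ((t.setVar (3 * l) (Op.eval .sub
            (t.var (3 * l)) (t.var (3 * (l + 2))))).var (3 * (l + 2)))) (by omega)
        rw [emitted, List.range_succ, List.flatMap_append]
        simpa [emitted] using h
      · rw [State.setVar_ne _ _ (by omega), State.setVar_same, hemt.slot (by omega),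
          hemt.slot (by omega), hc, ho]
        simp only [Op.eval]; omega
      · rw [State.setVar_same, State.setVar_ne _ _ (by omega), State.setVar_ne _ _ (by omega),
          hemt.slot (by omega), hemt.slot (by omega), hi, ho]
        rfl
      · rw [State.setVar_ne _ _ (by omega), State.setVar_ne _ _ (by omega), hemt.slot (by omega),
          ho])
    (s := (s₁.setVar (3 * (l + 1)) 0).setVar (3 * (l + 2)) 1)
    ⟨((hf₁.setVar (by omega)).setVar (by omega)).emits w, by
      rw [State.setVar_ne _ _ (by omega), State.setVar_ne _ _ (by omega), hr₁]; rfl, by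
      rw [State.setVar_ne _ _ (by omega), State.setVar_same], by
      rw [State.setVar_same]⟩
  refine ⟨T₁ + (1 + (1 + T₂)), ?_, s₂, .seq h₁ (.seq (.const _ _ _) (.seq (.const _ _ _) h₂)),
    hs₂.1⟩
  rw [Finset.sum_const, Finset.card_range, smul_eq_mul] at hT₂
  simp only [Nat.add_assoc, Nat.reduceAdd] at hT₂ ⊢
  omega

/-- A sequence of `emit`s. -/
def emitAll (l : ℕ) : List (ℕ × Arith × List Arith) → Cmd
  | [] => .skip
  | b :: bs => .seq (emit b.1 b.2.1 b.2.2 l) (emitAll l bs)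

/-- What a sequence of `emit`s writes to the stream `w`. -/
def emittedAll (M : ℕ → ℕ → ℕ) (env : List ℕ) (w : ℕ) (bs : List (ℕ × Arith × List Arith)) :
    List ℕ :=
  bs.flatMap fun b => if b.1 = w then emitted M (b.2.1.eval M env) b.2.2 env else []

theorem exec_emitAll (inp : List (List ℕ)) (l K X : ℕ) (bs : List (ℕ × Arith × List Arith)) :
    ∀ s : State, (∀ b ∈ bs, b.2.1.cost s.arr (s.slots l) ≤ K ∧ b.2.1.eval s.arr (s.slots l) ≤ X ∧
      b.2.2.length ≤ 6 ∧ ∀ e ∈ b.2.2, ∀ x, e.cost s.arr (x :: s.slots l) ≤ K) →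
    ∃ T ≤ bs.length * (K + 3 + X * (6 * (K + 1) + 4)) + 1, ∃ s',
      Exec inp (emitAll l bs) s T s' ∧ ∀ w, s'.out w = s.out w ++
        emittedAll s.arr (s.slots l) w bs := by
  induction bs with
  | nil => exact fun s _ => ⟨1, by simp, s, .skip s, fun w => by simp [emittedAll]⟩
  | cons b bs ih =>
    intro s hK
    obtain ⟨h1, h2, h3, h4⟩ := hK b List.mem_cons_self
    obtain ⟨T, hT, s', h, hem⟩ := exec_emit inp b.1 b.2.1 b.2.2 l K s h4
    obtain ⟨T', hT', s'', h', ho⟩ := ih s' (by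
      rw [hem.slots, hem.arr]
      exact fun b hb => hK b (List.mem_cons_of_mem _ hb))
    refine ⟨T + T', ?_, s'', .seq h h', fun w => ?_⟩
    · rw [List.length_cons, add_mul, one_mul]
      have : b.2.1.eval s.arr (s.slots l) * (b.2.2.length * (K + 1) + 4) ≤
          X * (6 * (K + 1) + 4) :=
        Nat.mul_le_mul h2 (Nat.add_le_add_right (Nat.mul_le_mul_right _ h3) 4)
      omega
    · have hcons : emittedAll s.arr (s.slots l) w (b :: bs) = (if b.1 = w then
          emitted s.arr (b.2.1.eval s.arr (s.slots l)) b.2.2 (s.slots l) else []) ++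
          emittedAll s.arr (s.slots l) w bs := List.flatMap_cons
      rw [ho w, hem.out, hem.slots, hem.arr, hcons, ← List.append_assoc]
      congr 1
      by_cases hw : b.1 = w
      · rw [← hw, Function.update_self, if_pos rfl]
      · rw [Function.update_of_ne (Ne.symm hw), if_neg hw, List.append_nil]

/-! ## The program of the robust verifier -/

theorem exists_pow_cost {S : List Bool} (es : List Arith) (h : ∀ e ∈ es, Tame S e) :
    ∃ k, ∀ e ∈ es, ∀ M B env, 2 ≤ B → EnvLE S B env → e.cost M env ≤ B ^ k := by
  induction es with
  | nil => exact ⟨0, by simp⟩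
  | cons e es ih =>
    obtain ⟨k, hk⟩ := ih fun e he => h e (List.mem_cons_of_mem _ he)
    obtain ⟨k', hk'⟩ := h e List.mem_cons_self
    refine ⟨k + k', fun e' he M B env hB henv => ?_⟩
    rcases List.mem_cons.1 he with rfl | he
    · exact le_pow_of_le_pow hB (hk' M B env hB henv) (by omega)
    · exact le_pow_of_le_pow hB (hk e' he M B env hB henv) (by omega)

theorem EnvLE.of_append {S : List Bool} {B : ℕ} {env env' : List ℕ} (h : EnvLE S B (env ++ env')) :
    EnvLE S B env := by
  intro i hi
  rcases lt_or_ge i env.length with h' | h'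
  · rw [← List.getD_append _ env' _ _ h']; exact h i hi
  · rw [List.getD_eq_default _ _ h']; exact Nat.zero_le _

theorem letsEnv_eq_append (M : ℕ → ℕ → ℕ) (es : List Arith) : ∀ env,
    ∃ env', letsEnv M es env = env ++ env' := by
  induction es with
  | nil => exact fun env => ⟨[], by simp [letsEnv]⟩
  | cons e es ih =>
    intro env
    obtain ⟨env', h⟩ := ih (env ++ [e.eval M env])
    exact ⟨e.eval M env :: env', by rw [letsEnv, h]; simp⟩

/-- It suffices to bound the final environment, because all earlier ones are its prefixes. -/
theorem letsCost_le {S : List Bool} {M : ℕ → ℕ → ℕ} {B k : ℕ} (es : List Arith)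
    (hk : ∀ e ∈ es, ∀ env, EnvLE S B env → e.cost M env ≤ B ^ k) : ∀ env,
    EnvLE S B (letsEnv M es env) → letsCost M es env ≤ es.length * B ^ k + 1 := by
  induction es with
  | nil => intros; simp [letsCost]
  | cons e es ih =>
    intro env h
    have h1 := ih (fun e he => hk e (List.mem_cons_of_mem _ he)) _ h
    obtain ⟨env', h2⟩ := letsEnv_eq_append M (e :: es) env
    rw [h2] at h
    have h3 := hk e List.mem_cons_self env h.of_append
    rw [letsCost, List.length_cons, add_mul]
    omega

theorem EnvLE.nil {B : ℕ} {env : List ℕ} : EnvLE [] B env := fun i hi => by simp at hi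

/-- `if a = b then c else d` -/
def ifEqA (a b c d : Arith) : Arith := .ite (eqA a b) c d

theorem eval_ifEqA (M a b c d env) : (ifEqA a b c d).eval M env =
    if a.eval M env = b.eval M env then c.eval M env else d.eval M env := by
  by_cases h : a.eval M env = b.eval M env <;> simp [ifEqA, eval, eval_eqA, h]

theorem Tame.ifEq {S : List Bool} {a b c d : Arith} (ha : Tame S a) (hb : Tame S b)
    (hc : Tame S c) (hd : Tame S d) : Tame S (ifEqA a b c d) :=
  Tame.ite (tame_eqA ha hb) hc hd

/-- The product `a * b`, in a number of steps that is bounded in terms of `a`. -/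
def prodA (a b : Arith) : Arith := .call mulA a b (.const 0)

theorem eval_prodA (M a b env) : (prodA a b).eval M env = a.eval M env * b.eval M env := by
  simp [prodA, eval, eval_mulA]

theorem Tame.prod {S : List Bool} {a b : Arith} (h : Small S a) (ha : Tame S a) (hb : Tame S b) :
    Tame S (prodA a b) :=
  Tame.call true false false tame_mulA ha hb (Tame.const _) (fun _ => h) (by simp) (by simp)

attribute [irreducible] ifEqA prodA

/-- The parameters, computed from the number `q` of queries, the length of the description of the
circuit, and the description: `σ`, the number of parity checks, the length of the code, the number
of inputs of the new circuit, `rowSize σ`, `checkSize q σ`, the number of gates, and `q * σ`. -/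
def paramExprs : List Arith :=
  [.op .div (.load 3 (.const 0)) (.var 0),
   .call rowsA (.var 2) (.const 0) (.const 0),
   .op .add (.var 2) (.var 3),
   prodA (.var 4) (.var 0),
   .op .add (fourA (.var 2)) (.const 1),
   .op .add (.const 2) (prodA (.var 6) (prodA (.var 3) (.var 0))),
   .op .div (.op .sub (.var 1) (.const 1)) (.const 3),
   prodA (.var 2) (.var 0)]

/-- Exactly `σ`, the number of parity checks, the code length and the row size are polynomial in
`σ`; everything that involves `q` or the circuit stays unmarked. -/
def paramMarks : List Bool := [false, false, true, true, true, false, true, false, false, false]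

def paramEnv (q L σ : ℕ) : List ℕ :=
  [q, L, σ, codeRows σ, codeLen σ, q * codeLen σ, rowSize σ, checkSize q σ, (L - 1) / 3, q * σ]

/-- The description of the circuit begins with its number of inputs `q * σ`, so `σ` need not be
computable on its own. -/
theorem letsEnv_paramExprs {M : ℕ → ℕ → ℕ} {q L σ : ℕ} (hq : 1 ≤ q) (hM : M 3 0 = q * σ) :
    letsEnv M paramExprs [q, L] = paramEnv q L σ := by
  simp [letsEnv, paramExprs, eval, Op.eval, hM, eval_prodA, eval_rowsA, eval_fourA, paramEnv,
    Nat.mul_div_cancel_left σ hq, codeLen, rowSize, checkSize, mul_comm]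

theorem tame_paramExprs : ∀ e ∈ paramExprs, Tame paramMarks e := by
  have v := Tame.var (S := paramMarks)
  have c := Tame.const (S := paramMarks)
  have s2 : Small paramMarks (.var 2) := Small.var rfl
  simp only [paramExprs, List.forall_mem_cons, List.not_mem_nil, false_imp_iff, implies_true,
    and_true]
  refine ⟨Tame.op _ (Tame.load _ (c _)) (v _), Tame.call_all tame_rowsA s2 (Small.const _)
    (Small.const _) (v _) (c _) (c _), Tame.op _ (v _) (v _), Tame.prod (Small.var rfl) (v _) (v _),
    Tame.op _ (v _).four (c _), Tame.op _ (c _) (Tame.prod (Small.var rfl) (v _)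
    (Tame.prod (Small.var rfl) (v _) (v _))), Tame.op _ (Tame.op _ (v _) (c _)) (c _),
    Tame.prod s2 (v _) (v _)⟩

theorem envLE_paramEnv {q L σ : ℕ} (hσ : 1 ≤ σ) : EnvLE paramMarks (40 * σ) (paramEnv q L σ) := by
  have h := codeLen_le hσ
  have h' : codeRows σ ≤ codeLen σ := Nat.le_add_left _ _
  have h'' : rowSize σ = 4 * σ + 1 := rfl
  refine .cons (.cons (.cons (.cons (.cons (.cons (.cons (.cons (.cons (.cons .nil le_rfl ?_) le_rfl
    ?_) le_rfl ?_) le_rfl ?_) le_rfl ?_) le_rfl ?_) le_rfl ?_) le_rfl ?_) le_rfl ?_) le_rfl ?_ <;>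
    intro hb <;> first | omega | exact absurd hb (by decide)

/-- The environment in the loops: the loop variable, then the parameters. -/
def loopMarks : List Bool := false :: paramMarks

/-- The number of the row that the checking gate belongs to. -/
def rowNoA : Arith := .op .div (.op .sub (.var 0) (.const 2)) (.var 7)

/-- The position of the checking gate in its row. -/
def rowPosA : Arith := .op .mod (.op .sub (.var 0) (.const 2)) (.var 7)

/-- The number of the loop variable as a vertex. -/
def vertexA : Arith := .op .add (.var 6) (.var 0)

def kindA : Arith :=
  ifEqA (.var 0) (.const 0) (.const 2) <| ifEqA (.var 0) (.const 1) (.const 0) <|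
  ifEqA rowPosA (fourA (.var 3)) (.const 1) <|
  ifEqA (.op .mod rowPosA (.const 4)) (.const 0) (.const 1) <|
  ifEqA (.op .mod rowPosA (.const 4)) (.const 2) (.const 2) (.const 0)

def fstA : Arith :=
  ifEqA (.var 0) (.const 0) (.const 0) <| ifEqA (.var 0) (.const 1) (.const 0) <|
  ifEqA rowPosA (fourA (.var 3)) (.op .sub (.op .sub vertexA rowPosA) (.const 1)) <|
  ifEqA (.op .mod rowPosA (.const 4)) (.const 2) (.op .sub vertexA (.const 1)) <|
  ifEqA (.op .mod rowPosA (.const 4)) (.const 3) (.op .sub vertexA (.const 3)) <|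
  ifEqA (.op .div rowPosA (.const 4)) (.const 0)
    (.op .add (.op .add (prodA (.var 5) (.op .div rowNoA (.var 4))) (.var 3))
      (.op .mod rowNoA (.var 4))) <|
  .op .sub (.op .sub vertexA (.op .mod rowPosA (.const 4))) (.const 1)

def sndA : Arith :=
  ifEqA (.var 0) (.const 0) (.const 0) <| ifEqA (.var 0) (.const 1) (.var 6) <|
  ifEqA rowPosA (fourA (.var 3)) (.op .sub vertexA (.const 1)) <|
  ifEqA (.op .mod rowPosA (.const 4)) (.const 2) (.op .sub vertexA (.const 1)) <|
  ifEqA (.op .mod rowPosA (.const 4)) (.const 3) (.op .sub vertexA (.const 1)) <|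
  ifEqA (.call genA (.var 3) (Arith.min (.op .mod rowNoA (.var 4)) (.var 4))
    (Arith.min (.op .div rowPosA (.const 4)) (.var 7))) (.const 0)
    (.op .add (.var 6) (.const 1)) <|
  .op .add (prodA (.var 5) (.op .div rowNoA (.var 4))) (.op .div rowPosA (.const 4))

def renumberA (v : Arith) : Arith :=
  .ite (ltA v (.var 10)) (.op .add (prodA (.var 5) (.op .div v (.var 3))) (.op .mod v (.var 3)))
    (.op .add (.op .sub v (.var 10)) (.op .add (.var 6) (.var 8)))

def bufferA (k : ℕ) : Arith :=
  .load 3 (.op .add (.const k) (.op .add (.op .add (.var 0) (.var 0)) (.var 0)))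

def queryA : Arith :=
  .op .add (prodA (.var 5) (.load 0 (.op .div (.var 0) (.var 5)))) (.op .mod (.var 0) (.var 5))

/-- The last vertex before the gates of the original circuit. -/
def errorA : Arith := .op .sub (.op .add (.var 6) (.var 8)) (.const 1)

/-- What the program writes: the queries, the number of inputs of the circuit, and the gates. -/
def emissions : List (ℕ × Arith × List Arith) :=
  [(0, .var 5, [queryA]),
   (1, .const 1, [.var 6]),
   (1, .var 7, [kindA, fstA, sndA]),
   (1, .var 8, [bufferA 1, renumberA (bufferA 2), renumberA (bufferA 3)]),
   (1, .const 1, [.const 2, errorA, errorA, .const 0,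
      renumberA (.op .sub (.op .add (.var 10) (.var 9)) (.const 1)),
      .op .add (.op .add (.var 6) (.var 8)) (.var 9)])]

theorem tame_emissions : ∀ e ∈ emissions.flatMap fun b => b.2.2, Tame loopMarks e := by
  have v := Tame.var (S := loopMarks)
  have c := Tame.const (S := loopMarks)
  have s5 : Small loopMarks (.var 5) := Small.var rfl
  have rn : Tame loopMarks rowNoA := Tame.op _ (Tame.op _ (v _) (c _)) (v _)
  have rp : Tame loopMarks rowPosA := Tame.op _ (Tame.op _ (v _) (c _)) (v _)
  have vx : Tame loopMarks vertexA := Tame.op _ (v _) (v _)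
  have ren : ∀ {e}, Tame loopMarks e → Tame loopMarks (renumberA e) := fun h =>
    Tame.ite (tame_ltA h (v _)) (Tame.op _ (Tame.prod s5 (v _) (Tame.op _ h (v _)))
      (Tame.op _ h (v _))) (Tame.op _ (Tame.op _ h (v _)) (Tame.op _ (v _) (v _)))
  have buf : ∀ k, Tame loopMarks (bufferA k) := fun k =>
    Tame.load _ (Tame.op _ (c _) (Tame.op _ (Tame.op _ (v _) (v _)) (v _)))
  have err : Tame loopMarks errorA := Tame.op _ (Tame.op _ (v _) (v _)) (c _)
  simp only [emissions, List.flatMap_cons, List.flatMap_nil, List.cons_append, List.nil_append,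
    List.forall_mem_cons, List.not_mem_nil, false_imp_iff, implies_true, and_true]
  refine ⟨Tame.op _ (Tame.prod s5 (v _) (Tame.load _ (Tame.op _ (v _) (v _))))
    (Tame.op _ (v _) (v _)), v _, ?_, ?_, ?_, buf _, ren (buf _), ren (buf _), c _, err, err, c _,
    ren (Tame.op _ (Tame.op _ (v _) (v _)) (c _)), Tame.op _ (Tame.op _ (v _) (v _)) (v _)⟩
  · exact .ifEq (v _) (c _) (c _) <| .ifEq (v _) (c _) (c _) <| .ifEq rp (v _).four (c _) <|
      .ifEq (.op _ rp (c _)) (c _) (c _) <| .ifEq (.op _ rp (c _)) (c _) (c _) (c _)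
  · exact .ifEq (v _) (c _) (c _) <| .ifEq (v _) (c _) (c _) <|
      .ifEq rp (v _).four (.op _ (.op _ vx rp) (c _)) <|
      .ifEq (.op _ rp (c _)) (c _) (.op _ vx (c _)) <|
      .ifEq (.op _ rp (c _)) (c _) (.op _ vx (c _)) <|
      .ifEq (.op _ rp (c _)) (c _) (.op _ (.op _ (.prod s5 (v _) (.op _ rn (v _))) (v _))
        (.op _ rn (v _))) <| .op _ (.op _ vx (.op _ rp (c _))) (c _)
  · exact .ifEq (v _) (c _) (c _) <| .ifEq (v _) (c _) (v _) <|
      .ifEq rp (v _).four (.op _ vx (c _)) <|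
      .ifEq (.op _ rp (c _)) (c _) (.op _ vx (c _)) <|
      .ifEq (.op _ rp (c _)) (c _) (.op _ vx (c _)) <|
      .ifEq (.call_all tame_genA (Small.var rfl) (Small.min _ (Small.var rfl))
        (Small.min _ (Small.var rfl)) (v _) (.min (.op _ rn (v _)) (v _))
        (.min (.op _ rp (c _)) (v _))) (c _) (.op _ (v _) (c _)) <|
      .op _ (.prod s5 (v _) (.op _ rn (v _))) (.op _ rp (c _))

section

variable {M : ℕ → ℕ → ℕ} {q L σ : ℕ}

theorem eval_kindA (x : ℕ) : kindA.eval M (x :: paramEnv q L σ) = checkKind σ x := by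
  simp [kindA, eval_ifEqA, eval, Op.eval, rowPosA, eval_fourA, paramEnv, checkKind]

theorem eval_fstA (x : ℕ) : fstA.eval M (x :: paramEnv q L σ) = checkFst q σ x := by
  simp [fstA, eval_ifEqA, eval, Op.eval, rowPosA, rowNoA, vertexA, eval_fourA, eval_prodA, paramEnv,
    checkFst, mul_comm (codeLen σ)]

theorem codeRows_pos (hσ : 1 ≤ σ) : 0 < codeRows σ := by
  have := two_le_codeExp hσ
  rw [codeRows, codeSize_eq hσ]
  positivity

/-- The two minima in the arguments of `genA` have no effect; they only make these arguments visibly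
small. -/
theorem eval_sndA (hσ : 1 ≤ σ) (x : ℕ) :
    sndA.eval M (x :: paramEnv q L σ) = checkSnd q σ x := by
  have h1 : ∀ y, Nat.min (y % codeRows σ) (codeRows σ) = y % codeRows σ := fun y =>
    Nat.min_eq_left (Nat.mod_lt _ (codeRows_pos hσ)).le
  have h2 : ∀ y, Nat.min (y % rowSize σ / 4) (rowSize σ) = y % rowSize σ / 4 := fun y =>
    Nat.min_eq_left ((Nat.div_le_self _ _).trans (Nat.mod_lt _ (Nat.succ_pos _)).le)
  simp [sndA, eval_ifEqA, eval, Op.eval, rowPosA, rowNoA, vertexA, eval_fourA, eval_prodA, paramEnv,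
    checkSnd, mul_comm (codeLen σ), eval_genA, Arith.eval_min, h1, h2]

theorem eval_renumberA (v : Arith) (x : ℕ) : (renumberA v).eval M (x :: paramEnv q L σ) =
    renumber q σ (v.eval M (x :: paramEnv q L σ)) := by
  by_cases h : v.eval M (x :: paramEnv q L σ) < q * σ
  · rw [renumber, if_pos h]
    simp only [paramEnv] at h ⊢
    simp [renumberA, eval, Op.eval, eval_ltA, eval_prodA, h, mul_comm (codeLen σ)]
  · rw [renumber, if_neg h]
    simp only [paramEnv] at h ⊢
    simp [renumberA, eval, Op.eval, eval_ltA, h]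

theorem eval_bufferA (k x : ℕ) :
    (bufferA k).eval M (x :: paramEnv q L σ) = M 3 (k + 3 * x) := by
  simp [bufferA, eval, Op.eval, show x + x + x = 3 * x by ring]

theorem eval_queryA (x : ℕ) : queryA.eval M (x :: paramEnv q L σ) =
    M 0 (x / codeLen σ) * codeLen σ + x % codeLen σ := by
  simp [queryA, eval, Op.eval, eval_prodA, paramEnv, mul_comm (codeLen σ)]

theorem eval_errorA (x : ℕ) : errorA.eval M (x :: paramEnv q L σ) =
    q * codeLen σ + checkSize q σ - 1 := by
  simp [errorA, eval, Op.eval, paramEnv]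

end

/-- Each gate takes three entries, and the leading number of inputs shifts positions by one. -/
theorem getD_code_add {N : ℕ} (gs : List Gate) : ∀ (i k : ℕ) (hi : i < gs.length), k < 3 →
    (N :: gs.flatMap Gate.code).getD (k + 1 + 3 * i) 0 = (gs[i]).code.getD k 0 := by
  have hlen : ∀ g : Gate, g.code.length = 3 := by rintro (_ | _ | _) <;> rfl
  induction gs with
  | nil => exact fun i k hi => absurd hi (by simp)
  | cons g gs ih =>
    rintro (_ | i) k hi hk
    · rw [show k + 1 + 3 * 0 = k + 1 by omega, List.getD_cons_succ, List.flatMap_cons,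
        List.getD_append _ _ _ _ (by rw [hlen]; omega)]
      rfl
    · have := ih i k (by simpa using hi) hk
      rw [show k + 1 + 3 * i = k + 3 * i + 1 by omega, List.getD_cons_succ] at this
      rw [show k + 1 + 3 * (i + 1) = k + 3 * i + 3 + 1 by omega, List.getD_cons_succ,
        List.flatMap_cons, List.getD_append_right _ _ _ _ (by rw [hlen]; omega), hlen,
        Nat.add_sub_cancel, this]
      rfl

theorem length_flatMap_code (gs : List Gate) : (gs.flatMap Gate.code).length = 3 * gs.length := by
  induction gs with
  | nil => rfl
  | cons g gs ih =>
    rw [List.flatMap_cons, List.length_append, ih, List.length_cons]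
    rcases g with _ | _ | _ <;> simp [Gate.code] <;> omega

theorem code_map_gate (f : ℕ → ℕ) (g : Gate) :
    (g.map f).code = [g.code.getD 0 0, f (g.code.getD 1 0), f (g.code.getD 2 0)] := by
  rcases g with _ | _ | _ <;> rfl

theorem flatMap_range_eq {α : Type} (f : Gate → List α) (gs : List Gate) (h : ℕ → List α)
    (hf : ∀ (i : ℕ) (hi : i < gs.length), h i = f gs[i]) :
    (List.range gs.length).flatMap h = gs.flatMap f := by
  rw [List.flatMap_def, List.flatMap_def]
  congr 1
  refine List.ext_getElem (by simp) fun i h1 h2 => ?_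
  simp only [List.getElem_map, List.getElem_range]
  exact hf i (by simpa using h2)

theorem emittedAll_queries {M : ℕ → ℕ → ℕ} {q L σ : ℕ} :
    emittedAll M (paramEnv q L σ) 0 emissions =
      (List.range (q * codeLen σ)).map fun x =>
        M 0 (x / codeLen σ) * codeLen σ + x % codeLen σ := by
  have h : (Arith.var 5).eval M (paramEnv q L σ) = q * codeLen σ := rfl
  simp only [emittedAll, emissions, List.flatMap_cons, List.flatMap_nil, if_true, one_ne_zero,
    if_false, List.append_nil, emitted, h, List.map_cons, List.map_nil, eval_queryA]
  exact (List.map_eq_flatMap).symm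

theorem emittedAll_circuit {M : ℕ → ℕ → ℕ} {q σ N : ℕ} (hq : 1 ≤ q) (hσ : 1 ≤ σ)
    (hN : N = q * codeLen σ) (D : Circuit (q * σ)) (hM : ∀ i, M 3 i = D.code.getD i 0) :
    emittedAll M (paramEnv q D.code.length σ) 1 emissions = (robustCircuit hq hσ hN D).code := by
  have hlen : (D.code.length - 1) / 3 = D.gates.length := by
    rw [Circuit.code, List.length_cons, length_flatMap_code]; omega
  have h5 : ∀ x, (Arith.var 6).eval M (x :: paramEnv q D.code.length σ) = q * codeLen σ :=
    fun _ => rfl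
  have h7 : (Arith.var 7).eval M (paramEnv q D.code.length σ) = checkSize q σ := rfl
  have h8 : (Arith.var 8).eval M (paramEnv q D.code.length σ) = D.gates.length := hlen
  have h9 : ∀ x, (Arith.op .sub (.op .add (.var 10) (.var 9)) (.const 1)).eval M
      (x :: paramEnv q D.code.length σ) = D.size - 1 := fun _ => by
    rw [Circuit.size, ← hlen]; rfl
  have h10 : ∀ x, (Arith.op .add (.op .add (.var 6) (.var 8)) (.var 9)).eval M
      (x :: paramEnv q D.code.length σ) = q * codeLen σ + checkSize q σ + D.gates.length :=
    fun _ => by rw [← hlen]; rfl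
  have hc : ∀ k, ∀ env, (Arith.const k).eval M env = k := fun _ _ => rfl
  have hgates : (List.range D.gates.length).flatMap (fun x => [M 3 (1 + 3 * x),
      renumber q σ (M 3 (2 + 3 * x)), renumber q σ (M 3 (3 + 3 * x))]) =
      D.gates.flatMap fun g => (g.map (renumber q σ)).code := by
    refine flatMap_range_eq _ _ _ fun i hi => ?_
    rw [code_map_gate, hM, hM, hM, Circuit.code, getD_code_add D.gates i 0 hi (by norm_num),
      getD_code_add D.gates i 1 hi (by norm_num), getD_code_add D.gates i 2 hi (by norm_num)]
  have hr : List.range 1 = [0] := rfl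
  simp only [emittedAll, emissions, List.flatMap_cons, List.flatMap_nil, if_true, zero_ne_one,
    if_false, List.append_nil, emitted, h5, h7, h8, h9, h10, hc, List.map_cons, List.map_nil,
    eval_kindA, eval_fstA, eval_sndA hσ, eval_renumberA, eval_bufferA, eval_errorA, hgates, hr,
    List.nil_append, List.cons_append]
  have hnot : ∀ a, (Gate.not a).code = [2, a, a] := fun _ => rfl
  have hand : ∀ a b, (Gate.and a b).code = [0, a, b] := fun _ _ => rfl
  rw [Circuit.code]
  simp only [robustCircuit, robustGates, List.flatMap_append, List.flatMap_map, code_checkGate,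
    List.flatMap_cons, List.flatMap_nil, hnot, hand, List.cons_append, List.nil_append, hN]

/-! ### The complete program of the new verifier -/

/-- Keep the first two output streams in the arrays `0` and `3`, and their lengths in the first two
slots. -/
def bufferHandler : Handler where
  read v j i := .read v j i
  len v j := .len v j
  out w v :=
    if w = 0 then .seq (.store 0 0 v) (.seq (.const 6 1) (.arith .add 0 0 6))
    else if w = 1 then .seq (.store 3 3 v) (.seq (.const 6 1) (.arith .add 3 3 6))
    else .skip

structure Buffered (outs : ℕ → List ℕ) (s : State) : Prop where
  len₀ : s.var 0 = (outs 0).length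
  len₁ : s.var 3 = (outs 1).length
  arr₀ : ∀ i, s.arr 0 i = (outs 0).getD i 0
  arr₁ : ∀ i, s.arr 3 i = (outs 1).getD i 0
  out : s.out = fun _ => []

theorem getD_append_singleton (l : List ℕ) (x i : ℕ) :
    (l ++ [x]).getD i 0 = Function.update (fun i => l.getD i 0) l.length x i := by
  rcases lt_trichotomy i l.length with h | rfl | h
  · rw [List.getD_append _ _ _ _ h, Function.update_of_ne h.ne]
  · rw [Function.update_self, List.getD_append_right _ _ _ _ le_rfl, Nat.sub_self]; rfl
  · rw [Function.update_of_ne h.ne', List.getD_eq_default _ _ (by simp; omega),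
      List.getD_eq_default _ _ h.le]

theorem correct_bufferHandler (inp : List (List ℕ)) :
    bufferHandler.Correct 1 inp inp 3 Buffered where
  pos := by norm_num
  lt := by norm_num
  stable h hI :=
    ⟨(h.var 0 (by norm_num)).trans hI.len₀, (h.var 3 (by norm_num)).trans hI.len₁,
      fun i => (congrFun (h.arr 0 (by norm_num)) i).trans (hI.arr₀ i),
      fun i => (congrFun (h.arr 3 (by norm_num)) i).trans (hI.arr₁ i), h.out.trans hI.out⟩
  read v j i outs s hI := by
    refine ⟨1, by norm_num, _, .read _ _ _ _, setsTo_setVar 1 s v _, ?_⟩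
    exact ⟨(State.setVar_ne _ _ (by omega)).trans hI.len₀,
      (State.setVar_ne _ _ (by omega)).trans hI.len₁, hI.arr₀, hI.arr₁, hI.out⟩
  len v j outs s hI := by
    refine ⟨1, by norm_num, _, .len _ _ _, setsTo_setVar 1 s v _, ?_⟩
    exact ⟨(State.setVar_ne _ _ (by omega)).trans hI.len₀,
      (State.setVar_ne _ _ (by omega)).trans hI.len₁, hI.arr₀, hI.arr₁, hI.out⟩
  out w v outs s hI := by
    have h0 := hI.len₀
    have h1 := hI.len₁
    by_cases hw0 : w = 0
    · subst hw0
      refine ⟨1 + (1 + 1), le_rfl, _, .seq (.store _ _ _ _) (.seq (.const _ _ _)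
        (.arith _ _ _ _ _)), fun u => ?_, fun A => ?_, ?_, ?_, ?_, ?_, hI.out⟩
      · rw [State.setVar_ne _ _ (by omega), State.setVar_ne _ _ (by omega)]
      · simp only [State.setVar]
        rw [Function.update_of_ne (by omega)]
      · rw [State.setVar_same, State.setVar_ne _ _ (by norm_num), State.setVar_same]
        simp [Op.eval, h0]
      · rw [State.setVar_ne _ _ (by norm_num), State.setVar_ne _ _ (by norm_num)]
        simpa using h1
      · intro i
        simp only [State.setVar, Function.update_self]
        rw [getD_append_singleton, h0]
        congr 1
        exact funext hI.arr₀
      · intro i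
        simp only [State.setVar]
        rw [Function.update_of_ne (by norm_num), Function.update_of_ne (by norm_num)]
        exact hI.arr₁ i
    by_cases hw1 : w = 1
    · subst hw1
      refine ⟨1 + (1 + 1), le_rfl, _, .seq (.store _ _ _ _) (.seq (.const _ _ _)
        (.arith _ _ _ _ _)), fun u => ?_, fun A => ?_, ?_, ?_, ?_, ?_, hI.out⟩
      · rw [State.setVar_ne _ _ (by omega), State.setVar_ne _ _ (by omega)]
      · simp only [State.setVar]
        rw [Function.update_of_ne (by omega)]
      · rw [State.setVar_ne _ _ (by norm_num), State.setVar_ne _ _ (by norm_num)]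
        simpa using h0
      · rw [State.setVar_same, State.setVar_ne _ _ (by norm_num), State.setVar_same]
        simp [Op.eval, h1]
      · intro i
        simp only [State.setVar]
        rw [Function.update_of_ne (by norm_num), Function.update_of_ne (by norm_num)]
        exact hI.arr₀ i
      · intro i
        simp only [State.setVar, Function.update_self]
        rw [getD_append_singleton, h1]
        congr 1
        exact funext hI.arr₁
    · refine ⟨1, by norm_num, s, ?_, fun _ => rfl, fun _ => rfl, ?_, ?_, ?_, ?_, hI.out⟩
      · simp only [bufferHandler, if_neg hw0, if_neg hw1]
        exact .skip s
      · rw [Function.update_of_ne (Ne.symm hw0)]; exact h0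
      · rw [Function.update_of_ne (Ne.symm hw1)]; exact h1
      · rw [Function.update_of_ne (Ne.symm hw0)]; exact hI.arr₀
      · rw [Function.update_of_ne (Ne.symm hw1)]; exact hI.arr₁

/-- Run the verifier, and then write the queries and the circuit of the robust verifier. -/
def robustProg (p : Cmd) : Cmd :=
  .seq (p.sim 1 bufferHandler) (.seq (lets paramExprs 2) (emitAll 10 emissions))

/-- The exponent `K` suffices for the running time of the robust verifier. -/
def ProgBound (K : ℕ) : Prop :=
  ∀ (p : Cmd) (inp : List (List ℕ)) {q σ N : ℕ} (hq : 1 ≤ q) (hσ : 1 ≤ σ)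
    (hN : N = q * codeLen σ) (D : Circuit (q * σ)) (Q : List ℕ) (t : ℕ),
    Q.length = q → HaltsWithin p inp t (fun out => out 0 = Q ∧ out 1 = D.code) →
    HaltsWithin (robustProg p) inp ((40 * σ) ^ K * t) fun out =>
      out 0 = (List.range (q * codeLen σ)).map (fun x =>
        Q.getD (x / codeLen σ) 0 * codeLen σ + x % codeLen σ) ∧
      out 1 = (robustCircuit hq hσ hN D).code

/-- The old verifier runs with its output buffered, three steps for one. Then the parameters are
computed once, and each list is written with polynomial cost in `σ` per entry. The list lengths are
at most `(40 * σ) ^ 3 * t`. -/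
theorem exists_progBound : ∃ K, ProgBound K := by
  obtain ⟨k₁, hk₁⟩ := exists_pow_cost _ tame_paramExprs
  obtain ⟨k₂, hk₂⟩ := exists_pow_cost _ tame_emissions
  refine ⟨k₁ + k₂ + 12, fun p inp q σ N hq hσ hN D Q t hQ ⟨T, hT, s, hs, hs0, hs1⟩ => ?_⟩
  set B := 40 * σ with hB
  have hB2 : 2 ≤ B := by omega
  obtain ⟨T₁, hT₁, s₁, h₁, -, hbuf⟩ := exec_sim (correct_bufferHandler inp) hs State.start
    ⟨fun _ => rfl, fun _ => rfl⟩ ⟨rfl, rfl, fun _ => rfl, fun _ => rfl, rfl⟩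
  have hlen0 := length_out_le hs 0
  have hlen1 := length_out_le hs 1
  have hl0 := hbuf.len₀
  have hl1 := hbuf.len₁
  rw [hs0, hQ] at hlen0 hl0
  rw [hs1] at hlen1 hl1
  simp only [State.start, List.length_nil, Nat.zero_add] at hlen0 hlen1
  have hslots : s₁.slots 2 = [q, D.code.length] := by
    change [s₁.var 0, s₁.var 3] = _
    rw [hl0, hl1]
  have hM3 : ∀ i, s₁.arr 3 i = D.code.getD i 0 := fun i => by rw [hbuf.arr₁, hs1]
  have henv := letsEnv_paramExprs (M := s₁.arr) (L := D.code.length) (σ := σ) hq (hM3 0)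
  obtain ⟨T₂, hT₂, s₂, h₂, hr₂, hf₂⟩ := exec_lets inp paramExprs 2 s₁
  rw [hslots, henv] at hr₂
  rw [hslots] at hT₂
  have hT₂' := hT₂.trans (letsCost_le (S := paramMarks) (B := B) (k := k₁) paramExprs
    (fun e he env h => hk₁ e he _ _ _ hB2 h) _ (by rw [henv]; exact envLE_paramEnv hσ))
  change s₂.slots 10 = _ at hr₂
  have hlenB := codeLen_le hσ
  have hrows : codeRows σ ≤ B := (Nat.le_add_left _ _).trans (hlenB.trans (by omega))
  -- The `q` queries were written one per step, hence `q ≤ t`.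
  have hX0 : q * codeLen σ ≤ B ^ 3 * t := by
    calc q * codeLen σ ≤ t * B := Nat.mul_le_mul (by omega) (by omega)
      _ ≤ B ^ 3 * t := by rw [mul_comm]; exact Nat.mul_le_mul_right _ (Nat.le_self_pow (by omega) B)
  have ht1 : 1 ≤ t := by omega
  have hX1 : checkSize q σ ≤ B ^ 3 * t := by
    have h1 : q * codeRows σ * rowSize σ ≤ t * B * (5 * σ) :=
      Nat.mul_le_mul (Nat.mul_le_mul (by omega) hrows) (by rw [rowSize]; omega)
    have h2 : 2 ≤ t * B * (35 * σ) := by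
      have : 1 ≤ t * B := Nat.mul_pos ht1 (by omega)
      calc 2 ≤ 1 * (35 * σ) := by omega
        _ ≤ _ := Nat.mul_le_mul_right _ this
    calc checkSize q σ ≤ t * B * (35 * σ) + t * B * (5 * σ) := Nat.add_le_add h2 h1
      _ = B ^ 2 * t := by rw [hB]; ring
      _ ≤ B ^ 3 * t := Nat.mul_le_mul_right _ (Nat.pow_le_pow_right (by omega) (by norm_num))
  have hX2 : 1 ≤ B ^ 3 * t := Nat.mul_pos (by positivity) ht1
  have hX3 : (D.code.length - 1) / 3 ≤ B ^ 3 * t := by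
    calc (D.code.length - 1) / 3 ≤ 1 * t := by omega
      _ ≤ _ := Nat.mul_le_mul_right _ (Nat.one_le_pow _ _ (by omega))
  obtain ⟨T₃, hT₃, s₃, h₃, hr₃⟩ := exec_emitAll inp 10 (B ^ (k₂ + 1)) (B ^ 3 * t) emissions s₂ (by
    rw [hr₂]
    have hcost : ∀ b ∈ emissions, ∀ e ∈ b.2.2, ∀ x,
        e.cost s₂.arr (x :: paramEnv q D.code.length σ) ≤ B ^ (k₂ + 1) := by
      intro b hb e he x
      refine le_pow_of_le_pow hB2 (hk₂ e (List.mem_flatMap.2 ⟨b, hb, he⟩) _ _ _ hB2 ?_)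
        (Nat.le_succ _)
      exact (envLE_paramEnv hσ).cons le_rfl (by simp)
    have h2 : 2 ≤ B ^ (k₂ + 1) := hB2.trans (Nat.le_self_pow (by omega) B)
    have h1 : 1 ≤ B ^ (k₂ + 1) := by omega
    intro b hb
    refine ⟨?_, ?_, ?_, hcost b hb⟩ <;> revert b <;>
      simp only [emissions, List.forall_mem_cons, List.not_mem_nil, false_imp_iff, implies_true,
        and_true]
    · exact ⟨h2, h1, h2, h2, h1⟩
    · exact ⟨hX0, hX2, hX1, hX3, hX2⟩
    · simp)
  refine ⟨T₁ + (T₂ + T₃), ?_, s₃, .seq h₁ (.seq h₂ h₃), ?_, ?_⟩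
  · have e1 : paramExprs.length = 8 := rfl
    have e2 : emissions.length = 5 := rfl
    rw [e1] at hT₂'
    rw [e2] at hT₃
    set K := k₁ + k₂ with hK
    have hB40 : 40 ≤ B := by omega
    have p1 : B ^ k₁ ≤ B ^ K := Nat.pow_le_pow_right (by omega) (by omega)
    have p2 : B ^ (k₂ + 1) ≤ B ^ (K + 1) := Nat.pow_le_pow_right (by omega) (by omega)
    have p3 : 1 ≤ B ^ K := Nat.one_le_pow _ _ (by omega)
    have p4 : B ^ (K + 1) = B ^ K * B := pow_succ _ _
    have p5 : 40 * B ^ K ≤ B ^ (K + 1) := by rw [p4, mul_comm]; exact Nat.mul_le_mul_left _ hB40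
    have p6 : 6 * (B ^ (k₂ + 1) + 1) + 4 ≤ B ^ (K + 2) := by
      have : 40 * B ^ (K + 1) ≤ B ^ (K + 2) := by
        rw [pow_succ B (K + 1), mul_comm]; exact Nat.mul_le_mul_left _ hB40
      omega
    have p7 : B ^ 3 * t * (6 * (B ^ (k₂ + 1) + 1) + 4) ≤ B ^ (K + 5) * t := by
      calc _ ≤ B ^ 3 * t * B ^ (K + 2) := Nat.mul_le_mul_left _ p6
        _ = _ := by ring
    have p8 : B ^ (K + 1) ≤ B ^ (K + 5) * t := by
      calc B ^ (K + 1) ≤ B ^ (K + 5) := Nat.pow_le_pow_right (by omega) (by omega)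
        _ ≤ _ := Nat.le_mul_of_pos_right _ ht1
    have p9 : 40 * (B ^ (K + 5) * t) ≤ B ^ (K + 12) * t := by
      rw [← mul_assoc]
      refine Nat.mul_le_mul_right _ ?_
      calc 40 * B ^ (K + 5) ≤ B * B ^ (K + 5) := Nat.mul_le_mul_right _ hB40
        _ = B ^ (K + 6) := by ring
        _ ≤ _ := Nat.pow_le_pow_right (by omega) (by omega)
    have p10 : t ≤ B ^ (K + 5) * t := Nat.le_mul_of_pos_left _ (by positivity)
    omega
  · rw [hr₃ 0, hf₂.out, hbuf.out, List.nil_append, hr₂, hf₂.arr, emittedAll_queries]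
    refine List.map_congr_left fun x _ => ?_
    rw [hbuf.arr₀, hs0]
  · rw [hr₃ 1, hf₂.out, hbuf.out, List.nil_append, hr₂, hf₂.arr,
      emittedAll_circuit hq hσ hN D hM3]

end

/-! ## The encoding of messages -/

/-- A message as a function on the naturals. -/
def extend {σ : ℕ} (u : Fin σ → Bool) (j : ℕ) : Bool := if h : j < σ then u ⟨j, h⟩ else false

/-- The bits of the codeword of a message. -/
def encBit {σ : ℕ} (u : Fin σ → Bool) (j : ℕ) : Bool :=
  if j < σ then extend u j else parityBit σ (extend u) (j - σ)

theorem extend_of_lt {σ : ℕ} (u : Fin σ → Bool) {j : ℕ} (h : j < σ) : extend u j = u ⟨j, h⟩ :=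
  dif_pos h

/-- By linearity the difference of two codewords encodes the nonzero difference of the messages, and
its parity part alone has enough weight. -/
theorem codeLen_le_mul_card_encBit {σ : ℕ} {u v : Fin σ → Bool} (huv : u ≠ v) : codeLen σ ≤
    144 * ((Finset.range (codeLen σ)).filter fun j => encBit u j ≠ encBit v j).card := by
  obtain ⟨k, hk⟩ := Function.ne_iff.1 huv
  have hσ : 1 ≤ σ := by have := k.2; omega
  have h := codeLen_le_mul_card_parityBit hσ (fun j => extend u j ^^ extend v j) k.2 (by
    rw [extend_of_lt u k.2, extend_of_lt v k.2]
    simpa using hk)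
  refine h.trans (Nat.mul_le_mul_left _ (Finset.card_le_card_of_injOn (fun i => σ + i) ?_ ?_))
  · intro i hi
    simp only [Finset.coe_filter, Finset.mem_range, Set.mem_ofPred_eq] at hi ⊢
    refine ⟨Nat.add_lt_add_left hi.1 σ, ?_⟩
    rw [parityBit_xor] at hi
    rw [encBit, encBit, if_neg (by omega), if_neg (by omega), Nat.add_sub_cancel_left]
    simpa using hi.2
  · intro i _ j _ h
    exact Nat.add_left_cancel h

/-- The distance of a codeword from a word. -/
def encDist {σ : ℕ} (u : Fin σ → Bool) (y : ℕ → Bool) : ℕ :=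
  ((Finset.range (codeLen σ)).filter fun j => encBit u j ≠ y j).card

/-- Take `u` with codeword nearest to `y`. For `v ≠ u`, the triangle inequality bounds the distance
of the two codewords by `encDist v y + encDist u y ≤ 2 * encDist v y`, which turns 144 into 288. -/
theorem exists_decode {σ : ℕ} (y : ℕ → Bool) : ∃ u : Fin σ → Bool,
    ∀ v, v ≠ u → codeLen σ ≤ 288 * encDist v y := by
  obtain ⟨u, hu⟩ := Finite.exists_min fun u : Fin σ → Bool => encDist u y
  refine ⟨u, fun v hv => ?_⟩
  have h1 := codeLen_le_mul_card_encBit hv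
  have h2 : ((Finset.range (codeLen σ)).filter fun j => encBit v j ≠ encBit u j).card ≤
      encDist v y + encDist u y := by
    refine (Finset.card_le_card fun j hj => ?_).trans (Finset.card_union_le _ _)
    simp only [Finset.mem_union, Finset.mem_filter] at hj ⊢
    by_cases h : encBit v j = y j
    · exact .inr ⟨hj.1, fun h' => hj.2 (h.trans h'.symm)⟩
    · exact .inl ⟨hj.1, h⟩
  have := hu v
  omega

/-! ## The robust verifier -/

section

variable {q σ N : ℕ}

/-- The values of a block word as a function on the naturals. -/
def flat (a : Fin N → Fin (1 : ℕ+) → Bool) (i : ℕ) : Bool := if h : i < N then a ⟨i, h⟩ 0 else false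

theorem accepts_robustCircuit (hq : 1 ≤ q) (hσ : 1 ≤ σ) (hN : N * (1 : ℕ+) = q * codeLen σ)
    (D : Circuit (q * σ)) (a : Fin N → Fin (1 : ℕ+) → Bool) :
    (robustCircuit hq hσ hN D).Accepts a ↔ (∀ k < q, IsCodeBlock σ (flat a) k) ∧
      D.Accepts fun k j => flat a (k * codeLen σ + j) := by
  rw [Circuit.Accepts, Circuit.Accepts]
  have h : (fun i : Fin (N * (1 : ℕ+)) => a (finProdFinEquiv.symm i).1 (finProdFinEquiv.symm i).2) =
      fun i : Fin (N * (1 : ℕ+)) => flat a i := by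
    funext i
    have hi : (i : ℕ) < N := by simpa using i.2
    rw [flat, dif_pos hi]
    congr 1
    · exact Fin.ext (Nat.div_one _)
    · exact Subsingleton.elim (α := Fin 1) _ _
  rw [h, eval_robustCircuit]
  exact Iff.rfl

theorem flat_block {a : Fin N → Fin (1 : ℕ+) → Bool} {k : ℕ} (h : IsCodeBlock σ (flat a) k) {j : ℕ}
    (hj : j < codeLen σ) : flat a (k * codeLen σ + j) =
      encBit (fun j : Fin σ => flat a (k * codeLen σ + j)) j := by
  rw [encBit]
  split
  · rename_i h'
    rw [extend_of_lt _ h']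
  · rename_i h'
    obtain ⟨i, rfl⟩ := Nat.exists_eq_add_of_le (not_lt.1 h')
    rw [Nat.add_sub_cancel_left, ← add_assoc, h i (by rw [codeLen] at hj; omega)]
    exact parityBit_congr (fun j hj =>
      (extend_of_lt (fun j : Fin σ => flat a (k * codeLen σ + j)) hj).symm) i

end

/-- The length of the code as a positive integer. -/
def codeLenPos (σ : ℕ+) : ℕ+ := ⟨codeLen σ, σ.pos.trans_le (Nat.le_add_right _ _)⟩

/-- The old circuit has `q * σ` input vertices, so `q ≤ d`, and every contribution is `d` times a
power of `σ` of degree at most 3. -/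
theorem checkSize_le {q σ d g : ℕ} (hσ : 1 ≤ σ) (hq : 1 ≤ q) (hd : q * σ + g ≤ d) :
    q * codeLen σ + (checkSize q σ + g + 2) ≤ (40 * σ) ^ 3 * d := by
  have hlen := codeLen_le hσ
  have hrows : codeRows σ ≤ 33 * σ := (Nat.le_add_left _ _).trans hlen
  have hqd : q ≤ d := (Nat.le_mul_of_pos_right q hσ).trans (by omega)
  have h1 : q * codeLen σ ≤ d * (33 * σ) := Nat.mul_le_mul hqd hlen
  have h2 : q * codeRows σ * rowSize σ ≤ d * (33 * σ) * (5 * σ) :=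
    Nat.mul_le_mul (Nat.mul_le_mul hqd hrows) (by rw [rowSize]; omega)
  have h3 : d * 1 ≤ d * σ := Nat.mul_le_mul_left _ hσ
  have h4 : d * σ * 1 ≤ d * σ * σ := Nat.mul_le_mul_left _ hσ
  have h5 : d * σ * σ * 1 ≤ d * σ * σ * σ := Nat.mul_le_mul_left _ hσ
  have e1 : d * (33 * σ) = 33 * (d * σ) := by ring
  have e2 : d * (33 * σ) * (5 * σ) = 165 * (d * σ * σ) := by ring
  have e3 : (40 * σ) ^ 3 * d = 64000 * (d * σ * σ * σ) := by ring
  rw [e3, checkSize]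
  omega

theorem pow_le_pow_mul_pow {k K σ : ℕ} (hσ : 1 ≤ σ) (h : k ≤ K) :
    (40 * σ) ^ k ≤ 40 ^ K * σ ^ K := by
  rw [← mul_pow]
  exact Nat.pow_le_pow_right (by omega) h

theorem HaltsWithin.mono {p : Cmd} {inp : List (List ℕ)} {T T' : ℕ}
    {Q Q' : (ℕ → List ℕ) → Prop} (h : HaltsWithin p inp T Q) (hT : T ≤ T')
    (hQ : ∀ o, Q o → Q' o) : HaltsWithin p inp T' Q' := by
  obtain ⟨t, ht, s, hs, ho⟩ := h
  exact ⟨t, ht.trans hT, s, hs, hQ _ ho⟩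

section

variable {r q m d t σ : ℕ+ → ℕ+} (V : Verifier r q m d t σ)

/-- The number of the query of the original verifier that belongs to a query. -/
def blockIdx {q σ : ℕ+} (k : Fin (q * codeLenPos σ : ℕ+)) : Fin q :=
  ⟨k / codeLen σ, (Nat.div_lt_iff_lt_mul (codeLenPos σ).pos).2 k.2⟩

/-- The position with offset `j` in the block number `i`. -/
def blockPos {m σ : ℕ+} (i : Fin m) (j : ℕ) (hj : j < codeLen σ) : Fin (m * codeLenPos σ : ℕ+) :=
  ⟨i * codeLen σ + j, block_lt i.2 hj⟩

/-- Query `k` asks for the bit with offset `k % b` in the block of the old query `k / b`. The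
exponent `K` is free, so that one value can serve for size, time and agents. -/
def robustVerifier {k K : ℕ} (hk : ProgBound k) (h3 : 3 ≤ K) (hK : k ≤ K) :
    Verifier r (fun n => q n * codeLenPos (σ n)) (fun n => m n * codeLenPos (σ n))
      (fun n => 40 ^ K * σ n ^ K * d n) (fun n => 40 ^ K * σ n ^ K * t n) fun _ => 1 where
  prog := robustProg V.prog
  query {n} x R k := blockPos (V.query x R (blockIdx k)) (k % codeLen (σ n))
    (Nat.mod_lt _ (codeLenPos (σ n)).pos)
  pred {n} x R := robustCircuit (q n).pos (σ n).pos (Nat.mul_one _) (V.pred x R)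
  size_le {n} x R := by
    have h2 := checkSize_le (σ n).pos (q n).pos (V.size_le x R)
    refine (le_of_eq ?_).trans (h2.trans ?_)
    · exact congrArg₂ (· + ·) (Nat.mul_one _) (length_robustGates (V.pred x R))
    · push_cast
      exact Nat.mul_le_mul_right _ (pow_le_pow_mul_pow (σ n).pos h3)
  run {n} x R := by
    have h := hk V.prog [bits x, bits R] (q n).pos (σ n).pos
      (N := (q n * codeLenPos (σ n) : ℕ+) * (1 : ℕ+)) (Nat.mul_one _)
      (V.pred x R) _ (t n) (List.length_ofFn) (V.run x R)
    refine h.mono ?_ fun o ho => ⟨?_, ho.2⟩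
    · push_cast
      exact Nat.mul_le_mul_right _ (pow_le_pow_mul_pow (σ n).pos hK)
    · rw [ho.1]
      refine List.ext_getElem (by simp; rfl) fun i h1 h2 => ?_
      simp only [List.getElem_map, List.getElem_range, List.getElem_ofFn, blockPos]
      have hi : i / codeLen (σ n) < q n :=
        (Nat.div_lt_iff_lt_mul (show 0 < codeLen (σ n) from (codeLenPos (σ n)).pos)).2
          (by rw [List.length_map, List.length_range] at h1; exact h1)
      rw [List.getD_eq_getElem _ _ (by rw [List.length_ofFn]; exact hi), List.getElem_ofFn]
      rfl

theorem accepts_robustVerifier {k K : ℕ} (hk : ProgBound k) (h3 : 3 ≤ K) (hK : k ≤ K) {n : ℕ+}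
    (x : Fin n → Bool) (R : Fin (r n) → Bool)
    (a : Fin (q n * codeLenPos (σ n) : ℕ+) → Fin (1 : ℕ+) → Bool) :
    ((robustVerifier V hk h3 hK).pred x R).Accepts a ↔
      (∀ k < (q n : ℕ), IsCodeBlock (σ n) (flat a) k) ∧
        (V.pred x R).Accepts fun k j => flat a (k * codeLen (σ n) + j) :=
  accepts_robustCircuit (q n).pos (σ n).pos (Nat.mul_one _) (V.pred x R) a

theorem flat_answers {k K : ℕ} (hk : ProgBound k) (h3 : 3 ≤ K) (hK : k ≤ K) {n : ℕ+}
    (x : Fin n → Bool) (R : Fin (r n) → Bool)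
    (π : Fin (m n * codeLenPos (σ n) : ℕ+) → Fin (1 : ℕ+) → Bool) (k : Fin (q n)) {j : ℕ}
    (hj : j < codeLen (σ n)) :
    flat ((robustVerifier V hk h3 hK).answers x π R) (k * codeLen (σ n) + j) =
      π (blockPos (V.query x R k) j hj) 0 := by
  refine (dif_pos (show (k : ℕ) * codeLen (σ n) + j < (q n * codeLenPos (σ n) : ℕ+) from
    block_lt k.2 hj)).trans ?_
  have h1 : ((k : ℕ) * codeLen (σ n) + j) / codeLen (σ n) = k := by
    rw [mul_comm, Nat.mul_add_div (by omega), Nat.div_eq_of_lt hj, Nat.add_zero]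
  have h2 : ((k : ℕ) * codeLen (σ n) + j) % codeLen (σ n) = j := by
    rw [mul_comm, Nat.mul_add_mod, Nat.mod_eq_of_lt hj]
  change π _ 0 = _
  congr 1
  refine Fin.ext ?_
  simp only [robustVerifier, blockPos, blockIdx, h1, h2]

theorem prob_mono {r : ℕ} {E E' : (Fin r → Bool) → Prop} (h : ∀ R, E R → E' R) :
    prob E ≤ prob E' := by
  rw [prob, prob]
  gcongr
  · exact Set.toFinite _
  · exact h _

/-- Differences are counted block by block: each symbol where `a` and `π` differ contributes at
least `codeLen σ / 288` differing bits, and the blocks of the answer word are disjoint even if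
locations repeat. -/
theorem hammingDist_mul_le {q σ : ℕ+} {a π : Fin q → Fin σ → Bool}
    {a' π' : Fin (q * codeLenPos σ : ℕ+) → Fin (1 : ℕ+) → Bool}
    (h : ∀ k, a k ≠ π k → codeLen σ ≤ 288 * ((Finset.range (codeLen σ)).filter fun j =>
      flat a' (k * codeLen σ + j) ≠ flat π' (k * codeLen σ + j)).card) :
    hammingDist a π * codeLen σ ≤ 288 * hammingDist a' π' := by
  classical
  let w : Fin q → Finset ℕ := fun k => (Finset.range (codeLen σ)).filter fun j =>
    flat a' (k * codeLen σ + j) ≠ flat π' (k * codeLen σ + j)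
  have h1 : (Finset.univ.sigma w).card ≤ hammingDist a' π' := by
    rw [hammingDist]
    refine Finset.card_le_card_of_injOn
      (fun y => if h : y.2 < codeLen σ then blockPos y.1 y.2 h else ⟨0, PNat.pos _⟩) ?_ ?_
    · rintro ⟨k, j⟩ hy
      simp only [w, Finset.coe_sigma, Set.mem_sigma_iff, Finset.mem_coe, Finset.mem_filter,
        Finset.mem_range, Finset.mem_univ, true_and] at hy ⊢
      rw [dif_pos hy.1]
      intro heq
      have hlt : (k : ℕ) * codeLen σ + j < (q * codeLenPos σ : ℕ+) := block_lt k.2 hy.1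
      refine hy.2 ?_
      rw [flat, flat, dif_pos hlt, dif_pos hlt]
      exact congrFun heq 0
    · rintro ⟨k, j⟩ hy ⟨k', j'⟩ hy' heq
      simp only [w, Finset.coe_sigma, Set.mem_sigma_iff, Finset.mem_coe, Finset.mem_filter,
        Finset.mem_range, Finset.mem_univ, true_and] at hy hy' heq
      rw [dif_pos hy.1, dif_pos hy'.1] at heq
      have heq' : (k : ℕ) * codeLen σ + j = k' * codeLen σ + j' := Fin.ext_iff.1 heq
      have hpos : 0 < codeLen σ := (codeLenPos σ).pos
      have e1 := congrArg (· / codeLen σ) heq'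
      have e2 := congrArg (· % codeLen σ) heq'
      simp only [mul_comm _ (codeLen σ), Nat.mul_add_div hpos, Nat.mul_add_mod,
        Nat.div_eq_of_lt hy.1, Nat.div_eq_of_lt hy'.1, Nat.mod_eq_of_lt hy.1,
        Nat.mod_eq_of_lt hy'.1, Nat.add_zero] at e1 e2
      obtain rfl := Fin.ext e1
      rw [e2]
  rw [Finset.card_sigma] at h1
  refine le_trans ?_ (Nat.mul_le_mul_left 288 h1)
  rw [hammingDist, ← smul_eq_mul, Finset.mul_sum]
  refine (Finset.card_nsmul_le_sum _ (fun k => 288 * (w k).card) _ fun k hk => ?_).trans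
    (Finset.sum_le_sum_of_subset (Finset.filter_subset _ _))
  exact h k (Finset.mem_filter.1 hk).2

theorem isRobustPCP_robustVerifier {k K : ℕ} (hk : ProgBound k) (h3 : 3 ≤ K) (hK : k ≤ K)
    {L : Language Bool} {s ρ : ℕ+ → ℝ} (hV : V.IsRobustPCP L s ρ) :
    (robustVerifier V hk h3 hK).IsRobustPCP L s fun n => 1 / 288 * ρ n where
  complete {n} x hx := by
    obtain ⟨π, hπ⟩ := hV.complete x hx
    have hpos : 0 < codeLen (σ n) := (codeLenPos (σ n)).pos
    -- The honest proof encodes each symbol of the old honest proof; acceptance is then equivalent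
    -- coin by coin.
    refine ⟨fun i _ => encBit (π (blockIdx i)) (i % codeLen (σ n)), ?_⟩
    rw [← hπ]
    congr 1
    funext R
    refine propext ((accepts_robustVerifier V hk h3 hK x R _).trans ?_)
    have key : ∀ (k : Fin (q n)) {j : ℕ}, j < codeLen (σ n) →
        flat ((robustVerifier V hk h3 hK).answers x (fun i _ => encBit (π (blockIdx i))
          (i % codeLen (σ n))) R) (k * codeLen (σ n) + j) = encBit (π (V.query x R k)) j := by
      intro k j hj
      rw [flat_answers _ _ _ _ _ _ _ _ hj]
      have h1 : ((V.query x R k : ℕ) * codeLen (σ n) + j) / codeLen (σ n) = V.query x R k := by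
        rw [mul_comm, Nat.mul_add_div hpos, Nat.div_eq_of_lt hj, Nat.add_zero]
      have h2 : ((V.query x R k : ℕ) * codeLen (σ n) + j) % codeLen (σ n) = j := by
        rw [mul_comm, Nat.mul_add_mod, Nat.mod_eq_of_lt hj]
      simp only [blockPos, blockIdx, h1, h2]
    have hmsg : ∀ (k : Fin (q n)) (j : Fin (σ n)),
        flat ((robustVerifier V hk h3 hK).answers x (fun i _ => encBit (π (blockIdx i))
          (i % codeLen (σ n))) R) (k * codeLen (σ n) + j) = V.answers x π R k j := by
      intro k j
      rw [key k (j.2.trans_le (Nat.le_add_right _ _)), encBit, if_pos j.2, extend_of_lt _ j.2]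
      rfl
    have hblock : ∀ k < (q n : ℕ), IsCodeBlock (σ n) (flat ((robustVerifier V hk h3 hK).answers x
        (fun i _ => encBit (π (blockIdx i)) (i % codeLen (σ n))) R)) k := by
      intro k hk' i hi
      rw [add_assoc, key ⟨k, hk'⟩ (by rw [codeLen]; omega), encBit, if_neg (by omega),
        Nat.add_sub_cancel_left]
      refine parityBit_congr (fun j hj => ?_) i
      rw [hmsg ⟨k, hk'⟩ ⟨j, hj⟩, extend_of_lt _ hj]
      rfl
    rw [and_iff_right hblock]
    have : (fun (k : Fin (q n)) (j : Fin (σ n)) =>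
        flat ((robustVerifier V hk h3 hK).answers x (fun i _ => encBit (π (blockIdx i))
          (i % codeLen (σ n))) R) (k * codeLen (σ n) + j)) = V.answers x π R :=
      funext fun k => funext fun j => hmsg k j
    rw [this]
  robust {n} x hx π' := by
    let y : Fin (m n) → ℕ → Bool := fun i j =>
      if h : j < codeLen (σ n) then π' (blockPos i j h) 0 else false
    -- The old proof consists of the nearest-codeword decodings, chosen once per location and
    -- independently of the coins.
    choose π hπ using fun i => exists_decode (σ := σ n) (y i)
    refine lt_of_le_of_lt (prob_mono fun R => ?_) (hV.robust x hx π)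
    rintro ⟨a', hacc, hdist⟩
    replace hacc := (accepts_robustVerifier V hk h3 hK x R a').1 hacc
    -- The witness for the old bad event is the tuple of message parts of the accepted word.
    refine ⟨_, hacc.2, ?_⟩
    have hle := hammingDist_mul_le (q := q n) (σ := σ n)
      (a := fun k j => flat a' (k * codeLen (σ n) + j)) (π := V.answers x π R) (a' := a')
      (π' := (robustVerifier V hk h3 hK).answers x π' R) fun k hne => by
        refine (hπ (V.query x R k) _ hne).trans (Nat.mul_le_mul_left _ ?_)
        rw [encDist]
        refine Finset.card_le_card fun j hj => ?_
        simp only [Finset.mem_filter, Finset.mem_range] at hj ⊢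
        refine ⟨hj.1, ?_⟩
        rw [flat_block (hacc.1 k k.2) hj.1, flat_answers _ _ _ _ _ _ _ _ hj.1]
        have := hj.2
        simp only [y, dif_pos hj.1] at this
        exact this
    have hq : (0 : ℝ) < q n := by exact_mod_cast (q n).pos
    have hb : (0 : ℝ) < codeLen (σ n) := by exact_mod_cast (codeLenPos (σ n)).pos
    rw [relDist] at hdist ⊢
    have hcast : (((q n * codeLenPos (σ n) : ℕ+) : ℕ) : ℝ) = q n * codeLen (σ n) := by
      rw [PNat.mul_coe, Nat.cast_mul]; rfl
    rw [hcast, div_le_iff₀ (mul_pos hq hb)] at hdist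
    rw [div_le_iff₀ hq]
    have hle' : (hammingDist (fun (k : Fin (q n)) (j : Fin (σ n)) => flat a' (k * codeLen (σ n) + j))
        (V.answers x π R) : ℝ) *
        codeLen (σ n) ≤ 288 * hammingDist a' ((robustVerifier V hk h3 hK).answers x π' R) := by
      exact_mod_cast hle
    refine le_of_mul_le_mul_right ?_ hb
    calc _ ≤ _ := hle'
      _ ≤ 288 * (1 / 288 * ρ n * (q n * codeLen (σ n))) := by gcongr
      _ = _ := by ring

end

section

open Arith

/-! ## Neighbor listing: the programs of the agents -/

/-- Within `t` steps, the program writes `σ` to the first slot; it leaves the variables and arrays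
with numbers `3 * v + 2` and the output untouched. -/
def Prepares (p : Cmd) (inp : List (List ℕ)) (t σ : ℕ) : Prop :=
  ∃ T ≤ t, ∃ s, Exec inp p State.start T s ∧ s.var 0 = σ ∧ SimRel 2 State.start s ∧
    s.out = State.start.out

/-- The first nonzero entry of a list. -/
def firstNonzero (l : List ℕ) : ℕ := l.foldl (fun a x => if a = 0 then x else a) 0

theorem firstNonzero_append (l : List ℕ) (x : ℕ) :
    firstNonzero (l ++ [x]) = if firstNonzero l = 0 then x else firstNonzero l := by
  rw [firstNonzero, List.foldl_append]; rfl

theorem firstNonzero_cons {a : ℕ} (ha : a ≠ 0) (l : List ℕ) : firstNonzero (a :: l) = a := by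
  rw [firstNonzero, List.foldl_cons, if_pos rfl]
  induction l with
  | nil => rfl
  | cons x l ih => rwa [List.foldl_cons, if_neg ha]

/-- Keep the first nonzero entry of the output stream `w₀` in the first slot. If `w₀` is not `0`,
then count the entries of the output stream `0` in the second slot. Only the input `0` is read; the
command `c v` says how the length of the input `1` is determined. -/
def probeHandler (w₀ : ℕ) (c : ℕ → Cmd) : Handler where
  read v j i := if j = 0 then .read v 0 i else .const v 0
  len v j := if j = 0 then .len v 0 else if j = 1 then c v else .const v 0
  out w v :=
    if w = w₀ then .cond 0 .skip (copy 0 v)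
    else if w = 0 then .seq (.const 6 1) (.arith .add 3 3 6)
    else .skip

structure Probed (w₀ : ℕ) (outs : ℕ → List ℕ) (s : State) : Prop where
  first : s.var 0 = firstNonzero (outs w₀)
  count : w₀ ≠ 0 → s.var 3 = (outs 0).length
  sim : SimRel 2 State.start s
  out : s.out = State.start.out

theorem Probed.congr {w₀ : ℕ} {outs : ℕ → List ℕ} {s s' : State} (h : Probed w₀ outs s)
    (hv : ∀ v, v % 3 ≠ 1 → v ≠ 6 → s'.var v = s.var v) (ha : ∀ A, A % 3 ≠ 1 → s'.arr A = s.arr A)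
    (ho : s'.out = s.out) : Probed w₀ outs s' :=
  ⟨(hv 0 (by norm_num) (by norm_num)).trans h.first,
    fun h' => (hv 3 (by norm_num) (by norm_num)).trans (h.count h'),
    ⟨fun v => (hv _ (by omega) (by omega)).trans (h.sim.1 v),
      fun A => (ha _ (by omega)).trans (h.sim.2 A)⟩, ho.trans h.out⟩

/-- The simulated program sees the input `x` and, as second input, `r` zeros. Only their number
matters, and the command `c` supplies it; reading them always gives 0. In the first slot 0 can serve
as the mark for nothing seen yet. -/
theorem correct_probeHandler {w₀ : ℕ} {c : ℕ → Cmd} {X : List ℕ} {r : ℕ} {inp' : List (List ℕ)}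
    {inp : List (List ℕ)} (h0 : inp.getD 0 [] = X) (h0' : inp'.getD 0 [] = X)
    (h1 : inp.getD 1 [] = List.replicate r 0) (h2 : ∀ j, 2 ≤ j → inp.getD j [] = [])
    (hc : ∀ v s, ∃ T ≤ 4, ∃ s', Exec inp' (c (3 * v + 1)) s T s' ∧ SetsTo 1 v r s s' ∧
      (∀ u, u % 3 ≠ 1 → u ≠ 6 → s'.var u = s.var u) ∧ s'.arr = s.arr ∧ s'.out = s.out) :
    (probeHandler w₀ c).Correct 1 inp inp' 4 (Probed w₀) where
  pos := by norm_num
  lt := by norm_num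
  stable h hI := hI.congr (fun v hv _ => h.var v hv) h.arr h.out
  read v j i outs s hI := by
    have key : ∀ a, Probed w₀ outs (s.setVar (3 * v + 1) a) := fun a =>
      hI.congr (fun u hu _ => State.setVar_ne _ _ (by omega)) (fun _ _ => rfl) rfl
    by_cases hj : j = 0
    · subst hj
      refine ⟨1, by norm_num, s.setVar (3 * v + 1) (X.getD (s.var (3 * i + 1)) 0), ?_, ?_, key _⟩
      · simp only [probeHandler, if_true]
        rw [← h0']
        exact .read _ _ _ _
      · rw [h0]
        exact setsTo_setVar 1 s v _
    · refine ⟨1, by norm_num, s.setVar (3 * v + 1) 0, ?_, ?_, key _⟩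
      · simp only [probeHandler, if_neg hj]
        exact .const _ _ _
      · have : (inp.getD j []).getD (s.var (3 * i + 1)) 0 = 0 := by
          rcases (show j = 1 ∨ 2 ≤ j by omega) with rfl | hj2
          · rw [h1]
            rcases lt_or_ge (s.var (3 * i + 1)) r with h | h
            · rw [List.getD_eq_getElem _ _ (by simpa using h), List.getElem_replicate]
            · rw [List.getD_eq_default _ _ (by simpa using h)]
          · rw [h2 j hj2]; rfl
        rw [this]
        exact setsTo_setVar 1 s v _
  len v j outs s hI := by
    have key : ∀ a, Probed w₀ outs (s.setVar (3 * v + 1) a) := fun a =>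
      hI.congr (fun u hu _ => State.setVar_ne _ _ (by omega)) (fun _ _ => rfl) rfl
    by_cases hj : j = 0
    · subst hj
      refine ⟨1, by norm_num, s.setVar (3 * v + 1) X.length, ?_, ?_, key _⟩
      · simp only [probeHandler, if_true]
        rw [← h0']
        exact .len _ _ _
      · rw [h0]
        exact setsTo_setVar 1 s v _
    by_cases hj1 : j = 1
    · subst hj1
      obtain ⟨T, hT, s', hs, hset, hvar, harr, hout⟩ := hc v s
      refine ⟨T, hT, s', ?_, ?_, hI.congr hvar (fun A _ => congrFun harr A) hout⟩
      · simpa [probeHandler] using hs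
      · rwa [h1, List.length_replicate]
    · refine ⟨1, by norm_num, s.setVar (3 * v + 1) 0, ?_, ?_, key _⟩
      · simp only [probeHandler, if_neg hj, if_neg hj1]
        exact .const _ _ _
      · rw [h2 j (by omega)]
        exact setsTo_setVar 1 s v _
  out w v outs s hI := by
    by_cases hw : w = w₀
    · subst hw
      have hcount : w ≠ 0 → s.var 3 = (Function.update outs w (outs w ++ [s.var (3 * v + 1)])
          0).length := fun h' => by
        rw [Function.update_of_ne (Ne.symm h')]; exact hI.count h'
      simp only [probeHandler, if_true]
      by_cases h : s.var 0 = 0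
      · obtain ⟨s', hs', rfl⟩ := exec_copy inp' s (v := 0) (a := 3 * v + 1) (by omega)
        refine ⟨2 + 1, by norm_num, _, .condFalse h hs', fun u => State.setVar_ne _ _ (by omega),
          fun A => rfl, ?_, fun h' => (State.setVar_ne _ _ (by norm_num)).trans (hcount h'),
          ⟨fun u => (State.setVar_ne _ _ (by omega)).trans (hI.sim.1 u), hI.sim.2⟩, hI.out⟩
        rw [State.setVar_same, Function.update_self, firstNonzero_append, ← hI.first, if_pos h]
      · refine ⟨1 + 1, by norm_num, s, .condTrue h (.skip s), fun u => rfl, fun A => rfl, ?_,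
          hcount, hI.sim, hI.out⟩
        rw [Function.update_self, firstNonzero_append, ← hI.first, if_neg h]
    have hfirst : Function.update outs w (outs w ++ [s.var (3 * v + 1)]) w₀ = outs w₀ :=
      Function.update_of_ne (Ne.symm hw) _ _
    by_cases hw0 : w = 0
    · subst hw0
      simp only [probeHandler, if_neg hw, if_true]
      refine ⟨1 + 1, by norm_num, _, .seq (.const _ _ _) (.arith _ _ _ _ _), fun u => ?_,
        fun A => rfl, ?_, fun h' => ?_, ⟨fun u => ?_, hI.sim.2⟩, hI.out⟩
      · rw [State.setVar_ne _ _ (by omega), State.setVar_ne _ _ (by omega)]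
      · rw [State.setVar_ne _ _ (by norm_num), State.setVar_ne _ _ (by norm_num), hfirst]
        exact hI.first
      · rw [State.setVar_same, State.setVar_ne _ _ (by norm_num), State.setVar_same]
        simp [Op.eval, hI.count h']
      · rw [State.setVar_ne _ _ (by omega), State.setVar_ne _ _ (by omega)]
        exact hI.sim.1 u
    · simp only [probeHandler, if_neg hw, if_neg hw0]
      refine ⟨1, by norm_num, s, .skip s, fun u => rfl, fun A => rfl, ?_, fun h' => ?_, hI.sim,
        hI.out⟩
      · rw [hfirst]; exact hI.first
      · rw [Function.update_of_ne (Ne.symm hw0)]; exact hI.count h'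

theorem probed_start (w₀ : ℕ) : Probed w₀ State.start.out State.start :=
  ⟨rfl, fun _ => rfl, ⟨fun _ => rfl, fun _ => rfl⟩, rfl⟩

theorem prepares_of_haltsWithin {p : Cmd} {X : List ℕ} {Y : List (List ℕ)} {t σ : ℕ} (hσ : 1 ≤ σ)
    (h : HaltsWithin p [X] t fun out => out 0 = [σ]) :
    Prepares (p.sim 1 (probeHandler 0 fun v => .const v 0)) (X :: Y) (8 * t) σ := by
  obtain ⟨T, hT, s, hs, ho⟩ := h
  have hc : (probeHandler 0 fun v => .const v 0).Correct 1 [X] (X :: Y) 4 (Probed 0) := by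
    refine correct_probeHandler (X := X) (r := 0) rfl rfl rfl (fun j hj => ?_) fun v s =>
      ⟨1, by norm_num, _, .const _ _ _, setsTo_setVar 1 s v 0, fun u hu _ =>
        State.setVar_ne _ _ (by omega), rfl, rfl⟩
    rw [List.getD_eq_default _ _ (by simpa using by omega)]
  obtain ⟨T', hT', s', hs', -, hI⟩ := exec_sim hc hs State.start ⟨fun _ => rfl, fun _ => rfl⟩
    (probed_start 0)
  refine ⟨T', by omega, s', hs', ?_, hI.sim, hI.out⟩
  rw [hI.first, ho]
  exact firstNonzero_cons (by omega) _

/-- Run the verifier on zero coins, and divide the number of inputs of its circuit by the number of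
its queries. -/
def probeProg (p : Cmd) : Cmd :=
  .seq (p.sim 1 (probeHandler 1 fun v =>
    .seq (.len 6 2) (.seq (.len v 1) (.seq (.arith .add v v 6) (.arith .add v v v)))))
    (.arith .div 0 0 3)

/-- An agent lacks part of the coins, but zero coins are as good as any for finding `σ`, and their
number is twice the length of its own part and one shared part. The first number of the circuit
description is `q * σ`, the count of queries is `q`, and their quotient is `σ`. -/
theorem prepares_probeProg {p : Cmd} {X U W : List ℕ} {Y : List (List ℕ)} {t q σ r : ℕ}
    {Q C : List ℕ} (hq : 1 ≤ q) (hσ : 1 ≤ σ) (hr : r = U.length + W.length + (U.length + W.length))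
    (h : HaltsWithin p [X, List.replicate r 0] t fun out =>
      out 0 = Q ∧ out 1 = q * σ :: C) (hQ : Q.length = q) :
    Prepares (probeProg p) (X :: U :: W :: Y) (8 * t) σ := by
  obtain ⟨T, hT, s, hs, ho0, ho1⟩ := h
  have hc : (probeHandler 1 fun v =>
      .seq (.len 6 2) (.seq (.len v 1) (.seq (.arith .add v v 6) (.arith .add v v v)))).Correct
      1 [X, List.replicate r 0] (X :: U :: W :: Y) 4 (Probed 1) := by
    refine correct_probeHandler (X := X) (r := r) rfl rfl rfl (fun j hj => ?_) fun v s =>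
      ⟨1 + (1 + (1 + 1)), by norm_num, _, .seq (.len _ _ _) (.seq (.len _ _ _) (.seq
        (.arith _ _ _ _ _) (.arith _ _ _ _ _))), ⟨fun u => ?_, fun A => rfl⟩, fun u hu hu' => ?_,
        rfl, rfl⟩
    · rw [List.getD_eq_default _ _ (by simpa using by omega)]
    · split
      · rename_i h
        subst h
        have h6 : 6 ≠ 3 * u + 1 := by omega
        simp only [State.setVar_same, State.setVar_ne _ _ h6]
        exact hr.symm
      · rw [State.setVar_ne _ _ (by omega), State.setVar_ne _ _ (by omega),
          State.setVar_ne _ _ (by omega), State.setVar_ne _ _ (by omega)]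
    · rw [State.setVar_ne _ _ (by omega), State.setVar_ne _ _ (by omega),
        State.setVar_ne _ _ (by omega), State.setVar_ne _ _ hu']
  obtain ⟨T', hT', s', hs', -, hI⟩ := exec_sim hc hs State.start ⟨fun _ => rfl, fun _ => rfl⟩
    (probed_start 1)
  have := exec_pos hs
  -- The simulation takes at most `4 * t` steps, so `8 * t` leaves room for the division.
  refine ⟨T' + 1, by omega, _, .seq hs' (.arith _ _ _ _ _), ?_,
    ⟨fun u => (State.setVar_ne _ _ (by omega)).trans (hI.sim.1 u), hI.sim.2⟩, hI.out⟩
  rw [State.setVar_same, hI.first, hI.count one_ne_zero, ho0, ho1, hQ,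
    firstNonzero_cons (Nat.mul_pos hq hσ).ne']
  exact Nat.mul_div_cancel_left σ hq

/-- The length of the code, the number of the block of the query, and its offset in the block. -/
def blockExprs : List Arith :=
  [.op .add (.var 0) (.call rowsA (.var 0) (.const 0) (.const 0)),
   .op .div (.var 1) (.var 2),
   .op .mod (.var 1) (.var 2)]

/-- Small are `σ`, the code length and the offset; the query number and the block number are not. -/
def blockMarks : List Bool := [true, false, true, false, true]

def blockEnv (σ k : ℕ) : List ℕ := [σ, k, codeLen σ, k / codeLen σ, k % codeLen σ]

/-- The location with the same offset in the block whose number is in the sixth slot. -/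
def locationA : Arith := .op .add (prodA (.var 2) (.var 5)) (.var 4)

/-- Replace the number of the query by the number of its block, and the queries in the output stream
`2` by the queries with the same offset in their blocks. -/
def blockHandler : Handler where
  read v j i := if j = 4 then .cond i (.const v 0) (copy v 9) else .read v j i
  len v j := .len v j
  out w v :=
    if w = 2 then .seq (copy 15 v) (.seq (locationA.comp (List.range 6) 6) (.out 2 18))
    else .out w v

structure Located (σ k : ℕ) (outs : ℕ → List ℕ) (s : State) : Prop where
  slots : s.slots 5 = blockEnv σ k
  out : s.out = Function.update outs 2
    ((outs 2).map fun i => i * codeLen σ + k % codeLen σ)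

theorem envLE_blockEnv {σ : ℕ} (hσ : 1 ≤ σ) (k : ℕ) :
    EnvLE blockMarks (40 * σ) (blockEnv σ k) := by
  have h := codeLen_le hσ
  have h' : k % codeLen σ < codeLen σ := Nat.mod_lt _ (by rw [codeLen]; omega)
  refine .cons (.cons (.cons (.cons (.cons .nil le_rfl ?_) le_rfl ?_) le_rfl ?_) le_rfl ?_)
    le_rfl ?_ <;> intro hb <;> first | omega | exact absurd hb (by decide)

theorem tame_locationA : Tame blockMarks locationA :=
  Tame.op _ (Tame.prod (Small.var rfl) (Tame.var _) (Tame.var _)) (Tame.var _)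

theorem tame_blockExprs : ∀ e ∈ blockExprs, Tame blockMarks e := by
  have v := Tame.var (S := blockMarks)
  have c := Tame.const (S := blockMarks)
  simp only [blockExprs, List.forall_mem_cons, List.not_mem_nil, false_imp_iff, implies_true,
    and_true]
  exact ⟨Tame.op _ (v _) (Tame.call_all tame_rowsA (Small.var rfl) (Small.const _)
    (Small.const _) (v _) (c _) (c _)), Tame.op _ (v _) (v _), Tame.op _ (v _) (v _)⟩

theorem letsEnv_blockExprs (M : ℕ → ℕ → ℕ) (σ k : ℕ) :
    letsEnv M blockExprs [σ, k] = blockEnv σ k := by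
  simp [letsEnv, blockExprs, eval, Op.eval, eval_rowsA, blockEnv, codeLen]

theorem eval_locationA (M : ℕ → ℕ → ℕ) (σ k i : ℕ) :
    locationA.eval M (blockEnv σ k ++ [i]) = i * codeLen σ + k % codeLen σ := by
  simp [locationA, eval, Op.eval, eval_prodA, blockEnv, mul_comm]

theorem Located.congr {σ k : ℕ} {outs : ℕ → List ℕ} {s s' : State} (h : Located σ k outs s)
    (hv : ∀ v < 5, s'.var (3 * v) = s.var (3 * v)) (ho : s'.out = s.out) : Located σ k outs s' := by
  refine ⟨?_, ho.trans h.out⟩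
  rw [← h.slots]
  exact List.map_congr_left fun v hv' => hv v (List.mem_range.1 hv')

/-- The old agent is shown the block number in place of the query number, and only its stream of
query numbers is rewritten. The new number `i * b + offset` is a product with the small factor `b`,
so its cost is polynomial in `σ`. -/
theorem correct_blockHandler {σ k K : ℕ} (hσ : 1 ≤ σ)
    (hK : ∀ M B env, 2 ≤ B → EnvLE blockMarks B env → locationA.cost M env ≤ B ^ K)
    (I : List (List ℕ)) (hI : I.length = 4) :
    blockHandler.Correct 2 (I ++ [[k / codeLen σ]]) (I ++ [[k]]) ((40 * σ) ^ K + 3)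
      (Located σ k) where
  pos := by omega
  lt := by norm_num
  stable h hI := hI.congr (fun v _ => h.var _ (by omega)) h.out
  read v j i outs s hL := by
    have key : ∀ a, Located σ k outs (s.setVar (3 * v + 2) a) := fun a =>
      hL.congr (fun u _ => State.setVar_ne _ _ (by omega)) rfl
    by_cases hj : j = 4
    · subst hj
      have h9 : s.var 9 = k / codeLen σ := congrArg (·.getD 3 0) hL.slots
      have hget : (I ++ [[k / codeLen σ]]).getD 4 [] = [k / codeLen σ] := by
        rw [List.getD_append_right _ _ _ _ hI.le, hI]; rfl
      simp only [blockHandler, if_true]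
      rw [hget]
      by_cases h : s.var (3 * i + 2) = 0
      · obtain ⟨s', hs', rfl⟩ := exec_copy (I ++ [[k]]) s (v := 3 * v + 2) (a := 9) (by omega)
        refine ⟨2 + 1, by omega, _, .condFalse h hs', ?_, key _⟩
        rw [h, h9]
        exact setsTo_setVar 2 s v _
      -- The last input has a single entry, so any nonzero index reads the default 0.
      · refine ⟨1 + 1, by omega, _, .condTrue h (.const _ _ _), ?_, key _⟩
        rw [List.getD_eq_default _ _ (by simp; omega)]
        exact setsTo_setVar 2 s v _
    · simp only [blockHandler, if_neg hj]
      refine ⟨1, by omega, _, .read _ _ _ _, ?_, key _⟩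
      have : (I ++ [[k / codeLen σ]]).getD j [] = (I ++ [[k]]).getD j [] := by
        rcases lt_or_gt_of_ne hj with h | h
        · rw [List.getD_append _ _ _ _ (by omega), List.getD_append _ _ _ _ (by omega)]
        · rw [List.getD_eq_default _ _ (by simp; omega), List.getD_eq_default _ _ (by simp; omega)]
      rw [this]
      exact setsTo_setVar 2 s v _
  len v j outs s hL := by
    refine ⟨1, by omega, _, .len _ _ _, ?_,
      hL.congr (fun u _ => State.setVar_ne _ _ (by omega)) rfl⟩
    have : ((I ++ [[k / codeLen σ]]).getD j []).length = ((I ++ [[k]]).getD j []).length := by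
      rcases lt_trichotomy j 4 with h | rfl | h
      · rw [List.getD_append _ _ _ _ (by omega), List.getD_append _ _ _ _ (by omega)]
      · rw [List.getD_append_right _ _ _ _ hI.le, List.getD_append_right _ _ _ _ hI.le, hI]; rfl
      · rw [List.getD_eq_default _ _ (by simp; omega), List.getD_eq_default _ _ (by simp; omega)]
    rw [this]
    exact setsTo_setVar 2 s v _
  out w v outs s hL := by
    by_cases hw : w = 2
    · subst hw
      simp only [blockHandler, if_true]
      obtain ⟨s₁, h₁, rfl⟩ := exec_copy (I ++ [[k]]) s (v := 15) (a := 3 * v + 2) (by omega)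
      set s₁ := s.setVar 15 (s.var (3 * v + 2)) with hs₁
      have henv : s₁.env (List.range 6) = blockEnv σ k ++ [s.var (3 * v + 2)] := by
        change s₁.slots (5 + 1) = _
        rw [State.slots_succ, State.setVar_same, ← hL.slots]
        congr 1
      obtain ⟨T, hT, s₂, h₂, hr, hf⟩ := exec_comp (I ++ [[k]]) locationA (List.range 6) 6 s₁
        fun u => List.mem_range.1
      rw [henv] at hT hr
      rw [eval_locationA] at hr
      have hcost := hK s₁.arr (40 * σ) (blockEnv σ k ++ [s.var (3 * v + 2)]) (by omega) (by
        intro i hi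
        rcases lt_or_ge i 5 with h | h
        · rw [List.getD_append _ _ _ _ (by simpa [blockEnv] using h)]
          exact envLE_blockEnv hσ k i hi
        · rw [List.getD_eq_default _ _ (by simpa [blockMarks] using h)] at hi
          exact absurd hi (by decide))
      refine ⟨2 + (T + 1), by omega, _, .seq h₁ (.seq h₂ (.out _ _ _)), fun u => ?_, fun A => ?_,
        Located.congr (s := { s with out := Function.update s.out 2 (s.out 2 ++
          [s.var (3 * v + 2) * codeLen σ + k % codeLen σ]) }) ⟨hL.slots, ?_⟩ (fun u hu => ?_) ?_⟩
      · exact (hf.var _ (by omega)).trans (State.setVar_ne _ _ (by omega))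
      · exact congrFun hf.arr _
      · simp only [hL.out, Function.update_self, Function.update_idem, List.map_append,
          List.map_cons, List.map_nil]
      · exact (hf.var _ (by omega)).trans (State.setVar_ne _ _ (by omega))
      · simp only
        rw [hf.out, show s₂.var 18 = _ from hr]
        rfl
    · simp only [blockHandler, if_neg hw]
      refine ⟨1, by omega, _, .out _ _ _, fun u => rfl, fun A => rfl, hL.slots, ?_⟩
      simp only
      rw [hL.out, Function.update_of_ne hw, Function.update_of_ne (Ne.symm hw),
        Function.update_comm hw]

/-- The agent for the robust verifier: compute `σ`, and simulate the agent for the original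
verifier. -/
def blockAgent (pre A : Cmd) : Cmd :=
  .seq pre <| .seq (.const 6 0) <| .seq (.read 3 4 6) <| .seq (lets blockExprs 2) <|
    A.sim 2 blockHandler

/-- The exponent `K` suffices for the running time of the agents. -/
def AgentBound (K : ℕ) : Prop :=
  ∀ (pre A : Cmd) (I : List (List ℕ)) (σ k t T : ℕ) (Q : (ℕ → List ℕ) → Prop), 1 ≤ σ →
    I.length = 4 → Prepares pre (I ++ [[k]]) (8 * t) σ →
    HaltsWithin A (I ++ [[k / codeLen σ]]) T Q →
    HaltsWithin (blockAgent pre A) (I ++ [[k]]) ((40 * σ) ^ K * (T + t)) fun out =>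
      ∃ o, Q o ∧ out = Function.update o 2 ((o 2).map fun i => i * codeLen σ + k % codeLen σ)

theorem exists_agentBound : ∃ K, AgentBound K := by
  obtain ⟨k₁, hk₁⟩ := exists_pow_cost _ tame_blockExprs
  obtain ⟨k₂, hk₂⟩ := exists_pow_cost [locationA] (by simpa using tame_locationA)
  refine ⟨k₁ + k₂ + 1, fun pre A I σ k t T Q hσ hI ⟨T₀, hT₀, s, h₀, hs0, hsim, hout⟩
    ⟨T₃, hT₃, s', h₃, hQ⟩ => ?_⟩
  have hB2 : 2 ≤ 40 * σ := by omega
  set s₁ := (s.setVar 6 0).setVar 3 k with hs₁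
  have h₁ : Exec (I ++ [[k]]) (.read 3 4 6) (s.setVar 6 0) 1 s₁ := by
    have : ((I ++ [[k]]).getD 4 []).getD ((s.setVar 6 0).var 6) 0 = k := by
      rw [List.getD_append_right _ _ _ _ hI.le, hI, State.setVar_same]; rfl
    have h := Exec.read (inp := I ++ [[k]]) 3 4 6 (s.setVar 6 0)
    rwa [this] at h
  have hvar₁ : ∀ v, v ≠ 3 → v ≠ 6 → s₁.var v = s.var v := fun v h h' =>
    (State.setVar_ne _ _ h).trans (State.setVar_ne _ _ h')
  have hslots : s₁.slots 2 = [σ, k] := by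
    change [s₁.var 0, s₁.var 3] = _
    rw [hvar₁ 0 (by norm_num) (by norm_num), hs0, hs₁, State.setVar_same]
  obtain ⟨T₂, hT₂, s₂, h₂, hr₂, hf₂⟩ := exec_lets (I ++ [[k]]) blockExprs 2 s₁
  rw [hslots] at hT₂
  rw [hslots, letsEnv_blockExprs] at hr₂
  have hT₂' := hT₂.trans (letsCost_le (S := blockMarks) (B := 40 * σ) (k := k₁) blockExprs
    (fun e he env h => hk₁ e he _ _ _ hB2 h) _ (by
      rw [letsEnv_blockExprs]; exact envLE_blockEnv hσ k))
  obtain ⟨T₄, hT₄, s₄, h₄, -, hL⟩ := exec_sim (correct_blockHandler (k := k) hσ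
    (hk₂ _ List.mem_cons_self) I hI) h₃ s₂
    ⟨fun v => ((hf₂.var _ (by omega)).trans (hvar₁ _ (by omega) (by omega))).trans (hsim.1 v),
      fun A => (congrFun hf₂.arr _).trans (hsim.2 A)⟩
    ⟨hr₂, by rw [hf₂.out]; exact hout.trans (Function.update_eq_self 2 _).symm⟩
  refine ⟨T₀ + (1 + (1 + (T₂ + T₄))), ?_, s₄, .seq h₀ (.seq (.const _ _ _) (.seq h₁ (.seq h₂ h₄))),
    s'.out, hQ, hL.out⟩
  have e1 : blockExprs.length = 3 := rfl
  rw [e1] at hT₂'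
  have hT1 := exec_pos h₃
  set B := 40 * σ with hB
  have p0 : 1 ≤ B ^ (k₁ + k₂) := Nat.one_le_pow _ _ (by omega)
  have p1 : B ^ k₁ ≤ B ^ (k₁ + k₂) := Nat.pow_le_pow_right (by omega) (by omega)
  have p2 : B ^ k₂ ≤ B ^ (k₁ + k₂) := Nat.pow_le_pow_right (by omega) (by omega)
  have p3 : 40 * B ^ (k₁ + k₂) ≤ B ^ (k₁ + k₂ + 1) := by
    rw [pow_succ, mul_comm]; exact Nat.mul_le_mul_left _ (by omega)
  have p4 : T₄ ≤ (4 * B ^ (k₁ + k₂)) * T :=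
    hT₄.trans (Nat.mul_le_mul (by omega) hT₃)
  have p5 : B ^ (k₁ + k₂) * 1 ≤ B ^ (k₁ + k₂) * T := Nat.mul_le_mul_left _ (by omega)
  have p6 : 1 * t ≤ B ^ (k₁ + k₂) * t := Nat.mul_le_mul_right _ p0
  calc _ ≤ 40 * B ^ (k₁ + k₂) * (T + t) := by
        rw [mul_assoc] at p4
        rw [mul_assoc, mul_add]
        omega
    _ ≤ _ := Nat.mul_le_mul_right _ p3

end

/-! ## Neighbor listing: correctness -/

section

variable {q σ : ℕ+}

/-- The offset of a location in its block. -/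
def blockOff (k : Fin (q * codeLenPos σ : ℕ+)) : Fin (codeLen σ) :=
  ⟨k % codeLen σ, Nat.mod_lt _ (codeLenPos σ).pos⟩

theorem blockPos_inj {i i' : Fin q} {j j' : ℕ} {hj : j < codeLen σ} {hj' : j' < codeLen σ} :
    blockPos i j hj = blockPos i' j' hj' ↔ i = i' ∧ j = j' := by
  have hpos : 0 < codeLen σ := (codeLenPos σ).pos
  refine ⟨fun h => ?_, by rintro ⟨rfl, rfl⟩; rfl⟩
  have h' : (i : ℕ) * codeLen σ + j = i' * codeLen σ + j' := Fin.ext_iff.1 h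
  have e1 := congrArg (· / codeLen σ) h'
  have e2 := congrArg (· % codeLen σ) h'
  simp only [mul_comm _ (codeLen σ), Nat.mul_add_div hpos, Nat.mul_add_mod, Nat.div_eq_of_lt hj,
    Nat.div_eq_of_lt hj', Nat.mod_eq_of_lt hj, Nat.mod_eq_of_lt hj', Nat.add_zero] at e1 e2
  exact ⟨Fin.ext e1, e2⟩

theorem blockPos_blockIdx (k : Fin (q * codeLenPos σ : ℕ+)) :
    blockPos (blockIdx k) (blockOff k) (blockOff k).2 = k :=
  Fin.ext (Nat.div_add_mod' _ _)

end

section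

variable {r : ℕ+ → ℕ+} {τ : ℕ+ → ℝ} (P : CoinPartition r τ) {n q σ : ℕ+}

/-- The answers of the agents for the robust verifier. -/
def blockAnswer (F : P.Answer n q) : P.Answer n (q * codeLenPos σ : ℕ+) := fun u w z k =>
  ((F u w z (blockIdx k)).1.map fun e => (e.1, e.2.1, blockPos e.2.2 (blockOff k) (blockOff k).2),
    (F u w z (blockIdx k)).2)

theorem zipped_blockAnswer (F G : P.Answer n q) (R : Fin (r n) → Bool)
    (k : Fin (q * codeLenPos σ : ℕ+)) :
    P.zipped (blockAnswer P F) (blockAnswer P G) R k = (P.zipped F G R (blockIdx k)).map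
      fun c => (c.1, blockPos c.2 (blockOff k) (blockOff k).2) := by
  simp only [CoinPartition.zipped, CoinPartition.rowAnswer, CoinPartition.colAnswer, blockAnswer,
    List.zipWith_map, List.map_zipWith]

theorem computes_blockAnswer {k K : ℕ} (hk : AgentBound k) (hK : k ≤ K) {pre A : Cmd}
    {x : Fin n → Bool} {T t : ℕ} {F : P.Answer n q}
    (hpre : ∀ (u : Fin (P.own n) → Bool) (w z : Fin (P.shared n) → Bool) (k : ℕ),
      Prepares pre [bits x, bits u, bits w, bits z, [k]] (8 * t) σ)
    (hF : P.Computes A x T F) :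
    P.Computes (blockAgent pre A) x (40 ^ K * σ ^ K * (T + t)) (blockAnswer P (σ := σ) F) := by
  intro u w z k'
  refine (hk pre A [bits x, bits u, bits w, bits z] σ k' t T _ σ.pos rfl (hpre u w z k')
    (hF u w z (blockIdx k'))).mono (Nat.mul_le_mul_right _ (pow_le_pow_mul_pow σ.pos hK)) ?_
  rintro _ ⟨o, ⟨h0, h1, h2, h3⟩, rfl⟩
  refine ⟨?_, ?_, ?_, ?_⟩
  · rw [Function.update_of_ne (by norm_num), h0, blockAnswer, List.flatMap_map]
  · rw [Function.update_of_ne (by norm_num), h1, blockAnswer, List.flatMap_map]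
  · rw [Function.update_self, h2, blockAnswer, List.map_map, List.map_map]
    rfl
  · rw [Function.update_of_ne (by norm_num), h3, blockAnswer]

end

section

variable {r q m d t σ : ℕ+ → ℕ+} (V : Verifier r q m d t σ)

/-- A location determines its block and its offset, and the offset of a location is that of the
query itself. -/
theorem neighbors_robustVerifier {k K : ℕ} (hk : ProgBound k) (h3 : 3 ≤ K) (hK : k ≤ K) {n : ℕ+}
    (x : Fin n → Bool) (R R' : Fin (r n) → Bool) (i i' : Fin (q n * codeLenPos (σ n) : ℕ+)) :
    (robustVerifier V hk h3 hK).Neighbors x (R, i) (R', i') ↔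
      V.Neighbors x (R, blockIdx i) (R', blockIdx i') ∧ blockOff i = blockOff i' :=
  (blockPos_inj (hj := (blockOff i).2) (hj' := (blockOff i').2)).trans (and_congr_right fun _ =>
    (Fin.ext_iff (a := blockOff i) (b := blockOff i')).symm)

/-- With the offset fixed, the new neighbors of a configuration are in order-preserving bijection
with the old neighbors of its block configuration. Lists are mapped entrywise, and the agents'
indices stay as they are. -/
theorem hasRNL_robustVerifier {k k' K : ℕ} (hk : ProgBound k) (h3 : 3 ≤ K) (hK : k ≤ K)
    (hk' : AgentBound k') (hK' : k' ≤ K) {τ : ℕ+ → ℝ} {P : CoinPartition r τ} {T : ℕ+ → ℕ}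
    (hV : V.HasRNL P T) {pre : Cmd} {t' : ℕ+ → ℕ}
    (hpre : ∀ (n : ℕ+) (x : Fin n → Bool) (u : Fin (P.own n) → Bool)
      (w z : Fin (P.shared n) → Bool) (k : ℕ),
      Prepares pre [bits x, bits u, bits w, bits z, [k]] (8 * t' n) (σ n)) :
    (robustVerifier V hk h3 hK).HasRNL P fun n => 40 ^ K * σ n ^ K * (T n + t' n) := by
  obtain ⟨A, A', hA⟩ := hV
  refine ⟨blockAgent pre A, blockAgent pre A', fun n x => ?_⟩
  obtain ⟨F, G, hF, hG, h⟩ := hA n x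
  refine ⟨blockAnswer P F, blockAnswer P G, computes_blockAnswer P hk' hK' (hpre n x) hF,
    computes_blockAnswer P hk' hK' (hpre n x) hG, fun R i => ?_⟩
  obtain ⟨h1, h2, h4, h5, h6, h7⟩ := h R (blockIdx i)
  rw [zipped_blockAnswer]
  refine ⟨?_, ?_, ?_, ?_, ?_, ?_⟩
  · have := congrArg (List.map fun k => blockPos k (blockOff i) (blockOff i).2) h1
    simpa only [CoinPartition.rowAnswer, CoinPartition.colAnswer, blockAnswer, List.map_map,
      Function.comp_def] using this
  · refine h2.map fun c c' hc => ?_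
    obtain ⟨h1, h2⟩ := Prod.ext_iff.1 hc
    exact Prod.ext h1 ((blockPos_inj (hj := (blockOff i).2) (hj' := (blockOff i).2)).1 h2).1
  · rintro ⟨R', i'⟩
    rw [List.mem_map, neighbors_robustVerifier]
    constructor
    · rintro ⟨c, hc, heq⟩
      obtain ⟨rfl, hi⟩ := Prod.ext_iff.1 heq
      have hi' := hi.trans (blockPos_blockIdx i').symm
      obtain ⟨e1, e2⟩ := (blockPos_inj (hj := (blockOff i).2) (hj' := (blockOff i').2)).1 hi'
      exact ⟨by rw [← e1]; exact (h4 c).1 hc, Fin.ext e2⟩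
    · rintro ⟨hn, hoff⟩
      refine ⟨(R', blockIdx i'), (h4 _).2 hn, Prod.ext rfl ?_⟩
      simp only [hoff]
      exact blockPos_blockIdx i'
  · intro R' i' hn
    obtain ⟨hn, hoff⟩ := (neighbors_robustVerifier V hk h3 hK x R R' i i').1 hn
    rw [zipped_blockAnswer, h5 _ _ hn, hoff]
  · change (List.map _ _)[(P.rowAnswer F R (blockIdx i)).2]? = _
    rw [List.getElem?_map, h6, Option.map_some, blockPos_blockIdx]
  · change (List.map _ _)[(P.colAnswer G R (blockIdx i)).2]? = _
    rw [List.getElem?_map, h7, Option.map_some, blockPos_blockIdx]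

/-- The real fractions `(1 - τ) r / 2` and `τ r / 2` add up to `r / 2`, whatever `τ` is. -/
theorem CoinPartition.own_add_shared {τ : ℕ+ → ℝ} (P : CoinPartition r τ) (n : ℕ+) :
    (r n : ℕ) = P.own n + P.shared n + (P.own n + P.shared n) := by
  have h := P.own_eq n
  have h' := P.shared_eq n
  have : ((r n : ℕ) : ℝ) = (P.own n + P.shared n + (P.own n + P.shared n) : ℕ) := by
    push_cast
    rw [h, h']
    ring
  exact_mod_cast this

theorem prepares_probeProg_verifier {τ : ℕ+ → ℝ} (P : CoinPartition r τ) {n : ℕ+}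
    (x : Fin n → Bool) (u : Fin (P.own n) → Bool) (w z : Fin (P.shared n) → Bool) (k : ℕ) :
    Prepares (probeProg V.prog) [bits x, bits u, bits w, bits z, [k]] (8 * t n) (σ n) := by
  have h := V.run x fun _ => false
  have hbits : bits (fun _ : Fin (r n) => false) = List.replicate (r n) 0 := by
    rw [bits, List.ofFn_const]; rfl
  rw [hbits] at h
  refine prepares_probeProg (r := r n) (q n).pos (σ n).pos ?_ h List.length_ofFn
  rw [bits, bits, List.length_ofFn, List.length_ofFn]
  exact P.own_add_shared n

end

end RobustPCP

end

/-! ### The choice of the constants -/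

theorem lemma5p3 :
    -- the implied constants are universal
    ∃ (δ : ℝ) (C : ℕ+) (c : ℕ), 0 < δ ∧ δ ≤ 1 ∧
      ∀ (L : Language Bool) (r q m d t σ : ℕ+ → ℕ+) (s ρ : ℕ+ → ℝ)
        (V : RobustPCP.Verifier r q m d t σ),
        (∀ n, s n ∈ Set.Icc (0 : ℝ) 1) → (∀ n, ρ n ∈ Set.Icc (0 : ℝ) 1) →
        V.IsRobustPCP L s ρ →
        ∃ (b : ℕ+ → ℕ+) (V' : RobustPCP.Verifier r (fun n => q n * b n) (fun n => m n * b n)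
            (fun n => C * σ n ^ c * d n) (fun n => C * σ n ^ c * t n) (fun _ => 1)),
          (∀ n, b n ≤ C * σ n) ∧
          V'.IsRobustPCP L s (fun n => δ * ρ n) ∧
          ∀ (τ : ℕ+ → ℝ) (P : RobustPCP.CoinPartition r τ) (T : ℕ+ → ℕ),
            (∀ n, τ n ∈ Set.Ico (0 : ℝ) 1) → V.HasRNL P T →
            V'.HasRNL P (fun n => C * σ n ^ c * (T n + t n)) ∧
            ∀ Tσ : ℕ+ → ℕ, RobustPCP.ComputableInTime σ Tσ →
              V'.HasRNL P (fun n => C * σ n ^ c * (T n + Tσ n)) := by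
  obtain ⟨k, hk⟩ := RobustPCP.exists_progBound
  obtain ⟨k', hk'⟩ := RobustPCP.exists_agentBound
  have h3 : 3 ≤ k + k' + 3 := Nat.le_add_left _ _
  have hK : k ≤ k + k' + 3 := by omega
  have hK' : k' ≤ k + k' + 3 := by omega
  -- All bounds are powers of `40 * σ`, so `C = 40 ^ c`. The exponent covers the program, the agents
  -- and the cube in the circuit size.
  refine ⟨1 / 288, 40 ^ (k + k' + 3), k + k' + 3, by norm_num, by norm_num,
    fun L r q m d t σ s ρ V _ _ hV => ⟨fun n => RobustPCP.codeLenPos (σ n),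
      RobustPCP.robustVerifier V hk h3 hK, fun n => ?_,
      RobustPCP.isRobustPCP_robustVerifier V hk h3 hK hV, fun τ P T _ hR => ⟨?_, ?_⟩⟩⟩
  · rw [← PNat.coe_le_coe]
    push_cast
    refine (RobustPCP.codeLen_le (σ n).pos).trans (Nat.mul_le_mul_right _ ?_)
    -- The length is at most `33 * σ`, and `33 ≤ 40 ≤ C`.
    exact le_trans (by norm_num) (Nat.le_self_pow (by omega) 40)
  · have := RobustPCP.hasRNL_robustVerifier V hk h3 hK hk' hK' hR (t' := fun n => t n)
      fun n x => RobustPCP.prepares_probeProg_verifier V P x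
    simpa only [PNat.pow_coe, PNat.val_ofNat] using this
  · rintro Tσ ⟨A, hA⟩
    have := RobustPCP.hasRNL_robustVerifier V hk h3 hK hk' hK' hR (t' := Tσ)
      fun n x u w z k => RobustPCP.prepares_of_haltsWithin (σ n).pos (hA n x)
    simpa only [PNat.pow_coe, PNat.val_ofNat] using this
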